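/- **Theorem (Preservation for processes of the internal language of Gradual GV).** Let $\Gamma$ be an environment in which the names of linear type are exactly the channel endpoints, and let $P$ be a process in which all types annotating casts are regular. If $\Gamma\vdash P$ and $P\longrightarrow Q$, then $\Gamma\vdash Q$, and all types annotating casts in $Q$ are again regular. The language is the following. *Types.* Multiplicities $m,n::=\mathsf{un}\mid\mathsf{lin}$, ordered by $\mathsf{un}\le\mathsf{un}\le\mathsf{lin}\le\mathsf{lin}$. Types $T,U::=\mathsf{unit}\mid S\mid T\to_m U\mid T\times_m U\mid\star$. Session types $S,R::={!}T.S\mid{?}T.S\mid\oplus\{l_i{:}S_i\}_{i\in I}\mid\&\{l_i{:}S_i\}_{i\in I}\mid\mathsf{end}_!\mid\mathsf{end}_?\mid\circledast$, with $I$ finite and non-empty. Here $\star$ is the dynamic type and $\circledast$ the dynamic session type. The dual $\overline S$ exchanges $!$ with $?$, $\oplus$ with $\&$, $\mathsf{end}_!$ with $\mathsf{end}_?$, leaves message types unchanged, is applied to all residuals, and $\overline{\circledast}=\circledast$. The types $\mathsf{unit},\star$ are unrestricted, session types are linear, and $T\to_mU$, $T\times_mU$ have multiplicity $m$; write $m(T)$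 if $T$ has multiplicity $m$, and $m^{\ge}(T)$ if the multiplicity of $T$ is $\le m$; both extend to environments pointwise. A type is *regular* if $\mathsf{un}(T)$ and $\mathsf{un}(U)$ for every product $T\times_{\mathsf{un}}U$ occurring in it. Subtyping $T<:U$ is the least relation that relates $\mathsf{unit},\mathsf{end}_!,\mathsf{end}_?,\star,\circledast$ to themselves and is contravariant in domains of functions and in message types of $!$, covariant in all other components and in multiplicities, with $\oplus\{l_i{:}S_i\}_{I}<:\oplus\{l_j{:}R_j\}_{J}$ if $J\subseteq I$ and $S_j<:R_j$ for $j\in J$, and $\&\{l_i{:}S_i\}_{I}<:\&\{l_j{:}R_j\}_{J}$ if $I\subseteq J$ and $S_i<:R_i$ for $i\in I$. Consistent subtyping $T\lesssim U$ has the same rules and in addition $\star\lesssim T$, $T\lesssim\star$, $\circledast\lesssim S$, $S\lesssim\circledast$. Consistency $T\sim U$ means $T\lesssim U$ and $U\lesssim T$. Ground types: $\mathbb T,\mathbb U::=\mathsf{unit}\mid\circledast\mid\star\to_m\star\mid\star\times_m\star$. Ground session types: $\mathbb S,\mathbb R::={!}\star.\circledast\mid{?}\star.\circledast\mid\oplus\{l_i{:}\circledast\}_{I}\mid\&\{l_i{:}\circledast\}_{I}\mid\mathsf{end}_!\mid\mathsf{end}_?$.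 *Expressions.* Names $z$ are term variables $x,y$, channel endpoints $c,d$ or references $a,b$. Blame labels $p,q$ have a polarity, which $\overline p$ reverses. Expressions $e,f::=z\mid()\mid\lambda_mx.e\mid e\,f\mid(e,f)_m\mid\mathsf{let}\,x,y=e\,\mathsf{in}\,f\mid\mathsf{fork}\,e\mid\mathsf{new}\mid\mathsf{send}\,e\,f\mid\mathsf{receive}\,e\mid\mathsf{select}\,l\,e\mid\mathsf{case}\,e\,\mathsf{of}\{l_i{:}x_i.e_i\}_{I}\mid\mathsf{close}\,e\mid\mathsf{wait}\,e\mid e:T\Rightarrow^pU$; $\mathsf{let}\,x=e\,\mathsf{in}\,f$ abbreviates $(\lambda_{\mathsf{lin}}x.f)\,e$. Values $v,w::=()\mid\lambda_mx.e\mid(v,w)_m\mid c\mid a\mid v:\mathbb T\Rightarrow^p\star\ (\mathsf{un}(\mathbb T))\mid v:\mathbb S\Rightarrow^p\circledast\mid v:T\to_mU\Rightarrow^pT'\to_nU'\mid v:S\Rightarrow^pR\ (S,R\ne\circledast)$. Evaluation contexts $E,F::=[\,]\mid E\,e\mid v\,E\mid(E,e)_m\mid(v,E)_m\mid\mathsf{let}\,x,y=E\,\mathsf{in}\,e\mid\mathsf{send}\,E\,e\mid\mathsf{send}\,v\,E\mid\mathsf{receive}\,E\mid\mathsf{select}\,l\,E\mid\mathsf{case}\,E\,\mathsf{of}\{l_i{:}x_i.e_i\}_I\mid\mathsf{close}\,E\mid\mathsf{wait}\,E\mid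 E:T\Rightarrow^pU$. Processes $P,Q::=\langle e\rangle\mid P\mid Q\mid(\nu c,d)P\mid(\nu a)P\mid a\mapsto w:\mathbb T\Rightarrow^p\star\mid a\mapsto\mathsf{locked}\,p\mid\mathsf{blame}\,p\,q\,X\mid\mathsf{blame}\,p\,X$, with $X$ a finite set of names. Syntax is taken up to renaming of bound names, and bound names are chosen fresh. *Typing.* An environment $\Gamma$ maps names to types. $\Gamma=\Gamma_1\circ\Gamma_2$ means that every name of unrestricted type in $\Gamma$ is in both parts and every name of linear type is in exactly one, with the same types. $\mathrm{flv}(\Gamma)$ is the set of names of linear type in $\Gamma$; $\mathrm{flv}(e)$ and $\mathrm{flv}(E)$ are the sets of free channel endpoints. Expressions: - $\Gamma,z{:}T\vdash z:T$, $\Gamma\vdash():\mathsf{unit}$ and $\Gamma\vdash\mathsf{new}:S\times_{\mathsf{lin}}\overline S$ if $\mathsf{un}(\Gamma)$; - $\Gamma\vdash\lambda_mx.e:T\to_mU$ if $\Gamma,x{:}T\vdash e:U$ and $m^{\ge}(\Gamma)$; - $\Gamma\circ\Delta\vdash e\,f:U$ if $\Gamma\vdash e:T\to_mU$ and $\Delta\vdash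 f:T$; - $\Gamma\circ\Delta\vdash(e,f)_m:T\times_mU$ if $\Gamma\vdash e:T$, $\Delta\vdash f:U$, $m^{\ge}(T)$ and $m^{\ge}(U)$; - $\Gamma\circ\Delta\vdash\mathsf{let}\,x,y=e\,\mathsf{in}\,f:U$ if $\Gamma\vdash e:T_1\times_mT_2$ and $\Delta,x{:}T_1,y{:}T_2\vdash f:U$; - $\Gamma\vdash\mathsf{fork}\,e:\mathsf{unit}$ if $\Gamma\vdash e:\mathsf{unit}$; - $\Gamma\circ\Delta\vdash\mathsf{send}\,e\,f:S$ if $\Gamma\vdash e:T$ and $\Delta\vdash f:{!}T.S$; - $\Gamma\vdash\mathsf{receive}\,e:T\times_{\mathsf{lin}}S$ if $\Gamma\vdash e:{?}T.S$; - $\Gamma\vdash\mathsf{select}\,l_j\,e:S_j$ if $\Gamma\vdash e:\oplus\{l_i{:}S_i\}_I$ and $j\in I$; - $\Gamma\circ\Delta\vdash\mathsf{case}\,e\,\mathsf{of}\{l_i{:}x_i.e_i\}_I:T$ if $\Gamma\vdash e:\&\{l_i{:}S_i\}_I$ and $\Delta,x_i{:}S_i\vdash e_i:T$ for all $i\in I$;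 - $\Gamma\vdash\mathsf{close}\,e:\mathsf{unit}$ if $\Gamma\vdash e:\mathsf{end}_!$, and $\Gamma\vdash\mathsf{wait}\,e:\mathsf{unit}$ if $\Gamma\vdash e:\mathsf{end}_?$; - $\Gamma\vdash(e:T\Rightarrow^pU):U$ if $\Gamma\vdash e:T$ and $T\lesssim U$; - $\Gamma\vdash e:U$ if $\Gamma\vdash e:T$ and $T<:U$. Processes: - $\Gamma\vdash\langle e\rangle$ if $\Gamma\vdash e:T$ and $\mathsf{un}(T)$; - $\Gamma\circ\Delta\vdash P\mid Q$ if $\Gamma\vdash P$ and $\Delta\vdash Q$; - $\Gamma\vdash(\nu c,d)P$ if $\Gamma,c{:}S,d{:}\overline S\vdash P$, and $\Gamma\vdash(\nu a)P$ if $\Gamma,a{:}\star\vdash P$; - $\Gamma\circ\Delta\vdash a\mapsto w:\mathbb T\Rightarrow^p\star$ if $\Gamma\vdash a:\star$, $\Delta\vdash w:\mathbb T$ and $\mathsf{lin}(\mathbb T)$; - $\Gamma\vdash a\mapsto\mathsf{locked}\,p$ if $\Gamma\vdash a:\star$; - $\Gamma\vdash\mathsf{blame}\,p\,q\,X$ and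 $\Gamma\vdash\mathsf{blame}\,p\,X$ if $\mathrm{flv}(\Gamma)=X$. *Reduction of expressions.* - $(\lambda_mx.e)\,v\to e[v/x]$ and $\mathsf{let}\,x,y=(v,w)_m\,\mathsf{in}\,e\to e[v/x][w/y]$; - $v:T\Rightarrow^pT\to v$ for $T\in\{\star,\circledast,\mathsf{unit}\}$; - $(v:T\to_mU\Rightarrow^pT'\to_nU')\,w\to(v\,(w:T'\Rightarrow^{\overline p}T)):U\Rightarrow^pU'$; - $(v,w)_m:T\times_mU\Rightarrow^pT'\times_nU'\to(v:T\Rightarrow^pT',\,w:U\Rightarrow^pU')_n$; - $\mathsf{send}\,v\,(w:{!}T.S\Rightarrow^p{!}T'.S')\to(\mathsf{send}\,(v:T'\Rightarrow^{\overline p}T)\,w):S\Rightarrow^pS'$; - $\mathsf{receive}\,(w:{?}T.S\Rightarrow^p{?}T'.S')\to(\mathsf{receive}\,w):T\times_{\mathsf{lin}}S\Rightarrow^pT'\times_{\mathsf{lin}}S'$; - $\mathsf{select}\,l_k\,(w:\oplus\{l_i{:}R_i\}_I\Rightarrow^p\oplus\{l_j{:}S_j\}_J)\to(\mathsf{select}\,l_k\,w):R_k\Rightarrow^pS_k$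 if $k\in J\subseteq I$; - $\mathsf{case}\,(w:\&\{l_i{:}R_i\}_I\Rightarrow^p\&\{l_j{:}S_j\}_J)\,\mathsf{of}\{l_j{:}x_j.e_j\}_J\to\mathsf{case}\,w\,\mathsf{of}\{l_i{:}x_i.\,\mathsf{let}\,x_i=(x_i:R_i\Rightarrow^pS_i)\,\mathsf{in}\,e_i\}_I$ if $I\subseteq J$; - $\mathsf{close}\,(v:\mathsf{end}_!\Rightarrow^p\mathsf{end}_!)\to\mathsf{close}\,v$ and $\mathsf{wait}\,(v:\mathsf{end}_?\Rightarrow^p\mathsf{end}_?)\to\mathsf{wait}\,v$; - if $T\ne\star$, $T\ne\mathbb T$, $T\sim\mathbb T$: $v:T\Rightarrow^p\star\to(v:T\Rightarrow^p\mathbb T):\mathbb T\Rightarrow^p\star$ and $v:\star\Rightarrow^pT\to(v:\star\Rightarrow^p\mathbb T):\mathbb T\Rightarrow^pT$; - if $S\ne\circledast$, $S\ne\mathbb S$, $S\sim\mathbb S$: the same two rules with $S,\mathbb S,\circledast$ for $T,\mathbb T,\star$. *Structural congruence* $\equiv$ is the least congruence such that $\mid$ is commutative and associative, $P\mid\langle()\rangle\equiv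 P$, $(\nu c,d)P\equiv(\nu d,c)P$, restrictions of endpoints and of references commute with each other, and $((\nu c,d)P)\mid Q\equiv(\nu c,d)(P\mid Q)$ if $c,d$ are not free in $Q$, $((\nu a)P)\mid Q\equiv(\nu a)(P\mid Q)$ if $a$ is not free in $Q$. *Reduction of processes* is closed under $\mid$, $(\nu c,d)$, $(\nu a)$ and $\equiv$, has $\langle E[e]\rangle\to\langle E[f]\rangle$ if $e\to f$, and has the axioms - $\langle E[\mathsf{fork}\,e]\rangle\to\langle E[()]\rangle\mid\langle e\rangle$; - $\langle E[\mathsf{new}]\rangle\to(\nu c,d)\langle E[(c,d)_{\mathsf{lin}}]\rangle$; - $(\nu c,d)(\langle E[\mathsf{send}\,v\,c]\rangle\mid\langle F[\mathsf{receive}\,d]\rangle)\to(\nu c,d)(\langle E[c]\rangle\mid\langle F[(v,d)_{\mathsf{lin}}]\rangle)$; - $(\nu c,d)(\langle E[\mathsf{select}\,l_j\,c]\rangle\mid\langle F[\mathsf{case}\,d\,\mathsf{of}\{l_i{:}x_i.e_i\}_I]\rangle)\to(\nu c,d)(\langle E[c]\rangle\mid\langle F[e_j[d/x_j]]\rangle)$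 if $j\in I$; - $(\nu c,d)(\langle E[\mathsf{close}\,c]\rangle\mid\langle F[\mathsf{wait}\,d]\rangle)\to\langle E[()]\rangle\mid\langle F[()]\rangle$ ($c,d$ not free in $E,F$); - $\langle E[v:\mathbb T\Rightarrow^p\star]\rangle\to(\nu a)(\langle E[a]\rangle\mid a\mapsto v:\mathbb T\Rightarrow^p\star)$ if $\mathsf{lin}(\mathbb T)$ and $E$ is not of the form $F[[\,]:\star\Rightarrow^q\mathbb U]$; - $\langle E[a:\star\Rightarrow^q\mathbb U]\rangle\mid a\mapsto v:\mathbb T\Rightarrow^p\star\to\langle E[(v:\mathbb T\Rightarrow^p\star):\star\Rightarrow^q\mathbb U]\rangle\mid a\mapsto\mathsf{locked}\,p$; - $\langle E[a:\star\Rightarrow^q\mathbb U]\rangle\mid a\mapsto\mathsf{locked}\,p\to\mathsf{blame}\,\overline p\,q\,\mathrm{flv}(E)\mid a\mapsto\mathsf{locked}\,p$; - $(\nu a)(a\mapsto\mathsf{locked}\,p)\to\langle()\rangle$ and $(\nu a)(a\mapsto w:\mathbb T\Rightarrow^p\star)\to\mathsf{blame}\,\overline p\,\mathrm{flv}(w)$;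 - $\langle E[(v:\mathbb T\Rightarrow^p\star):\star\Rightarrow^q\mathbb U]\rangle\to\langle E[v]\rangle$ if $\mathbb T<:\mathbb U$, and $\to\mathsf{blame}\,\overline p\,q\,(\mathrm{flv}(E)\cup\mathrm{flv}(v))$ if not; - $\langle E[(v:\mathbb S\Rightarrow^p\circledast):\circledast\Rightarrow^q\mathbb R]\rangle\to\langle E[v]\rangle$ if $\mathbb S<:\mathbb R$, and $\to\mathsf{blame}\,\overline p\,q\,(\mathrm{flv}(E)\cup\mathrm{flv}(v))$ if not; - $(\nu c,d)(\langle E[c:\circledast\Rightarrow^p\mathbb S]\rangle\mid\langle F[d:\circledast\Rightarrow^q\mathbb R]\rangle)\to(\nu c,d)(\langle E[c]\rangle\mid\langle F[d]\rangle)$ if $\overline{\mathbb S}<:\mathbb R$, and $\to(\nu c,d)\,\mathsf{blame}\,p\,q\,(\mathrm{flv}(E)\cup\mathrm{flv}(F)\cup\{c,d\})$ if not. -/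

import Mathlib

/-!
The internal language of Gradual GV: types, expressions, processes, typing and reduction.

Syntax is taken up to renaming of bound names, by de Bruijn indices.  There are three separate
index spaces: term variables (bound by abstraction, pair destruction and case branches), channel
endpoints (bound in pairs by the endpoint restriction) and references (bound by the reference
restriction).  A restriction of a pair of endpoints `c, d` binds index 0 for `c` and index 1 for
`d`.  Pair destruction binding `x, y` binds index 1 for `x` and index 0 for `y`.
-/

namespace GGV

/-! ### Multiplicities, labels, types -/

inductive Mult
  | un
  | lin

/-- The ordering of multiplicities. -/
inductive Mult.Le : Mult → Mult → Prop
  | un_un : Mult.Le .un .un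
  | un_lin : Mult.Le .un .lin
  | lin_lin : Mult.Le .lin .lin

/-- Labels of selections and case choices. -/
abbrev Label := ℕ

/-- Blame labels carry a polarity. -/
structure BLabel where
  id : ℕ
  positive : Bool

/-- Complement of a blame label. -/
def BLabel.compl (p : BLabel) : BLabel := ⟨p.id, !p.positive⟩

mutual
/-- Types. -/
inductive Ty
  | unit : Ty
  | sess : STy → Ty
  | fn : Mult → Ty → Ty → Ty
  | prod : Mult → Ty → Ty → Ty
  | dyn : Ty
/-- Session types.  Label sets of selections and choices are finite and non-empty. -/
inductive STy
  | send : Ty → STy → STy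
  | recv : Ty → STy → STy
  | select (I : Finset Label) (hI : I.Nonempty) (S : {l // l ∈ I} → STy) : STy
  | choice (I : Finset Label) (hI : I.Nonempty) (S : {l // l ∈ I} → STy) : STy
  | close : STy
  | wait : STy
  | dc : STy
end

/-- Duality of session types. -/
def STy.dual : STy → STy
  | .send T S => .recv T S.dual
  | .recv T S => .send T S.dual
  | .select I hI S => .choice I hI (fun i => (S i).dual)
  | .choice I hI S => .select I hI (fun i => (S i).dual)
  | .close => .wait
  | .wait => .close
  | .dc => .dc

/-- The multiplicity of a type. -/
def Ty.mult : Ty → Mult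
  | .unit => .un
  | .sess _ => .lin
  | .fn m _ _ => m
  | .prod m _ _ => m
  | .dyn => .un

/-- `T` is unrestricted. -/
def Ty.Un (T : Ty) : Prop := T.mult = .un

/-- `T` is linear. -/
def Ty.Lin (T : Ty) : Prop := T.mult = .lin

/-- `T` has some multiplicity below `n`. -/
def Ty.Below (n : Mult) (T : Ty) : Prop := T.mult.Le n

/-- Subtyping.  Session types are types, so the relation is defined on types at once. -/
inductive Sub : Ty → Ty → Prop
  | unit : Sub .unit .unit
  | fn {T U T' U' : Ty} {m n : Mult} :
      Sub T' T → Sub U U' → m.Le n → Sub (.fn m T U) (.fn n T' U')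
  | prod {T U T' U' : Ty} {m n : Mult} :
      Sub T T' → Sub U U' → m.Le n → Sub (.prod m T U) (.prod n T' U')
  | send {T T' : Ty} {S S' : STy} :
      Sub T' T → Sub (.sess S) (.sess S') → Sub (.sess (.send T S)) (.sess (.send T' S'))
  | recv {T T' : Ty} {S S' : STy} :
      Sub T T' → Sub (.sess S) (.sess S') → Sub (.sess (.recv T S)) (.sess (.recv T' S'))
  | select {I J : Finset Label} {hI : I.Nonempty} {hJ : J.Nonempty}
      {S : {l // l ∈ I} → STy} {R : {l // l ∈ J} → STy} (h : J ⊆ I) :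
      (∀ j : {l // l ∈ J}, Sub (.sess (S ⟨j, h j.2⟩)) (.sess (R j))) →
      Sub (.sess (.select I hI S)) (.sess (.select J hJ R))
  | choice {I J : Finset Label} {hI : I.Nonempty} {hJ : J.Nonempty}
      {S : {l // l ∈ I} → STy} {R : {l // l ∈ J} → STy} (h : I ⊆ J) :
      (∀ i : {l // l ∈ I}, Sub (.sess (S i)) (.sess (R ⟨i, h i.2⟩))) →
      Sub (.sess (.choice I hI S)) (.sess (.choice J hJ R))
  | close : Sub (.sess .close) (.sess .close)
  | wait : Sub (.sess .wait) (.sess .wait)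
  | dyn : Sub .dyn .dyn
  | dc : Sub (.sess .dc) (.sess .dc)

/-- Consistent subtyping. -/
inductive CSub : Ty → Ty → Prop
  | unit : CSub .unit .unit
  | fn {T U T' U' : Ty} {m n : Mult} :
      CSub T' T → CSub U U' → m.Le n → CSub (.fn m T U) (.fn n T' U')
  | prod {T U T' U' : Ty} {m n : Mult} :
      CSub T T' → CSub U U' → m.Le n → CSub (.prod m T U) (.prod n T' U')
  | dyn_left (T : Ty) : CSub .dyn T
  | dyn_right (T : Ty) : CSub T .dyn
  | send {T T' : Ty} {S S' : STy} :
      CSub T' T → CSub (.sess S) (.sess S') → CSub (.sess (.send T S)) (.sess (.send T' S'))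
  | recv {T T' : Ty} {S S' : STy} :
      CSub T T' → CSub (.sess S) (.sess S') → CSub (.sess (.recv T S)) (.sess (.recv T' S'))
  | select {I J : Finset Label} {hI : I.Nonempty} {hJ : J.Nonempty}
      {S : {l // l ∈ I} → STy} {R : {l // l ∈ J} → STy} (h : J ⊆ I) :
      (∀ j : {l // l ∈ J}, CSub (.sess (S ⟨j, h j.2⟩)) (.sess (R j))) →
      CSub (.sess (.select I hI S)) (.sess (.select J hJ R))
  | choice {I J : Finset Label} {hI : I.Nonempty} {hJ : J.Nonempty}
      {S : {l // l ∈ I} → STy} {R : {l // l ∈ J} → STy} (h : I ⊆ J) :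
      (∀ i : {l // l ∈ I}, CSub (.sess (S i)) (.sess (R ⟨i, h i.2⟩))) →
      CSub (.sess (.choice I hI S)) (.sess (.choice J hJ R))
  | close : CSub (.sess .close) (.sess .close)
  | wait : CSub (.sess .wait) (.sess .wait)
  | dc_left (S : STy) : CSub (.sess .dc) (.sess S)
  | dc_right (S : STy) : CSub (.sess S) (.sess .dc)

/-- Consistency of types. -/
def Consistent (T U : Ty) : Prop := CSub T U ∧ CSub U T

/-- Ground types. -/
inductive Ground
  | unit : Ground
  | dc : Ground
  | fn : Mult → Ground
  | prod : Mult → Ground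

/-- A ground type as a type. -/
def Ground.ty : Ground → Ty
  | .unit => .unit
  | .dc => .sess .dc
  | .fn m => .fn m .dyn .dyn
  | .prod m => .prod m .dyn .dyn

/-- Ground session types. -/
inductive GroundS
  | send : GroundS
  | recv : GroundS
  | select (I : Finset Label) (hI : I.Nonempty) : GroundS
  | choice (I : Finset Label) (hI : I.Nonempty) : GroundS
  | close : GroundS
  | wait : GroundS

/-- A ground session type as a session type. -/
def GroundS.sty : GroundS → STy
  | .send => .send .dyn .dc
  | .recv => .recv .dyn .dc
  | .select I hI => .select I hI (fun _ => .dc)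
  | .choice I hI => .choice I hI (fun _ => .dc)
  | .close => .close
  | .wait => .wait

mutual
/-- Unrestricted data do not contain linear data: both components of every unrestricted product
type occurring in the type are unrestricted. -/
def Ty.Regular : Ty → Prop
  | .unit => True
  | .sess S => S.Regular
  | .fn _ T U => T.Regular ∧ U.Regular
  | .prod m T U => T.Regular ∧ U.Regular ∧ (m = .un → T.Un ∧ U.Un)
  | .dyn => True
/-- The same condition on session types. -/
def STy.Regular : STy → Prop
  | .send T S => T.Regular ∧ S.Regular
  | .recv T S => T.Regular ∧ S.Regular
  | .select _ _ S => ∀ i, (S i).Regular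
  | .choice _ _ S => ∀ i, (S i).Regular
  | .close => True
  | .wait => True
  | .dc => True
end

/-! ### Names and expressions -/

/-- Names: term variables, channel endpoints and references. -/
inductive Name
  | var : ℕ → Name
  | chan : ℕ → Name
  | ref : ℕ → Name
  deriving DecidableEq

/-- Channel endpoints among the names. -/
def Name.IsChan : Name → Prop
  | .chan _ => True
  | _ => False

/-- Expressions. -/
inductive Exp
  | name : Name → Exp
  | unit : Exp
  | lam : Mult → Exp → Exp
  | app : Exp → Exp → Exp
  | pair : Mult → Exp → Exp → Exp
  | letPair : Exp → Exp → Exp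
  | fork : Exp → Exp
  | new : Exp
  | send : Exp → Exp → Exp
  | recv : Exp → Exp
  | select : Label → Exp → Exp
  | branch (e : Exp) (I : Finset Label) (f : {l // l ∈ I} → Exp) : Exp
  | close : Exp → Exp
  | wait : Exp → Exp
  | cast (e : Exp) (T : Ty) (p : BLabel) (U : Ty) : Exp

/-- Renamings of names, one function for each of the three sorts. -/
structure Ren where
  var : ℕ → ℕ
  chan : ℕ → ℕ
  ref : ℕ → ℕ

/-- Renaming of a name. -/
def Ren.app (r : Ren) : Name → Name
  | .var n => .var (r.var n)
  | .chan n => .chan (r.chan n)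
  | .ref n => .ref (r.ref n)

/-- The renaming under the binder of one term variable. -/
def Ren.upVar (r : Ren) : Ren :=
  { r with var := fun | 0 => 0 | n + 1 => r.var n + 1 }

/-- The renaming under the binder of a pair of channel endpoints. -/
def Ren.upChan (r : Ren) : Ren :=
  { r with chan := fun | 0 => 0 | 1 => 1 | n + 2 => r.chan n + 2 }

/-- The renaming under the binder of one reference. -/
def Ren.upRef (r : Ren) : Ren :=
  { r with ref := fun | 0 => 0 | n + 1 => r.ref n + 1 }

/-- Make room for one more term variable. -/
def Ren.shiftVar : Ren := ⟨fun n => n + 1, id, id⟩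

/-- Make room for one more pair of channel endpoints. -/
def Ren.shiftChan : Ren := ⟨id, fun n => n + 2, id⟩

/-- Make room for one more reference. -/
def Ren.shiftRef : Ren := ⟨id, id, fun n => n + 1⟩

/-- Exchange the two endpoints bound by the innermost endpoint restriction. -/
def Ren.swapEnds : Ren := ⟨id, fun | 0 => 1 | 1 => 0 | n + 2 => n + 2, id⟩

/-- Exchange the endpoints bound by the two innermost endpoint restrictions. -/
def Ren.swapChans : Ren :=
  ⟨id, fun | 0 => 2 | 1 => 3 | 2 => 0 | 3 => 1 | n + 4 => n + 4, id⟩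

/-- Exchange the references bound by the two innermost reference restrictions. -/
def Ren.swapRefs : Ren := ⟨id, id, fun | 0 => 1 | 1 => 0 | n + 2 => n + 2⟩

/-- Renaming of the free names of an expression. -/
def Exp.rename : Ren → Exp → Exp
  | r, .name z => .name (r.app z)
  | _, .unit => .unit
  | r, .lam m e => .lam m (e.rename r.upVar)
  | r, .app e f => .app (e.rename r) (f.rename r)
  | r, .pair m e f => .pair m (e.rename r) (f.rename r)
  | r, .letPair e f => .letPair (e.rename r) (f.rename r.upVar.upVar)
  | r, .fork e => .fork (e.rename r)
  | _, .new => .new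
  | r, .send e f => .send (e.rename r) (f.rename r)
  | r, .recv e => .recv (e.rename r)
  | r, .select l e => .select l (e.rename r)
  | r, .branch e I f => .branch (e.rename r) I (fun i => (f i).rename r.upVar)
  | r, .close e => .close (e.rename r)
  | r, .wait e => .wait (e.rename r)
  | r, .cast e T p U => .cast (e.rename r) T p U

/-- The substitution for term variables under one more binder of a term variable. -/
def upSubst (s : ℕ → Exp) : ℕ → Exp
  | 0 => .name (.var 0)
  | n + 1 => (s n).rename Ren.shiftVar

/-- Simultaneous capture-avoiding substitution of expressions for term variables. -/
def Exp.subst : (ℕ → Exp) → Exp → Exp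
  | s, .name (.var n) => s n
  | _, .name (.chan n) => .name (.chan n)
  | _, .name (.ref n) => .name (.ref n)
  | _, .unit => .unit
  | s, .lam m e => .lam m (e.subst (upSubst s))
  | s, .app e f => .app (e.subst s) (f.subst s)
  | s, .pair m e f => .pair m (e.subst s) (f.subst s)
  | s, .letPair e f => .letPair (e.subst s) (f.subst (upSubst (upSubst s)))
  | s, .fork e => .fork (e.subst s)
  | _, .new => .new
  | s, .send e f => .send (e.subst s) (f.subst s)
  | s, .recv e => .recv (e.subst s)
  | s, .select l e => .select l (e.subst s)
  | s, .branch e I f => .branch (e.subst s) I (fun i => (f i).subst (upSubst s))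
  | s, .close e => .close (e.subst s)
  | s, .wait e => .wait (e.subst s)
  | s, .cast e T p U => .cast (e.subst s) T p U

/-- `e.subst1 v` replaces the variable with index 0 by `v`. -/
def Exp.subst1 (e v : Exp) : Exp :=
  e.subst (fun | 0 => v | n + 1 => .name (.var n))

/-- `e.subst2 v w` replaces the variables `x` (index 1) by `v` and `y` (index 0) by `w`. -/
def Exp.subst2 (e v w : Exp) : Exp :=
  e.subst (fun | 0 => w | 1 => v | n + 2 => .name (.var n))

/-- The free channel endpoints of an expression.  In a running program these are exactly its free
linear names. -/
def Exp.flv : Exp → Finset Name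
  | .name (.chan n) => {.chan n}
  | .name (.var _) => ∅
  | .name (.ref _) => ∅
  | .unit => ∅
  | .lam _ e => e.flv
  | .app e f => e.flv ∪ f.flv
  | .pair _ e f => e.flv ∪ f.flv
  | .letPair e f => e.flv ∪ f.flv
  | .fork e => e.flv
  | .new => ∅
  | .send e f => e.flv ∪ f.flv
  | .recv e => e.flv
  | .select _ e => e.flv
  | .branch e I f => e.flv ∪ I.attach.biUnion (fun i => (f i).flv)
  | .close e => e.flv
  | .wait e => e.flv
  | .cast e _ _ _ => e.flv

/-- All types annotating casts in the expression are regular. -/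
def Exp.RegularCasts : Exp → Prop
  | .name _ => True
  | .unit => True
  | .lam _ e => e.RegularCasts
  | .app e f => e.RegularCasts ∧ f.RegularCasts
  | .pair _ e f => e.RegularCasts ∧ f.RegularCasts
  | .letPair e f => e.RegularCasts ∧ f.RegularCasts
  | .fork e => e.RegularCasts
  | .new => True
  | .send e f => e.RegularCasts ∧ f.RegularCasts
  | .recv e => e.RegularCasts
  | .select _ e => e.RegularCasts
  | .branch e _ f => e.RegularCasts ∧ ∀ i, (f i).RegularCasts
  | .close e => e.RegularCasts
  | .wait e => e.RegularCasts
  | .cast e T _ U => e.RegularCasts ∧ T.Regular ∧ U.Regular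

/-- Values. -/
inductive Value : Exp → Prop
  | unit : Value .unit
  | lam (m : Mult) (e : Exp) : Value (.lam m e)
  | pair (m : Mult) {v w : Exp} : Value v → Value w → Value (.pair m v w)
  | chan (n : ℕ) : Value (.name (.chan n))
  | castDyn {v : Exp} (G : Ground) (p : BLabel) :
      Value v → G.ty.Un → Value (.cast v G.ty p .dyn)
  | castDC {v : Exp} (G : GroundS) (p : BLabel) :
      Value v → Value (.cast v (.sess G.sty) p (.sess .dc))
  | castFn {v : Exp} (m n : Mult) (T U T' U' : Ty) (p : BLabel) :
      Value v → Value (.cast v (.fn m T U) p (.fn n T' U'))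
  | castSess {v : Exp} (S R : STy) (p : BLabel) :
      Value v → S ≠ .dc → R ≠ .dc → Value (.cast v (.sess S) p (.sess R))
  | ref (n : ℕ) : Value (.name (.ref n))

/-- Evaluation contexts. -/
inductive ECtx
  | hole : ECtx
  | appL (E : ECtx) (e : Exp) : ECtx
  | appR (v : Exp) (hv : Value v) (E : ECtx) : ECtx
  | pairL (m : Mult) (E : ECtx) (e : Exp) : ECtx
  | pairR (m : Mult) (v : Exp) (hv : Value v) (E : ECtx) : ECtx
  | letPair (E : ECtx) (e : Exp) : ECtx
  | sendL (E : ECtx) (e : Exp) : ECtx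
  | sendR (v : Exp) (hv : Value v) (E : ECtx) : ECtx
  | recv (E : ECtx) : ECtx
  | select (l : Label) (E : ECtx) : ECtx
  | branch (E : ECtx) (I : Finset Label) (f : {l // l ∈ I} → Exp) : ECtx
  | close (E : ECtx) : ECtx
  | wait (E : ECtx) : ECtx
  | cast (E : ECtx) (T : Ty) (p : BLabel) (U : Ty) : ECtx

/-- `E.fill e` fills the hole of `E` with `e`.  The hole is under no binder. -/
def ECtx.fill : ECtx → Exp → Exp
  | .hole, g => g
  | .appL E e, g => .app (E.fill g) e
  | .appR v _ E, g => .app v (E.fill g)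
  | .pairL m E e, g => .pair m (E.fill g) e
  | .pairR m v _ E, g => .pair m v (E.fill g)
  | .letPair E e, g => .letPair (E.fill g) e
  | .sendL E e, g => .send (E.fill g) e
  | .sendR v _ E, g => .send v (E.fill g)
  | .recv E, g => .recv (E.fill g)
  | .select l E, g => .select l (E.fill g)
  | .branch E I f, g => .branch (E.fill g) I f
  | .close E, g => .close (E.fill g)
  | .wait E, g => .wait (E.fill g)
  | .cast E T p U, g => .cast (E.fill g) T p U

/-- `E.comp F` fills the hole of `E` with the context `F`. -/
def ECtx.comp : ECtx → ECtx → ECtx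
  | .hole, F => F
  | .appL E e, F => .appL (E.comp F) e
  | .appR v hv E, F => .appR v hv (E.comp F)
  | .pairL m E e, F => .pairL m (E.comp F) e
  | .pairR m v hv E, F => .pairR m v hv (E.comp F)
  | .letPair E e, F => .letPair (E.comp F) e
  | .sendL E e, F => .sendL (E.comp F) e
  | .sendR v hv E, F => .sendR v hv (E.comp F)
  | .recv E, F => .recv (E.comp F)
  | .select l E, F => .select l (E.comp F)
  | .branch E I f, F => .branch (E.comp F) I f
  | .close E, F => .close (E.comp F)
  | .wait E, F => .wait (E.comp F)
  | .cast E T p U, F => .cast (E.comp F) T p U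

/-- The free channel endpoints of an evaluation context. -/
def ECtx.flv : ECtx → Finset Name
  | .hole => ∅
  | .appL E e => E.flv ∪ e.flv
  | .appR v _ E => v.flv ∪ E.flv
  | .pairL _ E e => E.flv ∪ e.flv
  | .pairR _ v _ E => v.flv ∪ E.flv
  | .letPair E e => E.flv ∪ e.flv
  | .sendL E e => E.flv ∪ e.flv
  | .sendR v _ E => v.flv ∪ E.flv
  | .recv E => E.flv
  | .select _ E => E.flv
  | .branch E I f => E.flv ∪ I.attach.biUnion (fun i => (f i).flv)
  | .close E => E.flv
  | .wait E => E.flv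
  | .cast E _ _ _ => E.flv

theorem Value.rename {v : Exp} (h : Value v) : ∀ r : Ren, Value (v.rename r) := by
  induction h with
  | unit => intro r; exact .unit
  | lam m e => intro r; exact .lam m _
  | pair m _ _ ih₁ ih₂ => intro r; exact .pair m (ih₁ r) (ih₂ r)
  | chan n => intro r; exact .chan _
  | castDyn G p _ hG ih => intro r; exact .castDyn G p (ih r) hG
  | castDC G p _ ih => intro r; exact .castDC G p (ih r)
  | castFn m n T U T' U' p _ ih => intro r; exact .castFn m n T U T' U' p (ih r)
  | castSess S R p _ hS hR ih => intro r; exact .castSess S R p (ih r) hS hR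
  | ref n => intro r; exact .ref _

/-- Renaming of the free names of an evaluation context. -/
def ECtx.rename (r : Ren) : ECtx → ECtx
  | .hole => .hole
  | .appL E e => .appL (E.rename r) (e.rename r)
  | .appR v hv E => .appR (v.rename r) (hv.rename r) (E.rename r)
  | .pairL m E e => .pairL m (E.rename r) (e.rename r)
  | .pairR m v hv E => .pairR m (v.rename r) (hv.rename r) (E.rename r)
  | .letPair E e => .letPair (E.rename r) (e.rename r.upVar.upVar)
  | .sendL E e => .sendL (E.rename r) (e.rename r)
  | .sendR v hv E => .sendR (v.rename r) (hv.rename r) (E.rename r)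
  | .recv E => .recv (E.rename r)
  | .select l E => .select l (E.rename r)
  | .branch E I f => .branch (E.rename r) I (fun i => (f i).rename r.upVar)
  | .close E => .close (E.rename r)
  | .wait E => .wait (E.rename r)
  | .cast E T p U => .cast (E.rename r) T p U

/-! ### Processes -/

/-- Processes. -/
inductive Proc
  /-- The process running an expression. -/
  | run (e : Exp) : Proc
  | par (P Q : Proc) : Proc
  /-- Restriction of a pair of channel endpoints. -/
  | nuChan (P : Proc) : Proc
  /-- Restriction of a reference. -/
  | nuRef (P : Proc) : Proc
  /-- The reference `a` stores the value `w`, cast from the ground type `G` to the dynamic type. -/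
  | store (a : ℕ) (w : Exp) (G : Ground) (p : BLabel) : Proc
  /-- The reference `a` is locked. -/
  | locked (a : ℕ) (p : BLabel) : Proc
  | blame (p q : BLabel) (X : Finset Name) : Proc
  | blameGC (p : BLabel) (X : Finset Name) : Proc

/-- Renaming of the free names of a process. -/
def Proc.rename : Ren → Proc → Proc
  | r, .run e => .run (e.rename r)
  | r, .par P Q => .par (P.rename r) (Q.rename r)
  | r, .nuChan P => .nuChan (P.rename r.upChan)
  | r, .nuRef P => .nuRef (P.rename r.upRef)
  | r, .store a w G p => .store (r.ref a) (w.rename r) G p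
  | r, .locked a p => .locked (r.ref a) p
  | r, .blame p q X => .blame p q (X.image r.app)
  | r, .blameGC p X => .blameGC p (X.image r.app)

/-- All types annotating casts in the process are regular. -/
def Proc.RegularCasts : Proc → Prop
  | .run e => e.RegularCasts
  | .par P Q => P.RegularCasts ∧ Q.RegularCasts
  | .nuChan P => P.RegularCasts
  | .nuRef P => P.RegularCasts
  | .store _ w _ _ => w.RegularCasts
  | .locked _ _ => True
  | .blame _ _ _ => True
  | .blameGC _ _ => True

/-! ### Typing -/

/-- Type environments: partial maps from names to types. -/
abbrev Env := Name → Option Ty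

/-- The environment extended by a term variable. -/
def Env.extVar (Γ : Env) (T : Ty) : Env
  | .var 0 => some T
  | .var (n + 1) => Γ (.var n)
  | z => Γ z

/-- The environment extended by a pair of channel endpoints. -/
def Env.extChan (Γ : Env) (S R : STy) : Env
  | .chan 0 => some (.sess S)
  | .chan 1 => some (.sess R)
  | .chan (n + 2) => Γ (.chan n)
  | z => Γ z

/-- The environment extended by a reference of dynamic type. -/
def Env.extRef (Γ : Env) : Env
  | .ref 0 => some .dyn
  | .ref (n + 1) => Γ (.ref n)
  | z => Γ z

/-- All types in the environment are unrestricted. -/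
def Env.Un (Γ : Env) : Prop := ∀ z T, Γ z = some T → T.Un

/-- All types in the environment have a multiplicity below `m`. -/
def Env.Below (m : Mult) (Γ : Env) : Prop := ∀ z T, Γ z = some T → T.Below m

/-- The names of linear type in the environment. -/
def Env.flv (Γ : Env) : Set Name := {z | ∃ T, Γ z = some T ∧ T.Lin}

/-- Environments of running programs: the names of linear type are exactly the channel
endpoints. -/
def Env.Running (Γ : Env) : Prop := ∀ z T, Γ z = some T → (T.Lin ↔ z.IsChan)

/-- Splitting of a single entry of an environment. -/
inductive SplitAt : Option Ty → Option Ty → Option Ty → Prop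
  | none : SplitAt none none none
  | un {T : Ty} : T.Un → SplitAt (some T) (some T) (some T)
  | linL {T : Ty} : T.Lin → SplitAt (some T) (some T) none
  | linR {T : Ty} : T.Lin → SplitAt (some T) none (some T)

/-- Environment splitting. -/
def Split (Γ Γ₁ Γ₂ : Env) : Prop := ∀ z, SplitAt (Γ z) (Γ₁ z) (Γ₂ z)

/-- Typing of expressions. -/
inductive HasType : Env → Exp → Ty → Prop
  | name {Γ : Env} {z : Name} {T : Ty} :
      Γ z = some T → (∀ z' T', z' ≠ z → Γ z' = some T' → T'.Un) → HasType Γ (.name z) T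
  | unit {Γ : Env} : Γ.Un → HasType Γ .unit .unit
  | lam {Γ : Env} {m : Mult} {e : Exp} {T U : Ty} :
      HasType (Γ.extVar T) e U → Γ.Below m → HasType Γ (.lam m e) (.fn m T U)
  | app {Γ Γ₁ Γ₂ : Env} {m : Mult} {e f : Exp} {T U : Ty} :
      Split Γ Γ₁ Γ₂ → HasType Γ₁ e (.fn m T U) → HasType Γ₂ f T → HasType Γ (.app e f) U
  | pair {Γ Γ₁ Γ₂ : Env} {m : Mult} {e f : Exp} {T U : Ty} :
      Split Γ Γ₁ Γ₂ → HasType Γ₁ e T → HasType Γ₂ f U → T.Below m → U.Below m →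
      HasType Γ (.pair m e f) (.prod m T U)
  | letPair {Γ Γ₁ Γ₂ : Env} {m : Mult} {e f : Exp} {T₁ T₂ U : Ty} :
      Split Γ Γ₁ Γ₂ → HasType Γ₁ e (.prod m T₁ T₂) →
      HasType ((Γ₂.extVar T₁).extVar T₂) f U → HasType Γ (.letPair e f) U
  | fork {Γ : Env} {e : Exp} : HasType Γ e .unit → HasType Γ (.fork e) .unit
  | new {Γ : Env} (S : STy) :
      Γ.Un → HasType Γ .new (.prod .lin (.sess S) (.sess S.dual))
  | send {Γ Γ₁ Γ₂ : Env} {e f : Exp} {T : Ty} {S : STy} :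
      Split Γ Γ₁ Γ₂ → HasType Γ₁ e T → HasType Γ₂ f (.sess (.send T S)) →
      HasType Γ (.send e f) (.sess S)
  | recv {Γ : Env} {e : Exp} {T : Ty} {S : STy} :
      HasType Γ e (.sess (.recv T S)) → HasType Γ (.recv e) (.prod .lin T (.sess S))
  | select {Γ : Env} {e : Exp} {I : Finset Label} {hI : I.Nonempty}
      {S : {l // l ∈ I} → STy} (j : {l // l ∈ I}) :
      HasType Γ e (.sess (.select I hI S)) → HasType Γ (.select j e) (.sess (S j))
  | branch {Γ Γ₁ Γ₂ : Env} {e : Exp} {I : Finset Label} {hI : I.Nonempty}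
      {S : {l // l ∈ I} → STy} {f : {l // l ∈ I} → Exp} {T : Ty} :
      Split Γ Γ₁ Γ₂ → HasType Γ₁ e (.sess (.choice I hI S)) →
      (∀ i, HasType (Γ₂.extVar (.sess (S i))) (f i) T) → HasType Γ (.branch e I f) T
  | close {Γ : Env} {e : Exp} : HasType Γ e (.sess .close) → HasType Γ (.close e) .unit
  | wait {Γ : Env} {e : Exp} : HasType Γ e (.sess .wait) → HasType Γ (.wait e) .unit
  | cast {Γ : Env} {e : Exp} {T U : Ty} {p : BLabel} :
      HasType Γ e T → CSub T U → HasType Γ (.cast e T p U) U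
  | sub {Γ : Env} {e : Exp} {T U : Ty} : HasType Γ e T → Sub T U → HasType Γ e U

/-- Typing of processes. -/
inductive ProcTyped : Env → Proc → Prop
  | run {Γ : Env} {e : Exp} {T : Ty} : HasType Γ e T → T.Un → ProcTyped Γ (.run e)
  | par {Γ Γ₁ Γ₂ : Env} {P Q : Proc} :
      Split Γ Γ₁ Γ₂ → ProcTyped Γ₁ P → ProcTyped Γ₂ Q → ProcTyped Γ (.par P Q)
  | nuChan {Γ : Env} {P : Proc} (S : STy) :
      ProcTyped (Γ.extChan S S.dual) P → ProcTyped Γ (.nuChan P)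
  | nuRef {Γ : Env} {P : Proc} : ProcTyped Γ.extRef P → ProcTyped Γ (.nuRef P)
  | store {Γ Γ₁ Γ₂ : Env} {a : ℕ} {w : Exp} {G : Ground} {p : BLabel} :
      Split Γ Γ₁ Γ₂ → HasType Γ₁ (.name (.ref a)) .dyn → HasType Γ₂ w G.ty → Value w →
      G.ty.Lin → ProcTyped Γ (.store a w G p)
  | locked {Γ : Env} {a : ℕ} {p : BLabel} :
      HasType Γ (.name (.ref a)) .dyn → ProcTyped Γ (.locked a p)
  | blame {Γ : Env} {p q : BLabel} {X : Finset Name} :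
      Γ.flv = (X : Set Name) → ProcTyped Γ (.blame p q X)
  | blameGC {Γ : Env} {p : BLabel} {X : Finset Name} :
      Γ.flv = (X : Set Name) → ProcTyped Γ (.blameGC p X)

/-! ### Reduction -/

/-- Reduction of expressions. -/
inductive Step : Exp → Exp → Prop
  | beta {m : Mult} {e v : Exp} : Value v → Step (.app (.lam m e) v) (e.subst1 v)
  | letPair {m : Mult} {v w e : Exp} : Value v → Value w →
      Step (.letPair (.pair m v w) e) (e.subst2 v w)
  | castDyn {v : Exp} {p : BLabel} : Value v → Step (.cast v .dyn p .dyn) v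
  | castDC {v : Exp} {p : BLabel} : Value v → Step (.cast v (.sess .dc) p (.sess .dc)) v
  | castUnit {v : Exp} {p : BLabel} : Value v → Step (.cast v .unit p .unit) v
  | castApp {v w : Exp} {m n : Mult} {T U T' U' : Ty} {p : BLabel} : Value v → Value w →
      Step (.app (.cast v (.fn m T U) p (.fn n T' U')) w)
        (.cast (.app v (.cast w T' p.compl T)) U p U')
  | castPair {v w : Exp} {m n : Mult} {T U T' U' : Ty} {p : BLabel} : Value v → Value w →
      Step (.cast (.pair m v w) (.prod m T U) p (.prod n T' U'))
        (.pair n (.cast v T p T') (.cast w U p U'))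
  | castSend {v w : Exp} {T T' : Ty} {S S' : STy} {p : BLabel} : Value v → Value w →
      Step (.send v (.cast w (.sess (.send T S)) p (.sess (.send T' S'))))
        (.cast (.send (.cast v T' p.compl T) w) (.sess S) p (.sess S'))
  | castRecv {w : Exp} {T T' : Ty} {S S' : STy} {p : BLabel} : Value w →
      Step (.recv (.cast w (.sess (.recv T S)) p (.sess (.recv T' S'))))
        (.cast (.recv w) (.prod .lin T (.sess S)) p (.prod .lin T' (.sess S')))
  | castSelect {w : Exp} {I J : Finset Label} {hI : I.Nonempty} {hJ : J.Nonempty}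
      {R : {l // l ∈ I} → STy} {S : {l // l ∈ J} → STy} {p : BLabel}
      (k : {l // l ∈ J}) (h : J ⊆ I) : Value w →
      Step (.select k (.cast w (.sess (.select I hI R)) p (.sess (.select J hJ S))))
        (.cast (.select k w) (.sess (R ⟨k, h k.2⟩)) p (.sess (S k)))
  /- The new branch for label `l` is `let x = (x : R l ⇒ S l) in f l`, which abbreviates the
  application of a linear abstraction. -/
  | castBranch {w : Exp} {I J : Finset Label} {hI : I.Nonempty} {hJ : J.Nonempty}
      {R : {l // l ∈ I} → STy} {S : {l // l ∈ J} → STy} {p : BLabel}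
      {f : {l // l ∈ J} → Exp} (h : I ⊆ J) : Value w →
      Step (.branch (.cast w (.sess (.choice I hI R)) p (.sess (.choice J hJ S))) J f)
        (.branch w I (fun i =>
          .app (.lam .lin ((f ⟨i, h i.2⟩).rename Ren.shiftVar.upVar))
            (.cast (.name (.var 0)) (.sess (R i)) p (.sess (S ⟨i, h i.2⟩)))))
  | castClose {v : Exp} {p : BLabel} : Value v →
      Step (.close (.cast v (.sess .close) p (.sess .close))) (.close v)
  | castWait {v : Exp} {p : BLabel} : Value v →
      Step (.wait (.cast v (.sess .wait) p (.sess .wait))) (.wait v)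
  | toDyn {v : Exp} {T : Ty} {G : Ground} {p : BLabel} : Value v →
      T ≠ .dyn → T ≠ G.ty → Consistent T G.ty →
      Step (.cast v T p .dyn) (.cast (.cast v T p G.ty) G.ty p .dyn)
  | fromDyn {v : Exp} {T : Ty} {G : Ground} {p : BLabel} : Value v →
      T ≠ .dyn → T ≠ G.ty → Consistent T G.ty →
      Step (.cast v .dyn p T) (.cast (.cast v .dyn p G.ty) G.ty p T)
  | toDC {v : Exp} {S : STy} {G : GroundS} {p : BLabel} : Value v →
      S ≠ .dc → S ≠ G.sty → Consistent (.sess S) (.sess G.sty) →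
      Step (.cast v (.sess S) p (.sess .dc))
        (.cast (.cast v (.sess S) p (.sess G.sty)) (.sess G.sty) p (.sess .dc))
  | fromDC {v : Exp} {S : STy} {G : GroundS} {p : BLabel} : Value v →
      S ≠ .dc → S ≠ G.sty → Consistent (.sess S) (.sess G.sty) →
      Step (.cast v (.sess .dc) p (.sess S))
        (.cast (.cast v (.sess .dc) p (.sess G.sty)) (.sess G.sty) p (.sess S))

/-- Structural congruence. -/
inductive Cong : Proc → Proc → Prop
  | refl (P : Proc) : Cong P P
  | symm {P Q : Proc} : Cong P Q → Cong Q P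
  | trans {P Q R : Proc} : Cong P Q → Cong Q R → Cong P R
  | congPar {P P' Q Q' : Proc} : Cong P P' → Cong Q Q' → Cong (.par P Q) (.par P' Q')
  | congNuChan {P Q : Proc} : Cong P Q → Cong (.nuChan P) (.nuChan Q)
  | congNuRef {P Q : Proc} : Cong P Q → Cong (.nuRef P) (.nuRef Q)
  | parComm (P Q : Proc) : Cong (.par P Q) (.par Q P)
  | parAssoc (P Q R : Proc) : Cong (.par P (.par Q R)) (.par (.par P Q) R)
  | parUnit (P : Proc) : Cong (.par P (.run .unit)) P
  | swapEnds (P : Proc) : Cong (.nuChan P) (.nuChan (P.rename Ren.swapEnds))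
  | extrudeChan (P Q : Proc) :
      Cong (.par (.nuChan P) Q) (.nuChan (.par P (Q.rename Ren.shiftChan)))
  | swapChans (P : Proc) :
      Cong (.nuChan (.nuChan P)) (.nuChan (.nuChan (P.rename Ren.swapChans)))
  | extrudeRef (P Q : Proc) :
      Cong (.par (.nuRef P) Q) (.nuRef (.par P (Q.rename Ren.shiftRef)))
  | swapRefs (P : Proc) : Cong (.nuRef (.nuRef P)) (.nuRef (.nuRef (P.rename Ren.swapRefs)))
  | swapChanRef (P : Proc) : Cong (.nuChan (.nuRef P)) (.nuRef (.nuChan P))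

/-- The channel endpoint `c` bound by the innermost endpoint restriction of a pair `c, d`. -/
abbrev endC : Exp := .name (.chan 0)

/-- The channel endpoint `d` bound by the innermost endpoint restriction of a pair `c, d`. -/
abbrev endD : Exp := .name (.chan 1)

/-- Reduction of processes. -/
inductive Red : Proc → Proc → Prop
  | fork {E : ECtx} {e : Exp} :
      Red (.run (E.fill (.fork e))) (.par (.run (E.fill .unit)) (.run e))
  | new {E : ECtx} :
      Red (.run (E.fill .new))
        (.nuChan (.run ((E.rename Ren.shiftChan).fill (.pair .lin endC endD))))
  | comm {E F : ECtx} {v : Exp} : Value v →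
      Red (.nuChan (.par (.run (E.fill (.send v endC))) (.run (F.fill (.recv endD)))))
        (.nuChan (.par (.run (E.fill endC)) (.run (F.fill (.pair .lin v endD)))))
  | choose {E F : ECtx} {I : Finset Label} {f : {l // l ∈ I} → Exp} (j : {l // l ∈ I}) :
      Red (.nuChan (.par (.run (E.fill (.select j endC))) (.run (F.fill (.branch endD I f)))))
        (.nuChan (.par (.run (E.fill endC)) (.run (F.fill ((f j).subst1 endD)))))
  /- The endpoints are not free in the two contexts, so that they do not escape their scope. -/
  | close {E F : ECtx} :
      Red (.nuChan (.par (.run ((E.rename Ren.shiftChan).fill (.close endC)))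
          (.run ((F.rename Ren.shiftChan).fill (.wait endD)))))
        (.par (.run (E.fill .unit)) (.run (F.fill .unit)))
  | par {P P' Q : Proc} : Red P P' → Red (.par P Q) (.par P' Q)
  | nuChan {P Q : Proc} : Red P Q → Red (.nuChan P) (.nuChan Q)
  | nuRef {P Q : Proc} : Red P Q → Red (.nuRef P) (.nuRef Q)
  | cong {P P' Q Q' : Proc} : Cong P' P → Red P Q → Cong Q Q' → Red P' Q'
  | step {E : ECtx} {e f : Exp} : Step e f → Red (.run (E.fill e)) (.run (E.fill f))
  /- Allocation of a reference to a linear value. -/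
  | alloc {E : ECtx} {v : Exp} {G : Ground} {p : BLabel} : Value v → G.ty.Lin →
      (∀ (F : ECtx) (q : BLabel) (H : Ground), E ≠ F.comp (.cast .hole .dyn q H.ty)) →
      Red (.run (E.fill (.cast v G.ty p .dyn)))
        (.nuRef (.par (.run ((E.rename Ren.shiftRef).fill (.name (.ref 0))))
          (.store 0 (v.rename Ren.shiftRef) G p)))
  /- First access to a reference. -/
  | access {E : ECtx} {a : ℕ} {v : Exp} {G H : Ground} {p q : BLabel} : Value v →
      Red (.par (.run (E.fill (.cast (.name (.ref a)) .dyn q H.ty))) (.store a v G p))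
        (.par (.run (E.fill (.cast (.cast v G.ty p .dyn) .dyn q H.ty))) (.locked a p))
  /- Any later access to a reference. -/
  | accessLocked {E : ECtx} {a : ℕ} {H : Ground} {p q : BLabel} :
      Red (.par (.run (E.fill (.cast (.name (.ref a)) .dyn q H.ty))) (.locked a p))
        (.par (.blame p.compl q E.flv) (.locked a p))
  /- Garbage collection of references. -/
  | gcLocked {p : BLabel} : Red (.nuRef (.locked 0 p)) (.run .unit)
  | gcStore {w : Exp} {G : Ground} {p : BLabel} : Value w →
      Red (.nuRef (.store 0 w G p)) (.blameGC p.compl w.flv)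
  | collapse {E : ECtx} {v : Exp} {G H : Ground} {p q : BLabel} : Value v → Sub G.ty H.ty →
      Red (.run (E.fill (.cast (.cast v G.ty p .dyn) .dyn q H.ty))) (.run (E.fill v))
  | collide {E : ECtx} {v : Exp} {G H : Ground} {p q : BLabel} : Value v → ¬ Sub G.ty H.ty →
      Red (.run (E.fill (.cast (.cast v G.ty p .dyn) .dyn q H.ty)))
        (.blame p.compl q (E.flv ∪ v.flv))
  | collapseSess {E : ECtx} {v : Exp} {G H : GroundS} {p q : BLabel} : Value v →
      Sub (.sess G.sty) (.sess H.sty) →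
      Red (.run (E.fill (.cast (.cast v (.sess G.sty) p (.sess .dc)) (.sess .dc) q
          (.sess H.sty))))
        (.run (E.fill v))
  | collideSess {E : ECtx} {v : Exp} {G H : GroundS} {p q : BLabel} : Value v →
      ¬ Sub (.sess G.sty) (.sess H.sty) →
      Red (.run (E.fill (.cast (.cast v (.sess G.sty) p (.sess .dc)) (.sess .dc) q
          (.sess H.sty))))
        (.blame p.compl q (E.flv ∪ v.flv))
  | collapseChan {E F : ECtx} {G H : GroundS} {p q : BLabel} :
      Sub (.sess G.sty.dual) (.sess H.sty) →
      Red (.nuChan (.par (.run (E.fill (.cast endC (.sess .dc) p (.sess G.sty))))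
          (.run (F.fill (.cast endD (.sess .dc) q (.sess H.sty))))))
        (.nuChan (.par (.run (E.fill endC)) (.run (F.fill endD))))
  /- The endpoints belong to the blame set, hence they stay bound. -/
  | collideChan {E F : ECtx} {G H : GroundS} {p q : BLabel} :
      ¬ Sub (.sess G.sty.dual) (.sess H.sty) →
      Red (.nuChan (.par (.run (E.fill (.cast endC (.sess .dc) p (.sess G.sty))))
          (.run (F.fill (.cast endD (.sess .dc) q (.sess H.sty))))))
        (.nuChan (.blame p q (E.flv ∪ F.flv ∪ {.chan 0, .chan 1})))

end GGV

namespace GGV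

/-! ### Multiplicities and subtyping -/

-- Preservation goes by induction on the reduction. Three facts turn most axioms into a computation
-- with types. First, subsumption can be postponed: as `Sub` is transitive, every typing of a given
-- constructor is an instance of its own rule, with the subsumption collected after it or absorbed
-- by a premise. Second, the content of an evaluation context is typed in one part of the
-- environment, and anything of the same type may replace it, even in a different environment
-- (`ECtx.hasType_fill`). Third, a value of unrestricted type uses no linear name (`Value.env_un`),
-- so substituting values neither duplicates nor loses linear names (`HasType.substAt`).
--
-- Most cast reductions of expressions follow by inverting consistent subtyping componentwise. The
-- delicate one is the cast of a pair: an unrestricted pair needs unrestricted components, and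
-- consistent subtyping does not provide them. They come from the regularity of the target
-- annotation. Regularity survives reduction because new annotations are built from components of
-- old ones or are ground or dynamic types.
--
-- Scope extrusion can be read in both directions, so structural congruence needs weakening as well
-- as strengthening. Both are statements about injective renamings, `HasType.rename` and
-- `HasType.of_rename`. The condition that links them is `Ren.Covers`, that every linear name lies
-- in the image of the renaming. Weakening assumes it. Strengthening obtains it, since linear names
-- of the environment have to be used.
--
-- When two threads meet on a restriction, linearity places one endpoint in each hole, with dual
-- types. Inverting the two subtypings yields the residual type for the new restriction, and the
-- environment of a message moves from sender to receiver. A blame process must list exactly the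
-- linear names of its environment. In a running environment these are the channel endpoints, and a
-- typed expression contains every endpoint of its environment and no other (`HasType.flv_eq`), so
-- the syntactic sets in the reduction rules are correct.

theorem Mult.Le.refl : ∀ m : Mult, m.Le m
  | .un => .un_un
  | .lin => .lin_lin

theorem Mult.Le.trans {k m n : Mult} (h : k.Le m) (h' : m.Le n) : k.Le n := by
  cases h <;> cases h' <;> constructor

theorem Mult.Le.eq_un {m : Mult} (h : m.Le .un) : m = .un := by
  cases h; rfl

theorem Mult.le_lin : ∀ m : Mult, m.Le .lin
  | .un => .un_lin
  | .lin => .lin_lin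

theorem Ty.un_or_lin (T : Ty) : T.Un ∨ T.Lin := by
  unfold Ty.Un Ty.Lin
  cases T.mult <;> simp

theorem Ty.Un.not_lin {T : Ty} (h : T.Un) : ¬ T.Lin := by
  unfold Ty.Un at h
  unfold Ty.Lin
  simp [h]

theorem Ty.Un.below {T : Ty} (h : T.Un) (m : Mult) : T.Below m := by
  unfold Ty.Un at h
  unfold Ty.Below
  rw [h]
  cases m <;> constructor

theorem Ty.below_lin (T : Ty) : T.Below .lin := Mult.le_lin _

theorem Ty.Below.un {T : Ty} (h : T.Below .un) : T.Un := h.eq_un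

theorem Ty.sess_lin (S : STy) : (Ty.sess S).Lin := rfl

mutual
theorem Sub.refl : ∀ T : Ty, Sub T T
  | .unit => .unit
  | .sess S => Sub.refl_sess S
  | .fn _ T U => .fn (Sub.refl T) (Sub.refl U) (.refl _)
  | .prod _ T U => .prod (Sub.refl T) (Sub.refl U) (.refl _)
  | .dyn => .dyn
theorem Sub.refl_sess : ∀ S : STy, Sub (.sess S) (.sess S)
  | .send T S => .send (Sub.refl T) (Sub.refl_sess S)
  | .recv T S => .recv (Sub.refl T) (Sub.refl_sess S)
  | .select _ _ S => .select (Finset.Subset.refl _) (fun j => Sub.refl_sess (S j))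
  | .choice _ _ S => .choice (Finset.Subset.refl _) (fun j => Sub.refl_sess (S j))
  | .close => .close
  | .wait => .wait
  | .dc => .dc
end

/-- Contravariant positions exchange the two ends, so an induction for one end alone does not close.
Composition on the right and on the left are proved together. -/
theorem Sub.trans_aux {A B : Ty} (h : Sub A B) :
    (∀ C, Sub B C → Sub A C) ∧ (∀ D, Sub D A → Sub D B) := by
  induction h with
  | unit => exact ⟨fun _ h => h, fun _ h => h⟩
  | fn _ _ hm ih₁ ih₂ =>
    refine ⟨fun C h => ?_, fun D h => ?_⟩
    · cases h with
      | fn h₁ h₂ h₃ => exact .fn (ih₁.2 _ h₁) (ih₂.1 _ h₂) (hm.trans h₃)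
    · cases h with
      | fn h₁ h₂ h₃ => exact .fn (ih₁.1 _ h₁) (ih₂.2 _ h₂) (h₃.trans hm)
  | prod _ _ hm ih₁ ih₂ =>
    refine ⟨fun C h => ?_, fun D h => ?_⟩
    · cases h with
      | prod h₁ h₂ h₃ => exact .prod (ih₁.1 _ h₁) (ih₂.1 _ h₂) (hm.trans h₃)
    · cases h with
      | prod h₁ h₂ h₃ => exact .prod (ih₁.2 _ h₁) (ih₂.2 _ h₂) (h₃.trans hm)
  | send _ _ ih₁ ih₂ =>
    refine ⟨fun C h => ?_, fun D h => ?_⟩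
    · cases h with
      | send h₁ h₂ => exact .send (ih₁.2 _ h₁) (ih₂.1 _ h₂)
    · cases h with
      | send h₁ h₂ => exact .send (ih₁.1 _ h₁) (ih₂.2 _ h₂)
  | recv _ _ ih₁ ih₂ =>
    refine ⟨fun C h => ?_, fun D h => ?_⟩
    · cases h with
      | recv h₁ h₂ => exact .recv (ih₁.1 _ h₁) (ih₂.1 _ h₂)
    · cases h with
      | recv h₁ h₂ => exact .recv (ih₁.2 _ h₁) (ih₂.2 _ h₂)
  | select hs _ ih =>
    refine ⟨fun C h => ?_, fun D h => ?_⟩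
    · cases h with
      | select hs' h' =>
        exact .select (hs'.trans hs) (fun j => (ih ⟨j, hs' j.2⟩).1 _ (h' j))
    · cases h with
      | select hs' h' =>
        exact .select (hs.trans hs') (fun j => (ih j).2 _ (h' ⟨j, hs j.2⟩))
  | choice hs _ ih =>
    refine ⟨fun C h => ?_, fun D h => ?_⟩
    · cases h with
      | choice hs' h' =>
        exact .choice (hs.trans hs') (fun j => (ih j).1 _ (h' ⟨j, hs j.2⟩))
    · cases h with
      | choice hs' h' =>
        exact .choice (hs'.trans hs) (fun j => (ih ⟨j, hs' j.2⟩).2 _ (h' j))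
  | close => exact ⟨fun _ h => h, fun _ h => h⟩
  | wait => exact ⟨fun _ h => h, fun _ h => h⟩
  | dyn => exact ⟨fun _ h => h, fun _ h => h⟩
  | dc => exact ⟨fun _ h => h, fun _ h => h⟩

theorem Sub.trans {A B C : Ty} (h : Sub A B) (h' : Sub B C) : Sub A C :=
  h.trans_aux.1 C h'

theorem Sub.mult_le {T U : Ty} (h : Sub T U) : T.mult.Le U.mult := by
  cases h <;> first | assumption | exact Mult.Le.refl _

theorem Sub.un {T U : Ty} (h : Sub T U) (hU : U.Un) : T.Un := by
  have := h.mult_le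
  unfold Ty.Un at hU
  rw [hU] at this
  exact this.eq_un

theorem Sub.sess_right {T : Ty} {S : STy} (h : Sub T (.sess S)) : ∃ R, T = .sess R := by
  cases h <;> exact ⟨_, rfl⟩

theorem STy.dual_dual : ∀ S : STy, S.dual.dual = S
  | .send T S => by simp [STy.dual, STy.dual_dual S]
  | .recv T S => by simp [STy.dual, STy.dual_dual S]
  | .select _ _ S => by
    simp only [STy.dual]
    congr
    funext i
    exact STy.dual_dual (S i)
  | .choice _ _ S => by
    simp only [STy.dual]
    congr
    funext i
    exact STy.dual_dual (S i)
  | .close => rfl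
  | .wait => rfl
  | .dc => rfl

/-! ### Environment splitting -/

theorem SplitAt.symm {o a b : Option Ty} (h : SplitAt o a b) : SplitAt o b a := by
  cases h with
  | none => exact .none
  | un h => exact .un h
  | linL h => exact .linR h
  | linR h => exact .linL h

theorem Split.symm {Γ Γ₁ Γ₂ : Env} (h : Split Γ Γ₁ Γ₂) : Split Γ Γ₂ Γ₁ := fun z => (h z).symm

/-- An unrestricted entry is in all three parts and a linear one in exactly one of them. The entry
`c` gathers what `a₂` and `b` hold. -/
theorem SplitAt.assoc {o a b a₁ a₂ : Option Ty} (h : SplitAt o a b) (h' : SplitAt a a₁ a₂) :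
    ∃ c, SplitAt o a₁ c ∧ SplitAt c a₂ b := by
  cases h with
  | none => cases h'; exact ⟨_, .none, .none⟩
  | un h =>
    cases h' with
    | un => exact ⟨_, .un h, .un h⟩
    | linL h' => exact absurd h' h.not_lin
    | linR h' => exact absurd h' h.not_lin
  | linL h =>
    cases h' with
    | un h' => exact absurd h h'.not_lin
    | linL => exact ⟨_, .linL h, .none⟩
    | linR => exact ⟨_, .linR h, .linL h⟩
  | linR h => cases h'; exact ⟨_, .linR h, .linR h⟩

theorem Split.assoc {Γ A B A₁ A₂ : Env} (h : Split Γ A B) (h' : Split A A₁ A₂) :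
    ∃ C, Split Γ A₁ C ∧ Split C A₂ B := by
  choose C hC using fun z => (h z).assoc (h' z)
  exact ⟨C, fun z => (hC z).1, fun z => (hC z).2⟩

/-- From `(A₁ ∘ A₂) ∘ B` to `(A₁ ∘ B) ∘ A₂`. -/
theorem Split.rotate {Γ A B A₁ A₂ : Env} (h : Split Γ A B) (h' : Split A A₁ A₂) :
    ∃ C, Split Γ C A₂ ∧ Split C A₁ B := by
  obtain ⟨C, h₁, h₂⟩ := h.assoc h'.symm
  exact ⟨C, h₁.symm, h₂⟩

/-- The unrestricted fragment of `Γ` is neutral for splitting. It serves to type anything without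
linear names beside a part that keeps all of `Γ`. -/
theorem Env.exists_split_un (Γ : Env) : ∃ Δ, Split Γ Γ Δ ∧ Δ.Un := by
  have : ∀ z, ∃ o, SplitAt (Γ z) (Γ z) o ∧ ∀ T, o = some T → T.Un := by
    intro z
    rcases hz : Γ z with _ | T
    · exact ⟨none, .none, by simp⟩
    · rcases T.un_or_lin with h | h
      · exact ⟨some T, .un h, by simpa using h⟩
      · exact ⟨none, .linL h, by simp⟩
  choose Δ hΔ using this
  exact ⟨Δ, fun z => (hΔ z).1, fun z => (hΔ z).2⟩

theorem Split.eq_left {Γ A B : Env} (h : Split Γ A B) (hB : B.Un) : A = Γ := by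
  funext z
  have h := h z
  have hB := hB z
  revert h hB
  generalize Γ z = o, A z = a, B z = b
  intro h hB
  cases h with
  | none => rfl
  | un => rfl
  | linL => rfl
  | linR h => exact absurd h (hB _ rfl).not_lin

theorem Split.eq_right {Γ A B : Env} (h : Split Γ A B) (hA : A.Un) : B = Γ :=
  h.symm.eq_left hA

theorem Split.some_left {Γ A B : Env} (h : Split Γ A B) {z : Name} {T : Ty}
    (hz : A z = some T) : Γ z = some T := by
  have h := h z
  revert h hz
  generalize Γ z = o, A z = a, B z = b
  intro hz h
  cases h <;> simp_all

theorem Split.some_right {Γ A B : Env} (h : Split Γ A B) {z : Name} {T : Ty}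
    (hz : B z = some T) : Γ z = some T := h.symm.some_left hz

theorem Split.some_or {Γ A B : Env} (h : Split Γ A B) {z : Name} {T : Ty}
    (hz : Γ z = some T) : A z = some T ∨ B z = some T := by
  have h := h z
  revert h hz
  generalize Γ z = o, A z = a, B z = b
  intro hz h
  cases h <;> simp_all

theorem Split.right_eq_none {Γ A B : Env} (h : Split Γ A B) {z : Name} {T : Ty}
    (hz : A z = some T) (hT : T.Lin) : B z = none := by
  have h := h z
  revert h hz
  generalize Γ z = o, A z = a, B z = b
  intro hz h
  cases h with
  | none => rfl
  | un h => cases hz; exact absurd hT h.not_lin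
  | linL => rfl
  | linR => cases hz

theorem Split.un {Γ A B : Env} (h : Split Γ A B) (hA : A.Un) (hB : B.Un) : Γ.Un := by
  rw [← h.eq_left hB]; exact hA

theorem Env.Un.split {Γ : Env} (h : Γ.Un) : Split Γ Γ Γ := by
  intro z
  have h := h z
  rcases hz : Γ z with _ | T
  · exact .none
  · exact .un (h T hz)

theorem Split.below {Γ A B : Env} {m : Mult} (h : Split Γ A B) (hA : A.Below m)
    (hB : B.Below m) : Γ.Below m := by
  intro z T hz
  rcases h.some_or hz with h | h
  · exact hA z T h
  · exact hB z T h

theorem Env.Un.below {Γ : Env} (h : Γ.Un) (m : Mult) : Γ.Below m :=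
  fun z T hz => (h z T hz).below m

theorem Env.below_lin (Γ : Env) : Γ.Below .lin := fun _ T _ => T.below_lin

/-- The names of linear type in the union of two parts. -/
theorem Split.flv {Γ A B : Env} (h : Split Γ A B) : Γ.flv = A.flv ∪ B.flv := by
  ext z
  constructor
  · rintro ⟨T, hz, hT⟩
    rcases h.some_or hz with h | h
    · exact .inl ⟨T, h, hT⟩
    · exact .inr ⟨T, h, hT⟩
  · rintro (⟨T, hz, hT⟩ | ⟨T, hz, hT⟩)
    · exact ⟨T, h.some_left hz, hT⟩
    · exact ⟨T, h.some_right hz, hT⟩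

theorem Env.Running.left {Γ A B : Env} (hΓ : Γ.Running) (h : Split Γ A B) : A.Running :=
  fun z T hz => hΓ z T (h.some_left hz)

theorem Env.Running.right {Γ A B : Env} (hΓ : Γ.Running) (h : Split Γ A B) : B.Running :=
  hΓ.left h.symm

theorem Env.Running.extChan {Γ : Env} (hΓ : Γ.Running) (S R : STy) :
    (Γ.extChan S R).Running := by
  intro z T hz
  match z with
  | .chan 0 => cases hz; simp [Ty.Lin, Ty.mult, Name.IsChan]
  | .chan 1 => cases hz; simp [Ty.Lin, Ty.mult, Name.IsChan]
  | .chan (n + 2) => exact hΓ (.chan n) T hz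
  | .var n => exact hΓ (.var n) T hz
  | .ref n => exact hΓ (.ref n) T hz

theorem Env.Running.extRef {Γ : Env} (hΓ : Γ.Running) : Γ.extRef.Running := by
  intro z T hz
  match z with
  | .ref 0 => cases hz; simp [Ty.Lin, Ty.mult, Name.IsChan]
  | .ref (n + 1) => exact hΓ (.ref n) T hz
  | .chan n => exact hΓ (.chan n) T hz
  | .var n => exact hΓ (.var n) T hz

/-! ### Inversion of typing -/

/-- Any typing derivation may end in subsumption, so case analysis does not suffice and each
inversion is an induction. The subsumptions are composed into a final `Sub`, or pushed into a
premise where the rule allows it. Where the rule gives `unit`, they are trivial. -/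
theorem HasType.name_inv {Γ : Env} {z : Name} {V : Ty} (h : HasType Γ (.name z) V) :
    ∃ T, Γ z = some T ∧ (∀ z' T', z' ≠ z → Γ z' = some T' → T'.Un) ∧ Sub T V := by
  generalize he : Exp.name z = g at h
  induction h with
  | name h₁ h₂ => cases he; exact ⟨_, h₁, h₂, .refl _⟩
  | sub _ hs ih =>
    obtain ⟨T, h₁, h₂, h₃⟩ := ih he
    exact ⟨T, h₁, h₂, h₃.trans hs⟩
  | _ => cases he

theorem HasType.unit_inv {Γ : Env} {V : Ty} (h : HasType Γ .unit V) : Γ.Un ∧ V = .unit := by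
  generalize he : Exp.unit = g at h
  induction h with
  | unit h => exact ⟨h, rfl⟩
  | sub _ hs ih =>
    obtain ⟨h, rfl⟩ := ih he
    cases hs
    exact ⟨h, rfl⟩
  | _ => cases he

theorem HasType.lam_inv {Γ : Env} {m : Mult} {e : Exp} {V : Ty} (h : HasType Γ (.lam m e) V) :
    ∃ T U, HasType (Γ.extVar T) e U ∧ Γ.Below m ∧ Sub (.fn m T U) V := by
  generalize he : Exp.lam m e = g at h
  induction h with
  | lam h₁ h₂ => cases he; exact ⟨_, _, h₁, h₂, .refl _⟩
  | sub _ hs ih =>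
    obtain ⟨T, U, h₁, h₂, h₃⟩ := ih he
    exact ⟨T, U, h₁, h₂, h₃.trans hs⟩
  | _ => cases he

theorem HasType.app_inv {Γ : Env} {e f : Exp} {V : Ty} (h : HasType Γ (.app e f) V) :
    ∃ Γ₁ Γ₂ m T, Split Γ Γ₁ Γ₂ ∧ HasType Γ₁ e (.fn m T V) ∧ HasType Γ₂ f T := by
  generalize he : Exp.app e f = g at h
  induction h with
  | app h₁ h₂ h₃ => cases he; exact ⟨_, _, _, _, h₁, h₂, h₃⟩
  | sub _ hs ih =>
    obtain ⟨Γ₁, Γ₂, m, T, h₁, h₂, h₃⟩ := ih he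
    -- Codomains are covariant, so the subsumption moves into the type of the function.
    exact ⟨Γ₁, Γ₂, m, T, h₁, h₂.sub (.fn (.refl _) hs (.refl _)), h₃⟩
  | _ => cases he

theorem HasType.pair_inv {Γ : Env} {m : Mult} {e f : Exp} {V : Ty}
    (h : HasType Γ (.pair m e f) V) :
    ∃ Γ₁ Γ₂ T U, Split Γ Γ₁ Γ₂ ∧ HasType Γ₁ e T ∧ HasType Γ₂ f U ∧ T.Below m ∧ U.Below m ∧
      Sub (.prod m T U) V := by
  generalize he : Exp.pair m e f = g at h
  induction h with
  | pair h₁ h₂ h₃ h₄ h₅ => cases he; exact ⟨_, _, _, _, h₁, h₂, h₃, h₄, h₅, .refl _⟩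
  | sub _ hs ih =>
    obtain ⟨Γ₁, Γ₂, T, U, h₁, h₂, h₃, h₄, h₅, h₆⟩ := ih he
    exact ⟨Γ₁, Γ₂, T, U, h₁, h₂, h₃, h₄, h₅, h₆.trans hs⟩
  | _ => cases he

theorem HasType.letPair_inv {Γ : Env} {e f : Exp} {V : Ty} (h : HasType Γ (.letPair e f) V) :
    ∃ Γ₁ Γ₂ m T₁ T₂, Split Γ Γ₁ Γ₂ ∧ HasType Γ₁ e (.prod m T₁ T₂) ∧
      HasType ((Γ₂.extVar T₁).extVar T₂) f V := by
  generalize he : Exp.letPair e f = g at h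
  induction h with
  | letPair h₁ h₂ h₃ => cases he; exact ⟨_, _, _, _, _, h₁, h₂, h₃⟩
  | sub _ hs ih =>
    obtain ⟨Γ₁, Γ₂, m, T₁, T₂, h₁, h₂, h₃⟩ := ih he
    exact ⟨Γ₁, Γ₂, m, T₁, T₂, h₁, h₂, h₃.sub hs⟩
  | _ => cases he

theorem HasType.fork_inv {Γ : Env} {e : Exp} {V : Ty} (h : HasType Γ (.fork e) V) :
    HasType Γ e .unit ∧ V = .unit := by
  generalize he : Exp.fork e = g at h
  induction h with
  | fork h => cases he; exact ⟨h, rfl⟩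
  | sub _ hs ih =>
    obtain ⟨h, rfl⟩ := ih he
    cases hs
    exact ⟨h, rfl⟩
  | _ => cases he

theorem HasType.new_inv {Γ : Env} {V : Ty} (h : HasType Γ .new V) :
    ∃ S : STy, Γ.Un ∧ Sub (.prod .lin (.sess S) (.sess S.dual)) V := by
  generalize he : Exp.new = g at h
  induction h with
  | new S h => exact ⟨S, h, .refl _⟩
  | sub _ hs ih =>
    obtain ⟨S, h₁, h₂⟩ := ih he
    exact ⟨S, h₁, h₂.trans hs⟩
  | _ => cases he

theorem HasType.send_inv {Γ : Env} {e f : Exp} {V : Ty} (h : HasType Γ (.send e f) V) :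
    ∃ Γ₁ Γ₂ T S, Split Γ Γ₁ Γ₂ ∧ HasType Γ₁ e T ∧ HasType Γ₂ f (.sess (.send T S)) ∧
      Sub (.sess S) V := by
  generalize he : Exp.send e f = g at h
  induction h with
  | send h₁ h₂ h₃ => cases he; exact ⟨_, _, _, _, h₁, h₂, h₃, .refl _⟩
  | sub _ hs ih =>
    obtain ⟨Γ₁, Γ₂, T, S, h₁, h₂, h₃, h₄⟩ := ih he
    exact ⟨Γ₁, Γ₂, T, S, h₁, h₂, h₃, h₄.trans hs⟩
  | _ => cases he

theorem HasType.recv_inv {Γ : Env} {e : Exp} {V : Ty} (h : HasType Γ (.recv e) V) :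
    ∃ T S, HasType Γ e (.sess (.recv T S)) ∧ Sub (.prod .lin T (.sess S)) V := by
  generalize he : Exp.recv e = g at h
  induction h with
  | recv h => cases he; exact ⟨_, _, h, .refl _⟩
  | sub _ hs ih =>
    obtain ⟨T, S, h₁, h₂⟩ := ih he
    exact ⟨T, S, h₁, h₂.trans hs⟩
  | _ => cases he

theorem HasType.select_inv {Γ : Env} {l : Label} {e : Exp} {V : Ty}
    (h : HasType Γ (.select l e) V) :
    ∃ (I : Finset Label) (hI : I.Nonempty) (S : {l // l ∈ I} → STy) (hl : l ∈ I),
      HasType Γ e (.sess (.select I hI S)) ∧ Sub (.sess (S ⟨l, hl⟩)) V := by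
  generalize he : Exp.select l e = g at h
  induction h with
  | select j h => cases he; exact ⟨_, _, _, j.2, h, .refl _⟩
  | sub _ hs ih =>
    obtain ⟨I, hI, S, hl, h₁, h₂⟩ := ih he
    exact ⟨I, hI, S, hl, h₁, h₂.trans hs⟩
  | _ => cases he

theorem HasType.branch_inv {Γ : Env} {e : Exp} {I : Finset Label} {f : {l // l ∈ I} → Exp}
    {V : Ty} (h : HasType Γ (.branch e I f) V) :
    ∃ (Γ₁ Γ₂ : Env) (hI : I.Nonempty) (S : {l // l ∈ I} → STy), Split Γ Γ₁ Γ₂ ∧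
      HasType Γ₁ e (.sess (.choice I hI S)) ∧
      ∀ i, HasType (Γ₂.extVar (.sess (S i))) (f i) V := by
  generalize he : Exp.branch e I f = g at h
  induction h with
  | branch h₁ h₂ h₃ => cases he; exact ⟨_, _, _, _, h₁, h₂, h₃⟩
  | sub _ hs ih =>
    obtain ⟨Γ₁, Γ₂, hI, S, h₁, h₂, h₃⟩ := ih he
    exact ⟨Γ₁, Γ₂, hI, S, h₁, h₂, fun i => (h₃ i).sub hs⟩
  | _ => cases he

theorem HasType.close_inv {Γ : Env} {e : Exp} {V : Ty} (h : HasType Γ (.close e) V) :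
    HasType Γ e (.sess .close) ∧ V = .unit := by
  generalize he : Exp.close e = g at h
  induction h with
  | close h => cases he; exact ⟨h, rfl⟩
  | sub _ hs ih =>
    obtain ⟨h, rfl⟩ := ih he
    cases hs
    exact ⟨h, rfl⟩
  | _ => cases he

theorem HasType.wait_inv {Γ : Env} {e : Exp} {V : Ty} (h : HasType Γ (.wait e) V) :
    HasType Γ e (.sess .wait) ∧ V = .unit := by
  generalize he : Exp.wait e = g at h
  induction h with
  | wait h => cases he; exact ⟨h, rfl⟩
  | sub _ hs ih =>
    obtain ⟨h, rfl⟩ := ih he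
    cases hs
    exact ⟨h, rfl⟩
  | _ => cases he

theorem HasType.cast_inv {Γ : Env} {e : Exp} {T U V : Ty} {p : BLabel}
    (h : HasType Γ (.cast e T p U) V) : HasType Γ e T ∧ CSub T U ∧ Sub U V := by
  generalize he : Exp.cast e T p U = g at h
  induction h with
  | cast h₁ h₂ => cases he; exact ⟨h₁, h₂, .refl _⟩
  | sub _ hs ih =>
    obtain ⟨h₁, h₂, h₃⟩ := ih he
    exact ⟨h₁, h₂, h₃.trans hs⟩
  | _ => cases he

/-- A value of unrestricted type uses no linear names. -/
theorem Value.env_un {v : Exp} (hv : Value v) :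
    ∀ {Γ : Env} {T : Ty}, HasType Γ v T → T.Un → Γ.Un := by
  have name : ∀ {z : Name} {Γ : Env} {T : Ty}, HasType Γ (.name z) T → T.Un → Γ.Un := by
    intro z Γ T h hT
    obtain ⟨T₀, h₁, h₂, h₃⟩ := h.name_inv
    intro z' T' hz'
    by_cases hzz : z' = z
    · subst hzz
      rw [h₁] at hz'
      cases hz'
      exact h₃.un hT
    · exact h₂ z' T' hzz hz'
  induction hv with
  | unit => intro Γ T h _; exact h.unit_inv.1
  | lam m e =>
    intro Γ T h hT
    obtain ⟨_, _, _, h₂, h₃⟩ := h.lam_inv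
    obtain rfl : m = .un := h₃.un hT
    exact fun z T hz => (h₂ z T hz).un
  | pair m _ _ ih₁ ih₂ =>
    intro Γ T h hT
    obtain ⟨_, _, _, _, h₁, h₂, h₃, h₄, h₅, h₆⟩ := h.pair_inv
    obtain rfl : m = .un := h₆.un hT
    exact h₁.un (ih₁ h₂ h₄.un) (ih₂ h₃ h₅.un)
  | chan n => exact name
  | ref n => exact name
  | castDyn G p _ hG ih =>
    intro Γ T h _
    -- A value cast to the dynamic type comes from an unrestricted ground type. Linear values are
    -- kept behind references instead.
    exact ih h.cast_inv.1 hG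
  | castDC G p _ ih =>
    intro Γ T h hT
    exact absurd (Ty.sess_lin _) (h.cast_inv.2.2.un hT).not_lin
  | castSess S R p _ _ _ ih =>
    intro Γ T h hT
    exact absurd (Ty.sess_lin _) (h.cast_inv.2.2.un hT).not_lin
  | castFn m n T U T' U' p _ ih =>
    intro Γ V h hV
    obtain ⟨h₁, h₂, h₃⟩ := h.cast_inv
    obtain rfl : n = .un := h₃.un hV
    -- Consistent subtyping of function types gives `m ≤ n = un`, so the inner function is
    -- unrestricted too.
    cases h₂ with
    | fn _ _ hm => exact ih h₁ hm.eq_un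

/-! ### Renaming -/

/-- The environment seen through a renaming. -/
def Env.comap (r : Ren) (Δ : Env) : Env := fun z => Δ (r.app z)

/-- All linear names of the environment are in the image of the renaming. -/
def Ren.Covers (r : Ren) (Δ : Env) : Prop :=
  ∀ z T, Δ z = some T → T.Lin → ∃ z', r.app z' = z

def Ren.Inj (r : Ren) : Prop := Function.Injective r.app

theorem Ren.Inj.upVar {r : Ren} (h : r.Inj) : r.upVar.Inj := by
  intro z z' hz
  match z, z' with
  | .var 0, .var 0 => rfl
  | .var (n + 1), .var (m + 1) =>
    have := @h (.var n) (.var m) (by simpa [Ren.app, Ren.upVar] using hz)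
    simpa using this
  | .var 0, .var (m + 1) => simp [Ren.app, Ren.upVar] at hz
  | .var (n + 1), .var 0 => simp [Ren.app, Ren.upVar] at hz
  | .chan n, .chan m => exact @h (.chan n) (.chan m) hz
  | .ref n, .ref m => exact @h (.ref n) (.ref m) hz
  | .var n, .chan m => cases hz
  | .var n, .ref m => cases hz
  | .chan n, .var m => cases hz
  | .chan n, .ref m => cases hz
  | .ref n, .var m => cases hz
  | .ref n, .chan m => cases hz

theorem Ren.Inj.upChan {r : Ren} (h : r.Inj) : r.upChan.Inj := by
  intro z z' hz
  match z, z' with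
  | .chan 0, .chan 0 => rfl
  | .chan 1, .chan 1 => rfl
  | .chan (n + 2), .chan (m + 2) =>
    have := @h (.chan n) (.chan m) (by simpa [Ren.app, Ren.upChan] using hz)
    simpa using this
  | .chan 0, .chan 1 => simp [Ren.app, Ren.upChan] at hz
  | .chan 0, .chan (m + 2) => simp [Ren.app, Ren.upChan] at hz
  | .chan 1, .chan (m + 2) => simp [Ren.app, Ren.upChan] at hz
  | .chan 1, .chan 0 => simp [Ren.app, Ren.upChan] at hz
  | .chan (n + 2), .chan 0 => simp [Ren.app, Ren.upChan] at hz
  | .chan (n + 2), .chan 1 => simp [Ren.app, Ren.upChan] at hz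
  | .var n, .var m => exact @h (.var n) (.var m) hz
  | .ref n, .ref m => exact @h (.ref n) (.ref m) hz
  | .var n, .chan m => cases hz
  | .var n, .ref m => cases hz
  | .chan n, .var m => cases hz
  | .chan n, .ref m => cases hz
  | .ref n, .var m => cases hz
  | .ref n, .chan m => cases hz

theorem Ren.Inj.upRef {r : Ren} (h : r.Inj) : r.upRef.Inj := by
  intro z z' hz
  match z, z' with
  | .ref 0, .ref 0 => rfl
  | .ref (n + 1), .ref (m + 1) =>
    have := @h (.ref n) (.ref m) (by simpa [Ren.app, Ren.upRef] using hz)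
    simpa using this
  | .ref 0, .ref (m + 1) => simp [Ren.app, Ren.upRef] at hz
  | .ref (n + 1), .ref 0 => simp [Ren.app, Ren.upRef] at hz
  | .chan n, .chan m => exact @h (.chan n) (.chan m) hz
  | .var n, .var m => exact @h (.var n) (.var m) hz
  | .var n, .chan m => cases hz
  | .var n, .ref m => cases hz
  | .chan n, .var m => cases hz
  | .chan n, .ref m => cases hz
  | .ref n, .var m => cases hz
  | .ref n, .chan m => cases hz

theorem Env.comap_extVar (r : Ren) (Δ : Env) (T : Ty) :
    (Δ.extVar T).comap r.upVar = (Δ.comap r).extVar T := by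
  funext z
  match z with
  | .var 0 => rfl
  | .var (n + 1) => rfl
  | .chan n => rfl
  | .ref n => rfl

theorem Env.comap_extChan (r : Ren) (Δ : Env) (S R : STy) :
    (Δ.extChan S R).comap r.upChan = (Δ.comap r).extChan S R := by
  funext z
  match z with
  | .chan 0 => rfl
  | .chan 1 => rfl
  | .chan (n + 2) => rfl
  | .var n => rfl
  | .ref n => rfl

theorem Env.comap_extRef (r : Ren) (Δ : Env) :
    Δ.extRef.comap r.upRef = (Δ.comap r).extRef := by
  funext z
  match z with
  | .ref 0 => rfl
  | .ref (n + 1) => rfl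
  | .var n => rfl
  | .chan n => rfl

theorem Ren.exists_app_eq_var {r : Ren} {n : ℕ} :
    (∃ z, r.app z = .var n) ↔ ∃ m, r.var m = n := by
  constructor
  · rintro ⟨z, hz⟩
    cases z <;> cases hz
    exact ⟨_, rfl⟩
  · rintro ⟨m, rfl⟩
    exact ⟨.var m, rfl⟩

theorem Ren.exists_app_eq_chan {r : Ren} {n : ℕ} :
    (∃ z, r.app z = .chan n) ↔ ∃ m, r.chan m = n := by
  constructor
  · rintro ⟨z, hz⟩
    cases z <;> cases hz
    exact ⟨_, rfl⟩
  · rintro ⟨m, rfl⟩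
    exact ⟨.chan m, rfl⟩

theorem Ren.exists_app_eq_ref {r : Ren} {n : ℕ} :
    (∃ z, r.app z = .ref n) ↔ ∃ m, r.ref m = n := by
  constructor
  · rintro ⟨z, hz⟩
    cases z <;> cases hz
    exact ⟨_, rfl⟩
  · rintro ⟨m, rfl⟩
    exact ⟨.ref m, rfl⟩

/-- The bound variable is always in the image of the lifted renaming. One direction serves weakening
under a binder, the other strengthening. -/
theorem Ren.covers_upVar {r : Ren} {Δ : Env} {T : Ty} :
    r.upVar.Covers (Δ.extVar T) ↔ r.Covers Δ := by
  constructor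
  · intro h z U hz hU
    match z with
    | .var n =>
      obtain ⟨z', hz'⟩ := h (.var (n + 1)) U hz hU
      match z' with
      | .var 0 => simp [Ren.app, Ren.upVar] at hz'
      | .var (m + 1) => exact ⟨.var m, by simpa [Ren.app, Ren.upVar] using hz'⟩
    | .chan n =>
      obtain ⟨m, hm⟩ := Ren.exists_app_eq_chan.1 (h (.chan n) U hz hU)
      exact ⟨.chan m, congrArg Name.chan hm⟩
    | .ref n =>
      obtain ⟨m, hm⟩ := Ren.exists_app_eq_ref.1 (h (.ref n) U hz hU)
      exact ⟨.ref m, congrArg Name.ref hm⟩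
  · intro h z U hz hU
    match z with
    | .var 0 => exact ⟨.var 0, rfl⟩
    | .var (n + 1) =>
      obtain ⟨z', hz'⟩ := h (.var n) U hz hU
      match z' with
      | .var m => exact ⟨.var (m + 1), by simpa [Ren.app, Ren.upVar] using hz'⟩
    | .chan n =>
      obtain ⟨m, hm⟩ := Ren.exists_app_eq_chan.1 (h (.chan n) U hz hU)
      exact ⟨.chan m, congrArg Name.chan hm⟩
    | .ref n =>
      obtain ⟨m, hm⟩ := Ren.exists_app_eq_ref.1 (h (.ref n) U hz hU)
      exact ⟨.ref m, congrArg Name.ref hm⟩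

theorem Ren.covers_upChan {r : Ren} {Δ : Env} {S R : STy} :
    r.upChan.Covers (Δ.extChan S R) ↔ r.Covers Δ := by
  constructor
  · intro h z U hz hU
    match z with
    | .chan n =>
      obtain ⟨z', hz'⟩ := h (.chan (n + 2)) U hz hU
      match z' with
      | .chan 0 => simp [Ren.app, Ren.upChan] at hz'
      | .chan 1 => simp [Ren.app, Ren.upChan] at hz'
      | .chan (m + 2) => exact ⟨.chan m, by simpa [Ren.app, Ren.upChan] using hz'⟩
    | .var n =>
      obtain ⟨m, hm⟩ := Ren.exists_app_eq_var.1 (h (.var n) U hz hU)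
      exact ⟨.var m, congrArg Name.var hm⟩
    | .ref n =>
      obtain ⟨m, hm⟩ := Ren.exists_app_eq_ref.1 (h (.ref n) U hz hU)
      exact ⟨.ref m, congrArg Name.ref hm⟩
  · intro h z U hz hU
    match z with
    | .chan 0 => exact ⟨.chan 0, rfl⟩
    | .chan 1 => exact ⟨.chan 1, rfl⟩
    | .chan (n + 2) =>
      obtain ⟨z', hz'⟩ := h (.chan n) U hz hU
      match z' with
      | .chan m => exact ⟨.chan (m + 2), by simpa [Ren.app, Ren.upChan] using hz'⟩
    | .var n =>
      obtain ⟨m, hm⟩ := Ren.exists_app_eq_var.1 (h (.var n) U hz hU)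
      exact ⟨.var m, congrArg Name.var hm⟩
    | .ref n =>
      obtain ⟨m, hm⟩ := Ren.exists_app_eq_ref.1 (h (.ref n) U hz hU)
      exact ⟨.ref m, congrArg Name.ref hm⟩

theorem Ren.covers_upRef {r : Ren} {Δ : Env} : r.upRef.Covers Δ.extRef ↔ r.Covers Δ := by
  constructor
  · intro h z U hz hU
    match z with
    | .ref n =>
      obtain ⟨z', hz'⟩ := h (.ref (n + 1)) U hz hU
      match z' with
      | .ref 0 => simp [Ren.app, Ren.upRef] at hz'
      | .ref (m + 1) => exact ⟨.ref m, by simpa [Ren.app, Ren.upRef] using hz'⟩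
    | .chan n =>
      obtain ⟨m, hm⟩ := Ren.exists_app_eq_chan.1 (h (.chan n) U hz hU)
      exact ⟨.chan m, congrArg Name.chan hm⟩
    | .var n =>
      obtain ⟨m, hm⟩ := Ren.exists_app_eq_var.1 (h (.var n) U hz hU)
      exact ⟨.var m, congrArg Name.var hm⟩
  · intro h z U hz hU
    match z with
    | .ref 0 => exact ⟨.ref 0, rfl⟩
    | .ref (n + 1) =>
      obtain ⟨z', hz'⟩ := h (.ref n) U hz hU
      match z' with
      | .ref m => exact ⟨.ref (m + 1), by simpa [Ren.app, Ren.upRef] using hz'⟩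
    | .chan n =>
      obtain ⟨m, hm⟩ := Ren.exists_app_eq_chan.1 (h (.chan n) U hz hU)
      exact ⟨.chan m, congrArg Name.chan hm⟩
    | .var n =>
      obtain ⟨m, hm⟩ := Ren.exists_app_eq_var.1 (h (.var n) U hz hU)
      exact ⟨.var m, congrArg Name.var hm⟩

theorem Split.comap {Δ A B : Env} (h : Split Δ A B) (r : Ren) :
    Split (Δ.comap r) (A.comap r) (B.comap r) := fun z => h (r.app z)

theorem Ren.Covers.left {r : Ren} {Δ A B : Env} (h : r.Covers Δ) (hs : Split Δ A B) :
    r.Covers A := fun z T hz hT => h z T (hs.some_left hz) hT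

theorem Ren.Covers.right {r : Ren} {Δ A B : Env} (h : r.Covers Δ) (hs : Split Δ A B) :
    r.Covers B := h.left hs.symm

theorem Split.covers {r : Ren} {Δ A B : Env} (hs : Split Δ A B) (hA : r.Covers A)
    (hB : r.Covers B) : r.Covers Δ := by
  intro z T hz hT
  rcases hs.some_or hz with h | h
  · exact hA z T h hT
  · exact hB z T h hT

/-- A splitting of the environment seen through a renaming comes from a splitting. -/
theorem Split.of_comap {r : Ren} {Δ A B : Env} (hr : r.Inj) (hc : r.Covers Δ)
    (h : Split (Δ.comap r) A B) :
    ∃ A' B', Split Δ A' B' ∧ A'.comap r = A ∧ B'.comap r = B := by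
  have : ∀ z, ∃ a b, SplitAt (Δ z) a b ∧ ∀ z', r.app z' = z → a = A z' ∧ b = B z' := by
    intro z
    by_cases hz : ∃ z', r.app z' = z
    · obtain ⟨z', rfl⟩ := hz
      refine ⟨A z', B z', h z', fun z'' h' => ?_⟩
      rw [hr h']
      exact ⟨rfl, rfl⟩
    -- A name outside the image is not linear, by coverage, and can be given to both parts.
    · refine ⟨Δ z, Δ z, ?_, fun z' hz' => absurd ⟨z', hz'⟩ hz⟩
      rcases hΔ : Δ z with _ | T
      · exact .none
      · exact .un (T.un_or_lin.resolve_right fun hT => hz (hc z T hΔ hT))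
  choose A' B' h₁ h₂ using this
  exact ⟨A', B', h₁, funext fun z => (h₂ _ z rfl).1, funext fun z => (h₂ _ z rfl).2⟩

theorem Env.Un.of_comap {r : Ren} {Δ : Env} (hc : r.Covers Δ) (h : (Δ.comap r).Un) : Δ.Un := by
  intro z T hz
  refine T.un_or_lin.resolve_right fun hT => ?_
  obtain ⟨z', rfl⟩ := hc z T hz hT
  exact (h z' T hz).not_lin hT

theorem Env.Un.comap {r : Ren} {Δ : Env} (h : Δ.Un) : (Δ.comap r).Un :=
  fun z T hz => h (r.app z) T hz

theorem Env.Un.covers {Δ : Env} (h : Δ.Un) (r : Ren) : r.Covers Δ :=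
  fun z T hz hT => absurd hT (h z T hz).not_lin

theorem Env.Below.of_comap {r : Ren} {Δ : Env} {m : Mult} (hc : r.Covers Δ)
    (h : (Δ.comap r).Below m) : Δ.Below m := by
  intro z T hz
  rcases T.un_or_lin with hT | hT
  · exact hT.below m
  · obtain ⟨z', rfl⟩ := hc z T hz hT
    exact h z' T hz

/-- Renaming and weakening at once. By coverage the names of `Δ` outside the image are unrestricted,
hence harmless, and injectivity keeps distinct linear names distinct. -/
theorem HasType.rename {Γ : Env} {e : Exp} {T : Ty} (h : HasType Γ e T) :
    ∀ {r : Ren} {Δ : Env}, r.Inj → r.Covers Δ → Δ.comap r = Γ → HasType Δ (e.rename r) T := by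
  induction h with
  | name h₁ h₂ =>
    rintro r Δ hr hc rfl
    refine .name h₁ fun z' T' hz' hT' => ?_
    refine T'.un_or_lin.resolve_right fun hl => ?_
    obtain ⟨z'', rfl⟩ := hc z' T' hT' hl
    exact (h₂ z'' T' (fun h => hz' (h ▸ rfl)) hT').not_lin hl
  | unit h =>
    rintro r Δ hr hc rfl
    exact .unit (h.of_comap hc)
  | lam _ h₂ ih =>
    rintro r Δ hr hc rfl
    exact .lam (ih hr.upVar (Ren.covers_upVar.2 hc) (Env.comap_extVar _ _ _)) (h₂.of_comap hc)
  | app hs _ _ ih₁ ih₂ =>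
    rintro r Δ hr hc rfl
    obtain ⟨A, B, hs', rfl, rfl⟩ := hs.of_comap hr hc
    exact .app hs' (ih₁ hr (hc.left hs') rfl) (ih₂ hr (hc.right hs') rfl)
  | pair hs _ _ h₁ h₂ ih₁ ih₂ =>
    rintro r Δ hr hc rfl
    obtain ⟨A, B, hs', rfl, rfl⟩ := hs.of_comap hr hc
    exact .pair hs' (ih₁ hr (hc.left hs') rfl) (ih₂ hr (hc.right hs') rfl) h₁ h₂
  | letPair hs _ _ ih₁ ih₂ =>
    rintro r Δ hr hc rfl
    obtain ⟨A, B, hs', rfl, rfl⟩ := hs.of_comap hr hc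
    refine .letPair hs' (ih₁ hr (hc.left hs') rfl) (ih₂ hr.upVar.upVar ?_ ?_)
    · exact Ren.covers_upVar.2 (Ren.covers_upVar.2 (hc.right hs'))
    · rw [Env.comap_extVar, Env.comap_extVar]
  | fork _ ih =>
    rintro r Δ hr hc rfl
    exact .fork (ih hr hc rfl)
  | new S h =>
    rintro r Δ hr hc rfl
    exact .new S (h.of_comap hc)
  | send hs _ _ ih₁ ih₂ =>
    rintro r Δ hr hc rfl
    obtain ⟨A, B, hs', rfl, rfl⟩ := hs.of_comap hr hc
    exact .send hs' (ih₁ hr (hc.left hs') rfl) (ih₂ hr (hc.right hs') rfl)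
  | recv _ ih =>
    rintro r Δ hr hc rfl
    exact .recv (ih hr hc rfl)
  | select j _ ih =>
    rintro r Δ hr hc rfl
    exact .select j (ih hr hc rfl)
  | branch hs _ _ ih₁ ih₂ =>
    rintro r Δ hr hc rfl
    obtain ⟨A, B, hs', rfl, rfl⟩ := hs.of_comap hr hc
    exact .branch hs' (ih₁ hr (hc.left hs') rfl) fun i =>
      ih₂ i hr.upVar (Ren.covers_upVar.2 (hc.right hs')) (Env.comap_extVar _ _ _)
  | close _ ih =>
    rintro r Δ hr hc rfl
    exact .close (ih hr hc rfl)
  | wait _ ih =>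
    rintro r Δ hr hc rfl
    exact .wait (ih hr hc rfl)
  | cast _ h ih =>
    rintro r Δ hr hc rfl
    exact .cast (ih hr hc rfl) h
  | sub _ h ih =>
    rintro r Δ hr hc rfl
    exact .sub (ih hr hc rfl) h

/-- Strengthening. Coverage is a conclusion here: a linear name of `Δ` must be used, and the renamed
expression has free names in the image only. -/
theorem HasType.of_rename {e : Exp} : ∀ {r : Ren} {Δ : Env} {T : Ty}, r.Inj →
    HasType Δ (e.rename r) T → r.Covers Δ ∧ HasType (Δ.comap r) e T := by
  induction e with
  | name z =>
    intro r Δ T hr h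
    obtain ⟨T₀, h₁, h₂, h₃⟩ := h.name_inv
    refine ⟨fun z' T' hz' hT' => ?_, .sub (.name h₁ fun z' T' hz' hT' => ?_) h₃⟩
    · by_contra hne
      exact (h₂ z' T' (fun h => hne ⟨z, h.symm⟩) hz').not_lin hT'
    · exact h₂ _ T' (fun h => hz' (hr h)) hT'
  | unit =>
    intro r Δ T hr h
    obtain ⟨h', rfl⟩ := h.unit_inv
    exact ⟨h'.covers r, .unit h'.comap⟩
  | lam m e ih =>
    intro r Δ T hr h
    obtain ⟨_, _, h₁, h₂, h₃⟩ := h.lam_inv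
    obtain ⟨hc, h₁⟩ := ih hr.upVar h₁
    rw [Env.comap_extVar] at h₁
    exact ⟨Ren.covers_upVar.1 hc, .sub (.lam h₁ fun z T hz => h₂ _ T hz) h₃⟩
  | app e f ih₁ ih₂ =>
    intro r Δ T hr h
    obtain ⟨_, _, _, _, hs, h₁, h₂⟩ := h.app_inv
    obtain ⟨hc₁, h₁⟩ := ih₁ hr h₁
    obtain ⟨hc₂, h₂⟩ := ih₂ hr h₂
    exact ⟨hs.covers hc₁ hc₂, .app (hs.comap r) h₁ h₂⟩
  | pair m e f ih₁ ih₂ =>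
    intro r Δ T hr h
    obtain ⟨_, _, _, _, hs, h₁, h₂, h₃, h₄, h₅⟩ := h.pair_inv
    obtain ⟨hc₁, h₁⟩ := ih₁ hr h₁
    obtain ⟨hc₂, h₂⟩ := ih₂ hr h₂
    exact ⟨hs.covers hc₁ hc₂, .sub (.pair (hs.comap r) h₁ h₂ h₃ h₄) h₅⟩
  | letPair e f ih₁ ih₂ =>
    intro r Δ T hr h
    obtain ⟨_, _, _, _, _, hs, h₁, h₂⟩ := h.letPair_inv
    obtain ⟨hc₁, h₁⟩ := ih₁ hr h₁
    obtain ⟨hc₂, h₂⟩ := ih₂ hr.upVar.upVar h₂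
    rw [Env.comap_extVar, Env.comap_extVar] at h₂
    exact ⟨hs.covers hc₁ (Ren.covers_upVar.1 (Ren.covers_upVar.1 hc₂)),
      .letPair (hs.comap r) h₁ h₂⟩
  | fork e ih =>
    intro r Δ T hr h
    obtain ⟨h', rfl⟩ := h.fork_inv
    obtain ⟨hc, h'⟩ := ih hr h'
    exact ⟨hc, .fork h'⟩
  | new =>
    intro r Δ T hr h
    obtain ⟨S, h₁, h₂⟩ := h.new_inv
    exact ⟨h₁.covers r, .sub (.new S h₁.comap) h₂⟩
  | send e f ih₁ ih₂ =>
    intro r Δ T hr h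
    obtain ⟨_, _, _, _, hs, h₁, h₂, h₃⟩ := h.send_inv
    obtain ⟨hc₁, h₁⟩ := ih₁ hr h₁
    obtain ⟨hc₂, h₂⟩ := ih₂ hr h₂
    exact ⟨hs.covers hc₁ hc₂, .sub (.send (hs.comap r) h₁ h₂) h₃⟩
  | recv e ih =>
    intro r Δ T hr h
    obtain ⟨_, _, h₁, h₂⟩ := h.recv_inv
    obtain ⟨hc, h₁⟩ := ih hr h₁
    exact ⟨hc, .sub (.recv h₁) h₂⟩
  | select l e ih =>
    intro r Δ T hr h
    obtain ⟨I, hI, S, hl, h₁, h₂⟩ := h.select_inv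
    obtain ⟨hc, h₁⟩ := ih hr h₁
    exact ⟨hc, .sub (.select ⟨l, hl⟩ h₁) h₂⟩
  | branch e I f ih₁ ih₂ =>
    intro r Δ T hr h
    obtain ⟨_, _, hI, S, hs, h₁, h₂⟩ := h.branch_inv
    obtain ⟨hc₁, h₁⟩ := ih₁ hr h₁
    have h₂ := fun i => ih₂ i hr.upVar (h₂ i)
    -- Coverage of the environment shared by the branches is read off from one branch, so at least
    -- one label is needed.
    obtain ⟨l, hl⟩ := hI
    refine ⟨hs.covers hc₁ (Ren.covers_upVar.1 (h₂ ⟨l, hl⟩).1),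
      .branch (hs.comap r) h₁ fun i => ?_⟩
    have := (h₂ i).2
    rwa [Env.comap_extVar] at this
  | close e ih =>
    intro r Δ T hr h
    obtain ⟨h', rfl⟩ := h.close_inv
    obtain ⟨hc, h'⟩ := ih hr h'
    exact ⟨hc, .close h'⟩
  | wait e ih =>
    intro r Δ T hr h
    obtain ⟨h', rfl⟩ := h.wait_inv
    obtain ⟨hc, h'⟩ := ih hr h'
    exact ⟨hc, .wait h'⟩
  | cast e T p U ih =>
    intro r Δ V hr h
    obtain ⟨h₁, h₂, h₃⟩ := h.cast_inv
    obtain ⟨hc, h₁⟩ := ih hr h₁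
    exact ⟨hc, .sub (.cast h₁ h₂) h₃⟩

/-! ### Substitution -/

/-- The new variable belongs to `Γ`. The part `Θ'` of the substituted value must contain it if it is
unrestricted and must not if it is linear. Either way the shifted value keeps its type. -/
theorem Env.exists_lift {Γ Δ Θ : Env} (hs : Split Δ Γ Θ) (T : Ty) :
    ∃ Θ' : Env, Split (Δ.extVar T) (Γ.extVar T) Θ' ∧ Θ'.comap Ren.shiftVar = Θ ∧
      Ren.shiftVar.Covers Θ' := by
  obtain ⟨o, ho, hun⟩ : ∃ o, SplitAt (some T) (some T) o ∧ ∀ U, o = some U → U.Un := by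
    rcases T.un_or_lin with h | h
    · exact ⟨some T, .un h, by simpa using h⟩
    · exact ⟨none, .linL h, by simp⟩
  let Θ' : Env := fun
    | .var 0 => o
    | .var (n + 1) => Θ (.var n)
    | .chan n => Θ (.chan n)
    | .ref n => Θ (.ref n)
  refine ⟨Θ', ?_, ?_, ?_⟩
  · intro z
    match z with
    | .var 0 => exact ho
    | .var (n + 1) => exact hs (.var n)
    | .chan n => exact hs (.chan n)
    | .ref n => exact hs (.ref n)
  · funext z
    cases z <;> rfl
  · intro z U hz hU
    match z with
    | .var 0 => exact absurd hU (hun U hz).not_lin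
    | .var (n + 1) => exact ⟨.var n, rfl⟩
    | .chan n => exact ⟨.chan n, rfl⟩
    | .ref n => exact ⟨.ref n, rfl⟩

theorem Ren.shiftVar_inj : Ren.shiftVar.Inj := by
  intro z z' h
  cases z <;> cases z' <;> simp_all [Ren.app, Ren.shiftVar]

theorem Ren.shiftChan_inj : Ren.shiftChan.Inj := by
  intro z z' h
  cases z <;> cases z' <;> simp_all [Ren.app, Ren.shiftChan]

theorem Ren.shiftRef_inj : Ren.shiftRef.Inj := by
  intro z z' h
  cases z <;> cases z' <;> simp_all [Ren.app, Ren.shiftRef]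

/-- Make room for one more term variable, with index `k`. -/
def Ren.skip : ℕ → Ren
  | 0 => Ren.shiftVar
  | k + 1 => (Ren.skip k).upVar

theorem Ren.skip_inj : ∀ k, (Ren.skip k).Inj
  | 0 => Ren.shiftVar_inj
  | k + 1 => (Ren.skip_inj k).upVar

theorem Ren.skip_chan (k n : ℕ) : (Ren.skip k).chan n = n := by
  induction k with
  | zero => rfl
  | succ k ih => exact ih

theorem Ren.skip_ref (k n : ℕ) : (Ren.skip k).ref n = n := by
  induction k with
  | zero => rfl
  | succ k ih => exact ih

theorem Ren.skip_var_ne : ∀ k n : ℕ, (Ren.skip k).var n ≠ k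
  | 0, n => by simp [Ren.skip, Ren.shiftVar]
  | k + 1, 0 => by simp [Ren.skip, Ren.upVar]
  | k + 1, n + 1 => by simpa [Ren.skip, Ren.upVar] using Ren.skip_var_ne k n

theorem Ren.eq_or_exists_skip : ∀ k n : ℕ, n = k ∨ ∃ m, (Ren.skip k).var m = n
  | 0, 0 => .inl rfl
  | 0, n + 1 => .inr ⟨n, rfl⟩
  | k + 1, 0 => .inr ⟨0, rfl⟩
  | k + 1, n + 1 => by
    rcases Ren.eq_or_exists_skip k n with rfl | ⟨m, hm⟩
    · exact .inl rfl
    · exact .inr ⟨m + 1, congrArg (· + 1) hm⟩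

/-- The substitution `s` replaces the variable with index `k` by an expression which has the type
of that variable in `Γ`, and which uses the linear names that `Δ` has in addition to `Γ`. -/
def SubstAt (k : ℕ) (s : ℕ → Exp) (Γ Δ : Env) : Prop :=
  (∀ n, s ((Ren.skip k).var n) = .name (.var n)) ∧
  ∃ Θ, Split Δ (Γ.comap (Ren.skip k)) Θ ∧ (Γ (.var k) = none → Θ.Un) ∧
    ∀ U, Γ (.var k) = some U → HasType Θ (s k) U ∧ (U.Un → Θ.Un)

/-- The first splitting makes `o'` the unrestricted fragment of `o`, and every part inherits this
fragment. -/
theorem SplitAt.un_part {o o' a b : Option Ty} (h : SplitAt o o o') (h' : SplitAt o a b)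
    (ho : ∀ T, o' = some T → T.Un) : SplitAt a a o' := by
  cases h with
  | none => cases h'; exact .none
  | un h => cases h' <;> first | exact .un h | exact absurd ‹_› h.not_lin
  | linL h =>
    cases h' with
    | un h' => exact absurd h h'.not_lin
    | linL => exact .linL h
    | linR => exact .none

/-- If `Θ` is unrestricted, both parts may use it. Otherwise the replaced variable is present and
linear, so it lies in exactly one part. That part receives all of `Θ`, and the other, where the
variable is absent, gets by with an unrestricted fragment. -/
theorem SubstAt.split {k : ℕ} {s : ℕ → Exp} {Γ Δ Γ₁ Γ₂ : Env} (h : SubstAt k s Γ Δ)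
    (hs : Split Γ Γ₁ Γ₂) : ∃ Δ₁ Δ₂, Split Δ Δ₁ Δ₂ ∧ SubstAt k s Γ₁ Δ₁ ∧ SubstAt k s Γ₂ Δ₂ := by
  obtain ⟨hv, Θ, hΔ, hnone, hsome⟩ := h
  have hs' := hs.comap (Ren.skip k)
  by_cases hΘ : Θ.Un
  · have key : ∀ {A B : Env}, Split Γ A B →
        SubstAt k s A (A.comap (Ren.skip k)) := by
      intro A B hAB
      refine ⟨hv, Θ, fun z => ?_, fun _ => hΘ, fun U hU =>
        ⟨(hsome U (hAB.some_left hU)).1, fun _ => hΘ⟩⟩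
      have h₁ := hΔ z
      rw [← congrFun (hΔ.eq_left hΘ) z] at h₁
      exact h₁.un_part (hAB.comap (Ren.skip k) z) (hΘ z)
    refine ⟨_, _, ?_, key hs, key hs.symm⟩
    rw [← hΔ.eq_left hΘ]
    exact hs'
  · have key : ∀ {A B : Env} {U : Ty}, Split Γ A B → A (.var k) = some U → U.Lin →
        ∃ C, Split Δ C (B.comap (Ren.skip k)) ∧ SubstAt k s A C ∧
          SubstAt k s B (B.comap (Ren.skip k)) := by
      intro A B U hAB hA hU
      obtain ⟨C, hC, hC'⟩ := hΔ.rotate (hAB.comap (Ren.skip k))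
      obtain ⟨Z, hZ, hZun⟩ := (B.comap (Ren.skip k)).exists_split_un
      refine ⟨C, hC, ⟨hv, Θ, hC', ?_, fun V hV => hsome V (hAB.some_left hV)⟩,
        hv, Z, hZ, fun _ => hZun, ?_⟩
      · simp [hA]
      · simp [hAB.right_eq_none hA hU]
    rcases hk : Γ (.var k) with _ | U
    · exact absurd (hnone hk) hΘ
    have hU : U.Lin := U.un_or_lin.resolve_left fun h => hΘ ((hsome U hk).2 h)
    rcases hs.some_or hk with h | h
    · obtain ⟨C, h₁, h₂, h₃⟩ := key hs h hU
      exact ⟨_, _, h₁, h₂, h₃⟩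
    · obtain ⟨C, h₁, h₂, h₃⟩ := key hs.symm h hU
      exact ⟨_, _, h₁.symm, h₃, h₂⟩

theorem SubstAt.below {k : ℕ} {s : ℕ → Exp} {Γ Δ : Env} {m : Mult} (h : SubstAt k s Γ Δ)
    (hΓ : Γ.Below m) : Δ.Below m := by
  obtain ⟨_, Θ, hΔ, hnone, hsome⟩ := h
  refine hΔ.below (fun z T hz => hΓ _ T hz) ?_
  rcases hk : Γ (.var k) with _ | U
  · exact (hnone hk).below m
  cases m with
  | un => exact ((hsome U hk).2 (hΓ _ U hk).un).below _
  | lin => exact Θ.below_lin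

theorem SubstAt.un {k : ℕ} {s : ℕ → Exp} {Γ Δ : Env} (h : SubstAt k s Γ Δ)
    (hΓ : Γ.Un) : Δ.Un :=
  fun z T hz => (h.below (hΓ.below .un) z T hz).un

theorem SubstAt.up {k : ℕ} {s : ℕ → Exp} {Γ Δ : Env} (h : SubstAt k s Γ Δ) (T : Ty) :
    SubstAt (k + 1) (upSubst s) (Γ.extVar T) (Δ.extVar T) := by
  obtain ⟨hv, Θ, hΔ, hnone, hsome⟩ := h
  obtain ⟨Θ', hs, hc, hcov⟩ := Env.exists_lift hΔ T
  refine ⟨fun n => ?_, Θ', ?_, fun hk => ?_, fun U hk => ?_⟩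
  · match n with
    | 0 => rfl
    | n + 1 =>
      change (s ((Ren.skip k).var n)).rename _ = _
      rw [hv]
      rfl
  · rwa [Ren.skip, Env.comap_extVar]
  · exact Env.Un.of_comap hcov (hc ▸ hnone hk)
  · obtain ⟨h₁, h₂⟩ := hsome U hk
    exact ⟨h₁.rename Ren.shiftVar_inj hcov hc, fun hU => Env.Un.of_comap hcov (hc ▸ h₂ hU)⟩

/-- The index `k` counts the binders already crossed. Splittings and binders are handled by
`SubstAt.split` and `SubstAt.up`, so only names require an argument. -/
theorem HasType.substAt {Γ : Env} {e : Exp} {T : Ty} (h : HasType Γ e T) :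
    ∀ {k : ℕ} {s : ℕ → Exp} {Δ : Env}, SubstAt k s Γ Δ → HasType Δ (e.subst s) T := by
  induction h with
  | @name Γ z T h₁ h₂ =>
    rintro k s Δ ⟨hv, Θ, hΔ, hnone, hsome⟩
    -- A name other than the replaced variable: that variable is then absent or unrestricted, so `Θ`
    -- is unrestricted and `Δ` is `Γ` without the variable.
    have other : ∀ z', (Ren.skip k).app z' = z → z ≠ .var k → HasType Δ (.name z') T := by
      intro z' hz' hk
      have hΘ : Θ.Un := by
        rcases hU : Γ (.var k) with _ | U
        · exact hnone hU
        · exact (hsome U hU).2 (h₂ _ U hk.symm hU)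
      rw [← hΔ.eq_left hΘ]
      subst hz'
      exact .name h₁ fun z'' T' hne hT' =>
        h₂ _ T' (fun h => hne (Ren.skip_inj k h)) hT'
    match z with
    | .var n =>
      rcases Ren.eq_or_exists_skip k n with rfl | ⟨m, rfl⟩
      -- The name is the replaced variable itself: everything else in `Γ` is unrestricted, so `Δ`
      -- coincides with `Θ`.
      · have hun : (Γ.comap (Ren.skip n)).Un := by
          intro z' T' hz'
          refine h₂ _ T' (fun h => ?_) hz'
          cases z' <;> simp [Ren.app] at h
          exact Ren.skip_var_ne _ _ h
        rw [← hΔ.eq_right hun]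
        exact (hsome T h₁).1
      · change HasType Δ (s _) T
        rw [hv]
        refine other (.var m) rfl fun h => ?_
        exact Ren.skip_var_ne k m (by simpa using h)
    | .chan n => exact other (.chan n) (by simp [Ren.app, Ren.skip_chan]) (by simp)
    | .ref n => exact other (.ref n) (by simp [Ren.app, Ren.skip_ref]) (by simp)
  | unit h => exact fun hσ => .unit (hσ.un h)
  | lam _ h₂ ih => exact fun hσ => .lam (ih (hσ.up _)) (hσ.below h₂)
  | app hs _ _ ih₁ ih₂ =>
    intro k s Δ hσ
    obtain ⟨Δ₁, Δ₂, hs', h₁, h₂⟩ := hσ.split hs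
    exact .app hs' (ih₁ h₁) (ih₂ h₂)
  | pair hs _ _ hT hU ih₁ ih₂ =>
    intro k s Δ hσ
    obtain ⟨Δ₁, Δ₂, hs', h₁, h₂⟩ := hσ.split hs
    exact .pair hs' (ih₁ h₁) (ih₂ h₂) hT hU
  | letPair hs _ _ ih₁ ih₂ =>
    intro k s Δ hσ
    obtain ⟨Δ₁, Δ₂, hs', h₁, h₂⟩ := hσ.split hs
    exact .letPair hs' (ih₁ h₁) (ih₂ ((h₂.up _).up _))
  | fork _ ih => exact fun hσ => .fork (ih hσ)
  | new S h => exact fun hσ => .new S (hσ.un h)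
  | send hs _ _ ih₁ ih₂ =>
    intro k s Δ hσ
    obtain ⟨Δ₁, Δ₂, hs', h₁, h₂⟩ := hσ.split hs
    exact .send hs' (ih₁ h₁) (ih₂ h₂)
  | recv _ ih => exact fun hσ => .recv (ih hσ)
  | select j _ ih => exact fun hσ => .select j (ih hσ)
  | branch hs _ _ ih₁ ih₂ =>
    intro k s Δ hσ
    obtain ⟨Δ₁, Δ₂, hs', h₁, h₂⟩ := hσ.split hs
    exact .branch hs' (ih₁ h₁) fun i => ih₂ i (h₂.up _)
  | close _ ih => exact fun hσ => .close (ih hσ)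
  | wait _ ih => exact fun hσ => .wait (ih hσ)
  | cast _ h ih => exact fun hσ => .cast (ih hσ) h
  | sub _ h ih => exact fun hσ => .sub (ih hσ) h

/-- Being a value is what provides the clause `U.Un → Θ.Un` of `SubstAt`: an unrestricted variable
may be duplicated or dropped, and so must be the environment of `v`. -/
theorem HasType.subst1 {Γ Δ Θ : Env} {e v : Exp} {T U : Ty} (h : HasType (Γ.extVar U) e T)
    (hs : Split Δ Γ Θ) (hv : HasType Θ v U) (hval : Value v) : HasType Δ (e.subst1 v) T := by
  refine h.substAt (k := 0) ⟨fun n => rfl, Θ, ?_, fun h => (by cases h), fun V hV => ?_⟩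
  · have : (Γ.extVar U).comap (Ren.skip 0) = Γ := by
      funext z
      cases z <;> rfl
    rwa [this]
  · cases hV
    exact ⟨hv, hval.env_un hv⟩

-- Composition laws for renaming and substitution

theorem Exp.rename_subst {e : Exp} : ∀ {r : Ren} {s t : ℕ → Exp}, r.chan = id → r.ref = id →
    (∀ n, s (r.var n) = t n) → (e.rename r).subst s = e.subst t := by
  have up : ∀ {r : Ren} {s t : ℕ → Exp}, (∀ n, s (r.var n) = t n) →
      ∀ n, upSubst s (r.upVar.var n) = upSubst t n := by
    intro r s t h n
    match n with
    | 0 => rfl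
    | n + 1 => exact congrArg _ (h n)
  induction e with
  | name z => intro r s t hc hr h; cases z <;> simp_all [Exp.rename, Exp.subst, Ren.app]
  | branch e I f ih₁ ih₂ =>
    intro r s t hc hr h
    simp only [Exp.rename, Exp.subst, ih₁ hc hr h, fun i => ih₂ i (r := r.upVar) hc hr (up h)]
  | letPair e f ih₁ ih₂ =>
    intro r s t hc hr h
    simp only [Exp.rename, Exp.subst, ih₁ hc hr h,
      ih₂ (r := r.upVar.upVar) hc hr (up (up h))]
  | lam m e ih =>
    intro r s t hc hr h
    simp only [Exp.rename, Exp.subst, ih (r := r.upVar) hc hr (up h)]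
  | _ => intro r s t hc hr h; simp only [Exp.rename, Exp.subst, *]

theorem Exp.rename_rename {e : Exp} : ∀ {r r' r'' : Ren}, (∀ z, r'.app (r.app z) = r''.app z) →
    (e.rename r).rename r' = e.rename r'' := by
  have up : ∀ {r r' r'' : Ren}, (∀ z, r'.app (r.app z) = r''.app z) →
      ∀ z, r'.upVar.app (r.upVar.app z) = r''.upVar.app z := by
    intro r r' r'' h z
    match z with
    | .var 0 => rfl
    | .var (n + 1) => simpa [Ren.app, Ren.upVar] using h (.var n)
    | .chan n => exact h (.chan n)
    | .ref n => exact h (.ref n)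
  induction e with
  | name z => intro r r' r'' h; simp only [Exp.rename, h]
  | branch e I f ih₁ ih₂ =>
    intro r r' r'' h
    simp only [Exp.rename, ih₁ h, fun i => ih₂ i (up h)]
  | letPair e f ih₁ ih₂ => intro r r' r'' h; simp only [Exp.rename, ih₁ h, ih₂ (up (up h))]
  | lam m e ih => intro r r' r'' h; simp only [Exp.rename, ih (up h)]
  | app e f ih₁ ih₂ => intro r r' r'' h; simp only [Exp.rename, ih₁ h, ih₂ h]
  | pair m e f ih₁ ih₂ => intro r r' r'' h; simp only [Exp.rename, ih₁ h, ih₂ h]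
  | send e f ih₁ ih₂ => intro r r' r'' h; simp only [Exp.rename, ih₁ h, ih₂ h]
  | unit => intros; rfl
  | new => intros; rfl
  | fork e ih => intro r r' r'' h; simp only [Exp.rename, ih h]
  | recv e ih => intro r r' r'' h; simp only [Exp.rename, ih h]
  | select l e ih => intro r r' r'' h; simp only [Exp.rename, ih h]
  | close e ih => intro r r' r'' h; simp only [Exp.rename, ih h]
  | wait e ih => intro r r' r'' h; simp only [Exp.rename, ih h]
  | cast e T p U ih => intro r r' r'' h; simp only [Exp.rename, ih h]

theorem Exp.subst_rename {e : Exp} : ∀ {r : Ren} {s t : ℕ → Exp}, r.chan = id → r.ref = id →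
    (∀ n, (s n).rename r = (t (r.var n))) → (e.subst s).rename r = (e.rename r).subst t := by
  have up : ∀ {r : Ren} {s t : ℕ → Exp}, (∀ n, (s n).rename r = t (r.var n)) →
      ∀ n, (upSubst s n).rename r.upVar = upSubst t (r.upVar.var n) := by
    intro r s t h n
    match n with
    | 0 => rfl
    | n + 1 =>
      change ((s n).rename _).rename _ = (t (r.var n)).rename _
      rw [← h]
      rw [Exp.rename_rename (r'' := ⟨fun n => r.var n + 1, r.chan, r.ref⟩),
        Exp.rename_rename (r'' := ⟨fun n => r.var n + 1, r.chan, r.ref⟩)]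
      · intro z; cases z <;> rfl
      · intro z; cases z <;> rfl
  induction e with
  | name z => intro r s t hc hr h; cases z <;> simp_all [Exp.rename, Exp.subst, Ren.app]
  | branch e I f ih₁ ih₂ =>
    intro r s t hc hr h
    simp only [Exp.rename, Exp.subst, ih₁ hc hr h, fun i => ih₂ i (r := r.upVar) hc hr (up h)]
  | letPair e f ih₁ ih₂ =>
    intro r s t hc hr h
    simp only [Exp.rename, Exp.subst, ih₁ hc hr h,
      ih₂ (r := r.upVar.upVar) hc hr (up (up h))]
  | lam m e ih =>
    intro r s t hc hr h
    simp only [Exp.rename, Exp.subst, ih (r := r.upVar) hc hr (up h)]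
  | app e f ih₁ ih₂ =>
    intro r s t hc hr h; simp only [Exp.rename, Exp.subst, ih₁ hc hr h, ih₂ hc hr h]
  | pair m e f ih₁ ih₂ =>
    intro r s t hc hr h; simp only [Exp.rename, Exp.subst, ih₁ hc hr h, ih₂ hc hr h]
  | send e f ih₁ ih₂ =>
    intro r s t hc hr h; simp only [Exp.rename, Exp.subst, ih₁ hc hr h, ih₂ hc hr h]
  | unit => intros; rfl
  | new => intros; rfl
  | fork e ih => intro r s t hc hr h; simp only [Exp.rename, Exp.subst, ih hc hr h]
  | recv e ih => intro r s t hc hr h; simp only [Exp.rename, Exp.subst, ih hc hr h]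
  | select l e ih => intro r s t hc hr h; simp only [Exp.rename, Exp.subst, ih hc hr h]
  | close e ih => intro r s t hc hr h; simp only [Exp.rename, Exp.subst, ih hc hr h]
  | wait e ih => intro r s t hc hr h; simp only [Exp.rename, Exp.subst, ih hc hr h]
  | cast e T p U ih => intro r s t hc hr h; simp only [Exp.rename, Exp.subst, ih hc hr h]

theorem Exp.subst_subst {e : Exp} : ∀ {s t u : ℕ → Exp}, (∀ n, (s n).subst t = u n) →
    (e.subst s).subst t = e.subst u := by
  have up : ∀ {s t u : ℕ → Exp}, (∀ n, (s n).subst t = u n) →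
      ∀ n, (upSubst s n).subst (upSubst t) = upSubst u n := by
    intro s t u h n
    match n with
    | 0 => rfl
    | n + 1 =>
      change ((s n).rename _).subst _ = (u n).rename _
      rw [← h]
      exact (Exp.subst_rename rfl rfl fun _ => rfl).symm
  induction e with
  | name z => intro s t u h; cases z <;> simp_all [Exp.subst]
  | branch e I f ih₁ ih₂ =>
    intro s t u h
    simp only [Exp.subst, ih₁ h, fun i => ih₂ i (up h)]
  | letPair e f ih₁ ih₂ => intro s t u h; simp only [Exp.subst, ih₁ h, ih₂ (up (up h))]
  | lam m e ih => intro s t u h; simp only [Exp.subst, ih (up h)]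
  | app e f ih₁ ih₂ => intro s t u h; simp only [Exp.subst, ih₁ h, ih₂ h]
  | pair m e f ih₁ ih₂ => intro s t u h; simp only [Exp.subst, ih₁ h, ih₂ h]
  | send e f ih₁ ih₂ => intro s t u h; simp only [Exp.subst, ih₁ h, ih₂ h]
  | unit => intros; rfl
  | new => intros; rfl
  | fork e ih => intro s t u h; simp only [Exp.subst, ih h]
  | recv e ih => intro s t u h; simp only [Exp.subst, ih h]
  | select l e ih => intro s t u h; simp only [Exp.subst, ih h]
  | close e ih => intro s t u h; simp only [Exp.subst, ih h]
  | wait e ih => intro s t u h; simp only [Exp.subst, ih h]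
  | cast e T p U ih => intro s t u h; simp only [Exp.subst, ih h]

theorem Exp.subst_name {e : Exp} : ∀ {s : ℕ → Exp}, (∀ n, s n = .name (.var n)) →
    e.subst s = e := by
  have up : ∀ {s : ℕ → Exp}, (∀ n, s n = .name (.var n)) →
      ∀ n, upSubst s n = .name (.var n) := by
    intro s h n
    match n with
    | 0 => rfl
    | n + 1 =>
      change (s n).rename _ = _
      rw [h]
      rfl
  induction e with
  | name z => intro s h; cases z <;> simp_all [Exp.subst]
  | branch e I f ih₁ ih₂ =>
    intro s h
    simp only [Exp.subst, ih₁ h, fun i => ih₂ i (up h)]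
  | letPair e f ih₁ ih₂ => intro s h; simp only [Exp.subst, ih₁ h, ih₂ (up (up h))]
  | lam m e ih => intro s h; simp only [Exp.subst, ih (up h)]
  | app e f ih₁ ih₂ => intro s h; simp only [Exp.subst, ih₁ h, ih₂ h]
  | pair m e f ih₁ ih₂ => intro s h; simp only [Exp.subst, ih₁ h, ih₂ h]
  | send e f ih₁ ih₂ => intro s h; simp only [Exp.subst, ih₁ h, ih₂ h]
  | unit => intros; rfl
  | new => intros; rfl
  | fork e ih => intro s h; simp only [Exp.subst, ih h]
  | recv e ih => intro s h; simp only [Exp.subst, ih h]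
  | select l e ih => intro s h; simp only [Exp.subst, ih h]
  | close e ih => intro s h; simp only [Exp.subst, ih h]
  | wait e ih => intro s h; simp only [Exp.subst, ih h]
  | cast e T p U ih => intro s h; simp only [Exp.subst, ih h]

/-- This reduces pair destruction to single substitutions. The expression `w` goes in first, and is
shifted because the variable awaiting `v` is still in scope at that moment. -/
theorem Exp.subst2_eq (e v w : Exp) :
    e.subst2 v w = (e.subst1 (w.rename Ren.shiftVar)).subst1 v := by
  refine (Exp.subst_subst fun n => ?_).symm
  match n with
  | 0 =>
    exact (Exp.rename_subst (t := fun n => .name (.var n)) rfl rfl fun _ => rfl).trans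
      (Exp.subst_name fun _ => rfl)
  | 1 => rfl
  | n + 2 => rfl

theorem HasType.subst2 {Γ Γ' Δ Θ₁ Θ₂ : Env} {e v w : Exp} {T T₁ T₂ : Ty}
    (h : HasType ((Γ.extVar T₁).extVar T₂) e T) (hs₂ : Split Γ' Γ Θ₂) (hs₁ : Split Δ Γ' Θ₁)
    (hv : HasType Θ₁ v T₁) (hw : HasType Θ₂ w T₂) (hval : Value v) (hwal : Value w) :
    HasType Δ (e.subst2 v w) T := by
  rw [Exp.subst2_eq]
  -- The first substitution takes place under the remaining variable of type `T₁`, past which the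
  -- environment of `w` is lifted.
  obtain ⟨Θ', hs, hc, hcov⟩ := Env.exists_lift hs₂ T₁
  exact (h.subst1 hs (hw.rename Ren.shiftVar_inj hcov hc) (hwal.rename _)).subst1 hs₁ hv hval

/-! ### Free channel endpoints -/

/-- Every endpoint in the environment is linear and therefore must be used. The hypothesis is weaker
than `Env.Running`, which fails under binders because bound variables may have linear type. -/
theorem HasType.mem_flv {Γ : Env} {e : Exp} {T : Ty} (h : HasType Γ e T) :
    (∀ z T, Γ z = some T → z.IsChan → T.Lin) →
      ∀ z, z ∈ e.flv ↔ z.IsChan ∧ ∃ T, Γ z = some T := by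
  have ext : ∀ {Γ : Env} {T : Ty} {z : Name}, z.IsChan → (Γ.extVar T) z = Γ z := by
    intro Γ T z hz
    cases z <;> first | rfl | exact hz.elim
  have ext_lin : ∀ {Γ : Env} {T : Ty}, (∀ z T, Γ z = some T → z.IsChan → T.Lin) →
      ∀ z U, (Γ.extVar T) z = some U → z.IsChan → U.Lin := by
    intro Γ T h z U hz hc
    rw [ext hc] at hz
    exact h z U hz hc
  have un : ∀ {Γ : Env}, Γ.Un → (∀ z T, Γ z = some T → z.IsChan → T.Lin) →
      ∀ z, ¬ (z.IsChan ∧ ∃ T, Γ z = some T) := by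
    rintro Γ hun h z ⟨hz, T, hT⟩
    exact (hun z T hT).not_lin (h z T hT hz)
  have union : ∀ {Γ A B : Env} {X Y : Finset Name}, Split Γ A B →
      (∀ z, z ∈ X ↔ z.IsChan ∧ ∃ T, A z = some T) →
      (∀ z, z ∈ Y ↔ z.IsChan ∧ ∃ T, B z = some T) →
      ∀ z, z ∈ X ∪ Y ↔ z.IsChan ∧ ∃ T, Γ z = some T := by
    intro Γ A B X Y hs hX hY z
    rw [Finset.mem_union, hX, hY]
    constructor
    · rintro (⟨hz, T, hT⟩ | ⟨hz, T, hT⟩)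
      · exact ⟨hz, T, hs.some_left hT⟩
      · exact ⟨hz, T, hs.some_right hT⟩
    · rintro ⟨hz, T, hT⟩
      rcases hs.some_or hT with h | h
      · exact .inl ⟨hz, T, h⟩
      · exact .inr ⟨hz, T, h⟩
  induction h with
  | @name Γ z T h₁ h₂ =>
    intro hΓ z'
    have other : z' ≠ z → ¬ (z'.IsChan ∧ ∃ T, Γ z' = some T) := by
      rintro hne ⟨hc, T', hT'⟩
      exact (h₂ z' T' hne hT').not_lin (hΓ z' T' hT' hc)
    match z with
    | .chan n =>
      by_cases hz : z' = .chan n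
      · subst hz
        simp [Exp.flv, Name.IsChan, h₁]
      · simp [Exp.flv, hz, other hz]
    | .var n =>
      by_cases hz : z' = .var n
      · subst hz
        simp [Exp.flv, Name.IsChan]
      · simp [Exp.flv, other hz]
    | .ref n =>
      by_cases hz : z' = .ref n
      · subst hz
        simp [Exp.flv, Name.IsChan]
      · simp [Exp.flv, other hz]
  | unit h => intro hΓ z; simp [Exp.flv, un h hΓ z]
  | new S h => intro hΓ z; simp [Exp.flv, un h hΓ z]
  | lam _ _ ih =>
    intro hΓ z
    rw [Exp.flv, ih (ext_lin hΓ)]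
    exact and_congr_right fun hz => by rw [ext hz]
  | app hs _ _ ih₁ ih₂ =>
    intro hΓ
    exact union hs (ih₁ fun z T h => hΓ z T (hs.some_left h))
      (ih₂ fun z T h => hΓ z T (hs.some_right h))
  | pair hs _ _ _ _ ih₁ ih₂ =>
    intro hΓ
    exact union hs (ih₁ fun z T h => hΓ z T (hs.some_left h))
      (ih₂ fun z T h => hΓ z T (hs.some_right h))
  | send hs _ _ ih₁ ih₂ =>
    intro hΓ
    exact union hs (ih₁ fun z T h => hΓ z T (hs.some_left h))
      (ih₂ fun z T h => hΓ z T (hs.some_right h))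
  | letPair hs _ _ ih₁ ih₂ =>
    intro hΓ
    refine union hs (ih₁ fun z T h => hΓ z T (hs.some_left h)) fun z => ?_
    rw [ih₂ (ext_lin (ext_lin fun z T h => hΓ z T (hs.some_right h)))]
    exact and_congr_right fun hz => by rw [ext hz, ext hz]
  | @branch Γ Γ₁ Γ₂ e I hI S f T hs _ _ ih₁ ih₂ =>
    intro hΓ
    refine union hs (ih₁ fun z T h => hΓ z T (hs.some_left h)) fun z => ?_
    have key : ∀ i, z ∈ (f i).flv ↔ z.IsChan ∧ ∃ T, Γ₂ z = some T := by
      intro i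
      rw [ih₂ i (ext_lin fun z T h => hΓ z T (hs.some_right h))]
      exact and_congr_right fun hz => by rw [ext hz]
    rw [Finset.mem_biUnion]
    constructor
    · rintro ⟨i, _, hi⟩
      exact (key i).1 hi
    · intro h
      -- All branches share one environment, hence have the same free endpoints. A non-empty label
      -- set makes their union equal to this common set.
      obtain ⟨l, hl⟩ := hI
      exact ⟨⟨l, hl⟩, Finset.mem_attach _ _, (key _).2 h⟩
  | fork _ ih => exact ih
  | recv _ ih => exact ih
  | select j _ ih => exact ih
  | close _ ih => exact ih
  | wait _ ih => exact ih
  | cast _ _ ih => exact ih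
  | sub _ _ ih => exact ih

/-- In a running program, the free channel endpoints are the linear names. -/
theorem HasType.flv_eq {Γ : Env} {e : Exp} {T : Ty} (h : HasType Γ e T) (hΓ : Γ.Running) :
    Γ.flv = (e.flv : Set Name) := by
  ext z
  rw [Finset.mem_coe, h.mem_flv (fun z T hz hc => (hΓ z T hz).2 hc)]
  constructor
  · rintro ⟨T, hz, hT⟩
    exact ⟨(hΓ z T hz).1 hT, T, hz⟩
  · rintro ⟨hc, T, hz⟩
    exact ⟨T, hz, (hΓ z T hz).2 hc⟩

/-! ### Regular casts -/

theorem Exp.regularCasts_rename {e : Exp} :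
    ∀ r : Ren, (e.rename r).RegularCasts ↔ e.RegularCasts := by
  induction e <;> intro r <;> simp only [Exp.rename, Exp.RegularCasts, *]

theorem Exp.RegularCasts.subst {e : Exp} : e.RegularCasts → ∀ {s : ℕ → Exp},
    (∀ n, (s n).RegularCasts) → (e.subst s).RegularCasts := by
  have up : ∀ {s : ℕ → Exp}, (∀ n, (s n).RegularCasts) → ∀ n, (upSubst s n).RegularCasts := by
    intro s hs n
    match n with
    | 0 => trivial
    | n + 1 => exact (Exp.regularCasts_rename _).2 (hs n)
  induction e with
  | name z => intro _ s hs; cases z <;> first | exact hs _ | trivial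
  | unit => intros; trivial
  | new => intros; trivial
  | lam m e ih => exact fun h s hs => ih h (up hs)
  | app e f ih₁ ih₂ => exact fun h s hs => ⟨ih₁ h.1 hs, ih₂ h.2 hs⟩
  | pair m e f ih₁ ih₂ => exact fun h s hs => ⟨ih₁ h.1 hs, ih₂ h.2 hs⟩
  | send e f ih₁ ih₂ => exact fun h s hs => ⟨ih₁ h.1 hs, ih₂ h.2 hs⟩
  | letPair e f ih₁ ih₂ => exact fun h s hs => ⟨ih₁ h.1 hs, ih₂ h.2 (up (up hs))⟩
  | branch e I f ih₁ ih₂ => exact fun h s hs => ⟨ih₁ h.1 hs, fun i => ih₂ i (h.2 i) (up hs)⟩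
  | fork e ih => exact fun h s hs => ih h hs
  | recv e ih => exact fun h s hs => ih h hs
  | select l e ih => exact fun h s hs => ih h hs
  | close e ih => exact fun h s hs => ih h hs
  | wait e ih => exact fun h s hs => ih h hs
  | cast e T p U ih => exact fun h s hs => ⟨ih h.1 hs, h.2⟩

theorem Exp.RegularCasts.subst1 {e v : Exp} (he : e.RegularCasts) (hv : v.RegularCasts) :
    (e.subst1 v).RegularCasts := by
  refine he.subst fun n => ?_
  match n with
  | 0 => exact hv
  | n + 1 => trivial

theorem Exp.RegularCasts.subst2 {e v w : Exp} (he : e.RegularCasts) (hv : v.RegularCasts)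
    (hw : w.RegularCasts) : (e.subst2 v w).RegularCasts := by
  refine he.subst fun n => ?_
  match n with
  | 0 => exact hw
  | 1 => exact hv
  | n + 2 => trivial

theorem Ground.regular : ∀ G : Ground, G.ty.Regular
  | .unit => trivial
  | .dc => trivial
  | .fn _ => ⟨trivial, trivial⟩
  | .prod _ => ⟨trivial, trivial, fun _ => ⟨rfl, rfl⟩⟩

theorem GroundS.regular : ∀ G : GroundS, G.sty.Regular
  | .send => ⟨trivial, trivial⟩
  | .recv => ⟨trivial, trivial⟩
  | .select _ _ => fun _ => trivial
  | .choice _ _ => fun _ => trivial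
  | .close => trivial
  | .wait => trivial

/-- Every new annotation is a component of an old one, a ground type, a dynamic type, or a linear
product of regular types, for which the side condition is void. -/
theorem Step.regularCasts {e f : Exp} (h : Step e f) (he : e.RegularCasts) : f.RegularCasts := by
  cases h with
  | @beta _ e _ => exact Exp.RegularCasts.subst1 (e := e) he.1 he.2
  | letPair => exact he.2.subst2 he.1.1 he.1.2
  | castDyn => exact he.1
  | castDC => exact he.1
  | castUnit => exact he.1
  | castApp =>
    obtain ⟨⟨hv, ⟨hT, hU⟩, hT', hU'⟩, hw⟩ := he
    exact ⟨⟨hv, hw, hT', hT⟩, hU, hU'⟩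
  | castPair =>
    obtain ⟨⟨hv, hw⟩, ⟨hT, hU, _⟩, hT', hU', _⟩ := he
    exact ⟨⟨hv, hT, hT'⟩, hw, hU, hU'⟩
  | castSend =>
    obtain ⟨hv, hw, ⟨hT, hS⟩, hT', hS'⟩ := he
    exact ⟨⟨⟨hv, hT', hT⟩, hw⟩, hS, hS'⟩
  | castRecv =>
    obtain ⟨hw, ⟨hT, hS⟩, hT', hS'⟩ := he
    exact ⟨hw, ⟨hT, hS, fun h => by cases h⟩, hT', hS', fun h => by cases h⟩
  | castSelect k h =>
    obtain ⟨hw, hR, hS⟩ := he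
    exact ⟨hw, hR _, hS k⟩
  | castBranch h =>
    obtain ⟨⟨hw, hR, hS⟩, hf⟩ := he
    exact ⟨hw, fun i => ⟨(Exp.regularCasts_rename _).2 (hf _), trivial, hR i, hS _⟩⟩
  | castClose => exact he.1
  | castWait => exact he.1
  | toDyn => exact ⟨⟨he.1, he.2.1, Ground.regular _⟩, Ground.regular _, trivial⟩
  | fromDyn => exact ⟨⟨he.1, trivial, Ground.regular _⟩, Ground.regular _, he.2.2⟩
  | toDC => exact ⟨⟨he.1, he.2.1, GroundS.regular _⟩, GroundS.regular _, trivial⟩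
  | fromDC => exact ⟨⟨he.1, trivial, GroundS.regular _⟩, GroundS.regular _, he.2.2⟩

/-! ### Preservation for expressions -/

/-- A function typed under a variable of type `T` is also typed under a variable of lower session
type, when it is applied to a cast of the latter. -/
theorem HasType.letCast {Γ : Env} {f : Exp} {R S S' : STy} {V : Ty} {p : BLabel}
    (hf : HasType (Γ.extVar (.sess S')) f V) (hRS : CSub (.sess R) (.sess S))
    (hS : Sub (.sess S) (.sess S')) :
    HasType (Γ.extVar (.sess R))
      (.app (.lam .lin (f.rename Ren.shiftVar.upVar))
        (.cast (.name (.var 0)) (.sess R) p (.sess S))) V := by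
  obtain ⟨Z, hZ, hZun⟩ := Γ.exists_split_un
  -- The cast argument consumes the linear variable with index 0. The abstraction is therefore typed
  -- without that entry, and its body is shifted past it.
  let A : Env := fun
    | .var 0 => none
    | .var (n + 1) => Γ (.var n)
    | .chan n => Γ (.chan n)
    | .ref n => Γ (.ref n)
  have hA : A.comap Ren.shiftVar = Γ := by
    funext z
    cases z <;> rfl
  have hcov : Ren.shiftVar.Covers A := by
    intro z T hz _
    match z with
    | .var 0 => cases hz
    | .var (n + 1) => exact ⟨.var n, rfl⟩
    | .chan n => exact ⟨.chan n, rfl⟩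
    | .ref n => exact ⟨.ref n, rfl⟩
  have hs : Split (Γ.extVar (.sess R)) A (Z.extVar (.sess R)) := by
    intro z
    match z with
    | .var 0 => exact .linR (Ty.sess_lin R)
    | .var (n + 1) => exact hZ (.var n)
    | .chan n => exact hZ (.chan n)
    | .ref n => exact hZ (.ref n)
  refine .app hs (.lam ?_ A.below_lin) (.sub (.cast (.name rfl fun z T hne hz => ?_) hRS) hS)
  · exact hf.rename Ren.shiftVar_inj.upVar (Ren.covers_upVar.2 hcov)
      (by rw [Env.comap_extVar, hA])
  · match z with
    | .var 0 => exact absurd rfl hne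
    | .var (n + 1) => exact hZun _ T hz
    | .chan n => exact hZun _ T hz
    | .ref n => exact hZun _ T hz

theorem Step.hasType {e f : Exp} (h : Step e f) (he : e.RegularCasts) {Γ : Env} {V : Ty}
    (ht : HasType Γ e V) : HasType Γ f V := by
  cases h with
  | beta hv =>
    obtain ⟨_, _, _, _, hs, h₁, h₂⟩ := ht.app_inv
    obtain ⟨_, _, h₃, _, h₄⟩ := h₁.lam_inv
    cases h₄ with
    | fn hT hU _ => exact (h₃.subst1 hs (h₂.sub hT) hv).sub hU
  | letPair hv hw =>
    obtain ⟨_, _, _, _, _, hs, h₁, h₂⟩ := ht.letPair_inv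
    obtain ⟨_, _, _, _, hs', h₃, h₄, _, _, h₅⟩ := h₁.pair_inv
    cases h₅ with
    | prod hT hU _ =>
      -- Regrouping lets the environment of `w` join that of the body first and the environment of
      -- `v` last, in the order of the two substitutions.
      obtain ⟨C, hC, hC'⟩ := hs.assoc hs'
      exact h₂.subst2 hC'.symm hC.symm (h₃.sub hT) (h₄.sub hU) hv hw
  | castDyn =>
    obtain ⟨h₁, _, h₂⟩ := ht.cast_inv
    exact h₁.sub h₂
  | castDC =>
    obtain ⟨h₁, _, h₂⟩ := ht.cast_inv
    exact h₁.sub h₂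
  | castUnit =>
    obtain ⟨h₁, _, h₂⟩ := ht.cast_inv
    exact h₁.sub h₂
  | castApp =>
    obtain ⟨_, _, _, _, hs, h₁, h₂⟩ := ht.app_inv
    obtain ⟨h₃, h₄, h₅⟩ := h₁.cast_inv
    cases h₄ with
    | fn hT hU _ =>
      cases h₅ with
      | fn hT' hU' _ => exact .sub (.cast (.app hs h₃ (.cast (h₂.sub hT') hT)) hU) hU'
  | @castPair _ _ _ n _ _ T' U' =>
    obtain ⟨h₁, h₂, h₃⟩ := ht.cast_inv
    obtain ⟨_, _, _, _, hs, h₄, h₅, _, _, h₆⟩ := h₁.pair_inv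
    -- Regularity enters here: the new pair has multiplicity `n`, and for `n = un` its components
    -- must have unrestricted types, although nothing in the typing of the cast says so.
    obtain ⟨_, _, hr⟩ : T'.Regular ∧ U'.Regular ∧ (n = .un → T'.Un ∧ U'.Un) := he.2.2
    cases h₂ with
    | prod hT hU _ =>
      cases h₆ with
      | prod hT' hU' _ =>
        refine .sub (.pair hs (.cast (h₄.sub hT') hT) (.cast (h₅.sub hU') hU) ?_ ?_) h₃
        · cases n
          · exact (hr rfl).1.below _
          · exact Ty.below_lin _
        · cases n
          · exact (hr rfl).2.below _
          · exact Ty.below_lin _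
  | castSend =>
    obtain ⟨_, _, _, _, hs, h₁, h₂, h₃⟩ := ht.send_inv
    obtain ⟨h₄, h₅, h₆⟩ := h₂.cast_inv
    cases h₅ with
    | send hT hS =>
      cases h₆ with
      | send hT' hS' =>
        exact .sub (.cast (.send hs (.cast (h₁.sub hT') hT) h₄) hS) (hS'.trans h₃)
  | castRecv =>
    obtain ⟨_, _, h₁, h₂⟩ := ht.recv_inv
    obtain ⟨h₃, h₄, h₅⟩ := h₁.cast_inv
    cases h₄ with
    | recv hT hS =>
      cases h₅ with
      | recv hT' hS' =>
        exact .sub (.cast (.recv h₃) (.prod hT hS (.refl _)))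
          (.trans (.prod hT' hS' (.refl _)) h₂)
  | castSelect k hJI =>
    obtain ⟨_, _, _, hl, h₁, h₂⟩ := ht.select_inv
    obtain ⟨h₃, h₄, h₅⟩ := h₁.cast_inv
    cases h₄ with
    | select _ hR =>
      cases h₅ with
      | select _ hS =>
        exact .sub (.cast (@HasType.select _ _ _ _ _ ⟨k, hJI k.2⟩ h₃) (hR k))
          ((hS ⟨k, hl⟩).trans h₂)
  | castBranch hIJ =>
    obtain ⟨_, _, _, _, hs, h₁, h₂⟩ := ht.branch_inv
    obtain ⟨h₃, h₄, h₅⟩ := h₁.cast_inv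
    cases h₄ with
    | choice _ hR =>
      cases h₅ with
      | choice _ hS => exact .branch hs h₃ fun i => (h₂ ⟨i, hIJ i.2⟩).letCast (hR i) (hS _)
  | castClose =>
    obtain ⟨h₁, rfl⟩ := ht.close_inv
    exact .close h₁.cast_inv.1
  | castWait =>
    obtain ⟨h₁, rfl⟩ := ht.wait_inv
    exact .wait h₁.cast_inv.1
  | toDyn _ _ _ hG =>
    obtain ⟨h₁, _, h₂⟩ := ht.cast_inv
    -- One half of consistency with the ground type justifies the inner cast; casting from a dynamic
    -- type uses the other half.
    exact .sub (.cast (.cast h₁ hG.1) (.dyn_right _)) h₂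
  | fromDyn _ _ _ hG =>
    obtain ⟨h₁, _, h₂⟩ := ht.cast_inv
    exact .sub (.cast (.cast h₁ (.dyn_left _)) hG.2) h₂
  | toDC _ _ _ hG =>
    obtain ⟨h₁, _, h₂⟩ := ht.cast_inv
    exact .sub (.cast (.cast h₁ hG.1) (.dc_right _)) h₂
  | fromDC _ _ _ hG =>
    obtain ⟨h₁, _, h₂⟩ := ht.cast_inv
    exact .sub (.cast (.cast h₁ (.dc_left _)) hG.2) h₂

/-! ### Evaluation contexts -/

theorem ECtx.fill_rename (r : Ren) (E : ECtx) (e : Exp) :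
    (E.fill e).rename r = (E.rename r).fill (e.rename r) := by
  induction E <;> simp only [ECtx.fill, ECtx.rename, Exp.rename, *]

theorem ECtx.fill_flv (E : ECtx) (e : Exp) : (E.fill e).flv = E.flv ∪ e.flv := by
  induction E <;> simp only [ECtx.fill, ECtx.flv, Exp.flv, Finset.empty_union, *] <;>
    ext z <;> simp only [Finset.mem_union] <;> tauto

theorem ECtx.regularCasts_fill {E : ECtx} {e : Exp} (h : (E.fill e).RegularCasts) :
    e.RegularCasts ∧ ∀ {f : Exp}, f.RegularCasts → (E.fill f).RegularCasts := by
  induction E with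
  | hole => exact ⟨h, id⟩
  | appL E e ih => exact ⟨(ih h.1).1, fun hf => ⟨(ih h.1).2 hf, h.2⟩⟩
  | appR v hv E ih => exact ⟨(ih h.2).1, fun hf => ⟨h.1, (ih h.2).2 hf⟩⟩
  | pairL m E e ih => exact ⟨(ih h.1).1, fun hf => ⟨(ih h.1).2 hf, h.2⟩⟩
  | pairR m v hv E ih => exact ⟨(ih h.2).1, fun hf => ⟨h.1, (ih h.2).2 hf⟩⟩
  | letPair E e ih => exact ⟨(ih h.1).1, fun hf => ⟨(ih h.1).2 hf, h.2⟩⟩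
  | sendL E e ih => exact ⟨(ih h.1).1, fun hf => ⟨(ih h.1).2 hf, h.2⟩⟩
  | sendR v hv E ih => exact ⟨(ih h.2).1, fun hf => ⟨h.1, (ih h.2).2 hf⟩⟩
  | recv E ih => exact ih h
  | select l E ih => exact ih h
  | branch E I f ih => exact ⟨(ih h.1).1, fun hf => ⟨(ih h.1).2 hf, h.2⟩⟩
  | close E ih => exact ih h
  | wait E ih => exact ih h
  | cast E T p U ih => exact ⟨(ih h.1).1, fun hf => ⟨(ih h.1).2 hf, h.2⟩⟩

/-- The content of an evaluation context is typed in a part of the environment, and can be replaced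
by any expression of the same type. -/
theorem ECtx.hasType_fill {E : ECtx} : ∀ {e : Exp} {Γ : Env} {T : Ty}, HasType Γ (E.fill e) T →
    ∃ Γ₁ Γ₂ U, Split Γ Γ₁ Γ₂ ∧ HasType Γ₂ e U ∧
      ∀ {Γ' Γ₂' : Env} {f : Exp}, Split Γ' Γ₁ Γ₂' → HasType Γ₂' f U → HasType Γ' (E.fill f) T := by
  induction E with
  | hole =>
    intro e Γ T h
    -- The empty context needs only the unrestricted fragment, which disappears again after any
    -- refilling.
    obtain ⟨Z, hZ, hun⟩ := Γ.exists_split_un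
    refine ⟨Z, Γ, T, hZ.symm, h, fun hs hf => ?_⟩
    rwa [← hs.eq_right hun]
  | appL E e ih =>
    intro g Γ T h
    obtain ⟨A, B, _, _, hs, h₁, h₂⟩ := h.app_inv
    obtain ⟨A₁, A₂, U, hs', h₃, h₄⟩ := ih h₁
    -- The part of the hole is detached at the root, and the remainder `C` joins the rest of the
    -- subcontext with the sibling's part. For new content the same regrouping is undone.
    obtain ⟨C, hC, hC'⟩ := hs.rotate hs'
    refine ⟨C, A₂, U, hC, h₃, fun hs'' hf => ?_⟩
    obtain ⟨D, hD, hD'⟩ := hs''.rotate hC'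
    exact .app hD (h₄ hD' hf) h₂
  | appR v hv E ih =>
    intro g Γ T h
    obtain ⟨A, B, _, _, hs, h₁, h₂⟩ := h.app_inv
    obtain ⟨A₁, A₂, U, hs', h₃, h₄⟩ := ih h₂
    obtain ⟨C, hC, hC'⟩ := hs.symm.rotate hs'
    refine ⟨C, A₂, U, hC, h₃, fun hs'' hf => ?_⟩
    obtain ⟨D, hD, hD'⟩ := hs''.rotate hC'
    exact .app hD.symm h₁ (h₄ hD' hf)
  | pairL m E e ih =>
    intro g Γ T h
    obtain ⟨A, B, _, _, hs, h₁, h₂, hm, hm', hsub⟩ := h.pair_inv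
    obtain ⟨A₁, A₂, U, hs', h₃, h₄⟩ := ih h₁
    obtain ⟨C, hC, hC'⟩ := hs.rotate hs'
    refine ⟨C, A₂, U, hC, h₃, fun hs'' hf => ?_⟩
    obtain ⟨D, hD, hD'⟩ := hs''.rotate hC'
    exact .sub (.pair hD (h₄ hD' hf) h₂ hm hm') hsub
  | pairR m v hv E ih =>
    intro g Γ T h
    obtain ⟨A, B, _, _, hs, h₁, h₂, hm, hm', hsub⟩ := h.pair_inv
    obtain ⟨A₁, A₂, U, hs', h₃, h₄⟩ := ih h₂
    obtain ⟨C, hC, hC'⟩ := hs.symm.rotate hs'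
    refine ⟨C, A₂, U, hC, h₃, fun hs'' hf => ?_⟩
    obtain ⟨D, hD, hD'⟩ := hs''.rotate hC'
    exact .sub (.pair hD.symm h₁ (h₄ hD' hf) hm hm') hsub
  | letPair E e ih =>
    intro g Γ T h
    obtain ⟨A, B, _, _, _, hs, h₁, h₂⟩ := h.letPair_inv
    obtain ⟨A₁, A₂, U, hs', h₃, h₄⟩ := ih h₁
    obtain ⟨C, hC, hC'⟩ := hs.rotate hs'
    refine ⟨C, A₂, U, hC, h₃, fun hs'' hf => ?_⟩
    obtain ⟨D, hD, hD'⟩ := hs''.rotate hC'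
    exact .letPair hD (h₄ hD' hf) h₂
  | sendL E e ih =>
    intro g Γ T h
    obtain ⟨A, B, _, _, hs, h₁, h₂, hsub⟩ := h.send_inv
    obtain ⟨A₁, A₂, U, hs', h₃, h₄⟩ := ih h₁
    obtain ⟨C, hC, hC'⟩ := hs.rotate hs'
    refine ⟨C, A₂, U, hC, h₃, fun hs'' hf => ?_⟩
    obtain ⟨D, hD, hD'⟩ := hs''.rotate hC'
    exact .sub (.send hD (h₄ hD' hf) h₂) hsub
  | sendR v hv E ih =>
    intro g Γ T h
    obtain ⟨A, B, _, _, hs, h₁, h₂, hsub⟩ := h.send_inv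
    obtain ⟨A₁, A₂, U, hs', h₃, h₄⟩ := ih h₂
    obtain ⟨C, hC, hC'⟩ := hs.symm.rotate hs'
    refine ⟨C, A₂, U, hC, h₃, fun hs'' hf => ?_⟩
    obtain ⟨D, hD, hD'⟩ := hs''.rotate hC'
    exact .sub (.send hD.symm h₁ (h₄ hD' hf)) hsub
  | recv E ih =>
    intro g Γ T h
    obtain ⟨_, _, h₁, hsub⟩ := h.recv_inv
    obtain ⟨A₁, A₂, U, hs, h₂, h₃⟩ := ih h₁
    exact ⟨A₁, A₂, U, hs, h₂, fun hs' hf => .sub (.recv (h₃ hs' hf)) hsub⟩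
  | select l E ih =>
    intro g Γ T h
    obtain ⟨_, _, _, hl, h₁, hsub⟩ := h.select_inv
    obtain ⟨A₁, A₂, U, hs, h₂, h₃⟩ := ih h₁
    exact ⟨A₁, A₂, U, hs, h₂, fun hs' hf => .sub (.select ⟨l, hl⟩ (h₃ hs' hf)) hsub⟩
  | branch E I f ih =>
    intro g Γ T h
    obtain ⟨A, B, _, _, hs, h₁, h₂⟩ := h.branch_inv
    obtain ⟨A₁, A₂, U, hs', h₃, h₄⟩ := ih h₁
    obtain ⟨C, hC, hC'⟩ := hs.rotate hs'
    refine ⟨C, A₂, U, hC, h₃, fun hs'' hf => ?_⟩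
    obtain ⟨D, hD, hD'⟩ := hs''.rotate hC'
    exact .branch hD (h₄ hD' hf) h₂
  | close E ih =>
    intro g Γ T h
    obtain ⟨h₁, rfl⟩ := h.close_inv
    obtain ⟨A₁, A₂, U, hs, h₂, h₃⟩ := ih h₁
    exact ⟨A₁, A₂, U, hs, h₂, fun hs' hf => .close (h₃ hs' hf)⟩
  | wait E ih =>
    intro g Γ T h
    obtain ⟨h₁, rfl⟩ := h.wait_inv
    obtain ⟨A₁, A₂, U, hs, h₂, h₃⟩ := ih h₁
    exact ⟨A₁, A₂, U, hs, h₂, fun hs' hf => .wait (h₃ hs' hf)⟩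
  | cast E V p W ih =>
    intro g Γ T h
    obtain ⟨h₁, hc, hsub⟩ := h.cast_inv
    obtain ⟨A₁, A₂, U, hs, h₂, h₃⟩ := ih h₁
    exact ⟨A₁, A₂, U, hs, h₂, fun hs' hf => .sub (.cast (h₃ hs' hf) hc) hsub⟩

/-! ### Renaming of processes -/

theorem Ren.Covers.flv {r : Ren} {Δ : Env} (hc : r.Covers Δ) :
    Δ.flv = r.app '' (Δ.comap r).flv := by
  ext z
  constructor
  · rintro ⟨T, hz, hT⟩
    obtain ⟨z', rfl⟩ := hc z T hz hT
    exact ⟨z', ⟨T, hz, hT⟩, rfl⟩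
  · rintro ⟨z', ⟨T, hz, hT⟩, rfl⟩
    exact ⟨T, hz, hT⟩

theorem ProcTyped.rename {Γ : Env} {P : Proc} (h : ProcTyped Γ P) :
    ∀ {r : Ren} {Δ : Env}, r.Inj → r.Covers Δ → Δ.comap r = Γ → ProcTyped Δ (P.rename r) := by
  have blame : ∀ {r : Ren} {Δ : Env} {X : Finset Name}, r.Covers Δ →
      (Δ.comap r).flv = (X : Set Name) → Δ.flv = ((X.image r.app : Finset Name) : Set Name) := by
    intro r Δ X hc h
    rw [hc.flv, h, Finset.coe_image]
  induction h with
  | run h hT =>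
    intro r Δ hr hc hΔ
    exact .run (h.rename hr hc hΔ) hT
  | par hs _ _ ih₁ ih₂ =>
    rintro r Δ hr hc rfl
    obtain ⟨A, B, hs', rfl, rfl⟩ := hs.of_comap hr hc
    exact .par hs' (ih₁ hr (hc.left hs') rfl) (ih₂ hr (hc.right hs') rfl)
  | nuChan S _ ih =>
    rintro r Δ hr hc rfl
    exact .nuChan S (ih hr.upChan (Ren.covers_upChan.2 hc) (Env.comap_extChan _ _ _ _))
  | nuRef _ ih =>
    rintro r Δ hr hc rfl
    exact .nuRef (ih hr.upRef (Ren.covers_upRef.2 hc) (Env.comap_extRef _ _))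
  | store hs h₁ h₂ h₃ h₄ =>
    rintro r Δ hr hc rfl
    obtain ⟨A, B, hs', rfl, rfl⟩ := hs.of_comap hr hc
    exact .store hs' (h₁.rename hr (hc.left hs') rfl) (h₂.rename hr (hc.right hs') rfl)
      (h₃.rename r) h₄
  | locked h =>
    intro r Δ hr hc hΔ
    exact .locked (h.rename hr hc hΔ)
  | blame h =>
    rintro r Δ hr hc rfl
    exact .blame (blame hc h)
  | blameGC h =>
    rintro r Δ hr hc rfl
    exact .blameGC (blame hc h)

/-- Renaming leaves constructors and cast annotations alone. Strengthening needs this for stores,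
whose typing requires a value. -/
theorem Value.of_rename {v : Exp} : ∀ {r : Ren}, Value (v.rename r) → Value v := by
  induction v with
  | name z => intro r h; cases z <;> first | constructor | cases h
  | unit => intros; constructor
  | lam => intros; constructor
  | pair m v w ih₁ ih₂ =>
    intro r h
    cases h with
    | pair _ h₁ h₂ => exact .pair m (ih₁ h₁) (ih₂ h₂)
  | cast v T p U ih =>
    intro r h
    cases h with
    | castDyn _ _ h hG => exact .castDyn _ _ (ih h) hG
    | castDC _ _ h => exact .castDC _ _ (ih h)
    | castFn _ _ _ _ _ _ _ h => exact .castFn _ _ _ _ _ _ _ (ih h)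
    | castSess _ _ _ h hS hR => exact .castSess _ _ _ (ih h) hS hR
  | _ => intro r h; cases h

/-- As for expressions, coverage is forced. In a blame process the renamed set is an image and
equals the set of linear names, so it gives coverage directly. -/
theorem ProcTyped.of_rename {P : Proc} : ∀ {r : Ren} {Δ : Env}, r.Inj →
    ProcTyped Δ (P.rename r) → r.Covers Δ ∧ ProcTyped (Δ.comap r) P := by
  have blame : ∀ {r : Ren} {Δ : Env} {X : Finset Name}, r.Inj →
      Δ.flv = ((X.image r.app : Finset Name) : Set Name) →
      r.Covers Δ ∧ (Δ.comap r).flv = (X : Set Name) := by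
    intro r Δ X hr h
    rw [Finset.coe_image] at h
    have hc : r.Covers Δ := by
      intro z T hz hT
      have : z ∈ Δ.flv := ⟨T, hz, hT⟩
      rw [h] at this
      obtain ⟨z', _, hz'⟩ := this
      exact ⟨z', hz'⟩
    rw [hc.flv] at h
    exact ⟨hc, hr.image_injective h⟩
  induction P with
  | run e =>
    intro r Δ hr h
    cases h with
    | run h hT =>
      obtain ⟨hc, h⟩ := h.of_rename hr
      exact ⟨hc, .run h hT⟩
  | par P Q ih₁ ih₂ =>
    intro r Δ hr h
    cases h with
    | par hs h₁ h₂ =>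
      obtain ⟨hc₁, h₁⟩ := ih₁ hr h₁
      obtain ⟨hc₂, h₂⟩ := ih₂ hr h₂
      exact ⟨hs.covers hc₁ hc₂, .par (hs.comap r) h₁ h₂⟩
  | nuChan P ih =>
    intro r Δ hr h
    cases h with
    | nuChan S h =>
      obtain ⟨hc, h⟩ := ih hr.upChan h
      rw [Env.comap_extChan] at h
      exact ⟨Ren.covers_upChan.1 hc, .nuChan S h⟩
  | nuRef P ih =>
    intro r Δ hr h
    cases h with
    | nuRef h =>
      obtain ⟨hc, h⟩ := ih hr.upRef h
      rw [Env.comap_extRef] at h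
      exact ⟨Ren.covers_upRef.1 hc, .nuRef h⟩
  | store a w G p =>
    intro r Δ hr h
    cases h with
    | store hs h₁ h₂ h₃ h₄ =>
      obtain ⟨hc₁, h₁⟩ := HasType.of_rename (e := .name (.ref a)) hr h₁
      obtain ⟨hc₂, h₂⟩ := h₂.of_rename hr
      exact ⟨hs.covers hc₁ hc₂, .store (hs.comap r) h₁ h₂ h₃.of_rename h₄⟩
  | locked a p =>
    intro r Δ hr h
    cases h with
    | locked h =>
      obtain ⟨hc, h⟩ := HasType.of_rename (e := .name (.ref a)) hr h
      exact ⟨hc, .locked h⟩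
  | blame p q X =>
    intro r Δ hr h
    cases h with
    | blame h =>
      obtain ⟨hc, h⟩ := blame hr h
      exact ⟨hc, .blame h⟩
  | blameGC p X =>
    intro r Δ hr h
    cases h with
    | blameGC h =>
      obtain ⟨hc, h⟩ := blame hr h
      exact ⟨hc, .blameGC h⟩

theorem Proc.regularCasts_rename {P : Proc} :
    ∀ r : Ren, (P.rename r).RegularCasts ↔ P.RegularCasts := by
  induction P <;> intro r <;>
    simp only [Proc.rename, Proc.RegularCasts, Exp.regularCasts_rename, *]

/-! ### Environments under binders of endpoints and references -/

/-- Insert two optional entries for the channel endpoints with indices 0 and 1. -/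
def Env.insChan (Γ : Env) (o o' : Option Ty) : Env
  | .chan 0 => o
  | .chan 1 => o'
  | .chan (n + 2) => Γ (.chan n)
  | z => Γ z

theorem Env.extChan_eq (Γ : Env) (S R : STy) :
    Γ.extChan S R = Γ.insChan (some (.sess S)) (some (.sess R)) := by
  funext z
  match z with
  | .chan 0 => rfl
  | .chan 1 => rfl
  | .chan (n + 2) => rfl
  | .var n => rfl
  | .ref n => rfl

theorem Env.comap_insChan (Γ : Env) (o o' : Option Ty) :
    (Γ.insChan o o').comap Ren.shiftChan = Γ := by
  funext z
  cases z <;> rfl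

theorem Env.comap_extRef_shift (Γ : Env) : Γ.extRef.comap Ren.shiftRef = Γ := by
  funext z
  cases z <;> rfl

theorem Env.eq_insChan (Γ : Env) :
    Γ = (Γ.comap Ren.shiftChan).insChan (Γ (.chan 0)) (Γ (.chan 1)) := by
  funext z
  match z with
  | .chan 0 => rfl
  | .chan 1 => rfl
  | .chan (n + 2) => rfl
  | .var n => rfl
  | .ref n => rfl

theorem Split.insChan {Γ A B : Env} {o a b o' a' b' : Option Ty} (h : Split Γ A B)
    (h₀ : SplitAt o a b) (h₁ : SplitAt o' a' b') :
    Split (Γ.insChan o o') (A.insChan a a') (B.insChan b b') := by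
  intro z
  match z with
  | .chan 0 => exact h₀
  | .chan 1 => exact h₁
  | .chan (n + 2) => exact h (.chan n)
  | .var n => exact h (.var n)
  | .ref n => exact h (.ref n)

theorem Split.of_insChan {Γ A B : Env} {o o' : Option Ty} (h : Split (Γ.insChan o o') A B) :
    ∃ A' B' a b a' b', Split Γ A' B' ∧ SplitAt o a b ∧ SplitAt o' a' b' ∧
      A = A'.insChan a a' ∧ B = B'.insChan b b' := by
  refine ⟨A.comap Ren.shiftChan, B.comap Ren.shiftChan, _, _, _, _, ?_, h (.chan 0),
    h (.chan 1), A.eq_insChan, B.eq_insChan⟩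
  have := h.comap Ren.shiftChan
  rwa [Env.comap_insChan] at this

theorem SplitAt.of_none {a b : Option Ty} (h : SplitAt Option.none a b) : a = Option.none ∧ b = Option.none := by
  cases h; exact ⟨rfl, rfl⟩

theorem SplitAt.of_sess_left {o b : Option Ty} {S : STy} (h : SplitAt o (some (.sess S)) b) :
    o = some (.sess S) ∧ b = Option.none := by
  cases h with
  | un h => exact absurd (Ty.sess_lin S) h.not_lin
  | linL => exact ⟨rfl, rfl⟩

theorem SplitAt.of_sess_right {o a : Option Ty} {S : STy} (h : SplitAt o a (some (.sess S))) :
    o = some (.sess S) ∧ a = Option.none := h.symm.of_sess_left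

theorem SplitAt.sessL (S : STy) : SplitAt (some (.sess S)) (some (.sess S)) Option.none :=
  .linL (Ty.sess_lin S)

theorem SplitAt.sessR (S : STy) : SplitAt (some (.sess S)) Option.none (some (.sess S)) :=
  .linR (Ty.sess_lin S)

theorem Ren.covers_shiftChan {Γ : Env} : Ren.shiftChan.Covers (Γ.insChan none none) := by
  intro z T hz _
  match z with
  | .chan 0 => cases hz
  | .chan 1 => cases hz
  | .chan (n + 2) => exact ⟨.chan n, rfl⟩
  | .var n => exact ⟨.var n, rfl⟩
  | .ref n => exact ⟨.ref n, rfl⟩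

/-- A bound endpoint in this part would be a linear name outside the image of the shift. Hence a
process that does not mention the two endpoints holds neither of them. -/
theorem Ren.Covers.shiftChan_none {Γ : Env} {S R : STy} {a o a' o' : Option Ty}
    (h : Ren.shiftChan.Covers (Γ.insChan o o')) (h₀ : SplitAt (some (.sess S)) a o)
    (h₁ : SplitAt (some (.sess R)) a' o') : o = none ∧ o' = none := by
  constructor
  · rcases o with _ | T
    · rfl
    · obtain rfl : T = .sess S := by
        cases h₀ <;> rfl
      obtain ⟨z, hz⟩ := h (.chan 0) _ rfl (Ty.sess_lin S)
      cases z <;> simp [Ren.app, Ren.shiftChan] at hz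
  · rcases o' with _ | T
    · rfl
    · obtain rfl : T = .sess R := by
        cases h₁ <;> rfl
      obtain ⟨z, hz⟩ := h (.chan 1) _ rfl (Ty.sess_lin R)
      cases z <;> simp [Ren.app, Ren.shiftChan] at hz

theorem Ren.covers_shiftRef {Γ : Env} : Ren.shiftRef.Covers Γ.extRef := by
  intro z T hz hT
  match z with
  | .ref 0 => cases hz; cases hT
  | .ref (n + 1) => exact ⟨.ref n, rfl⟩
  | .chan n => exact ⟨.chan n, rfl⟩
  | .var n => exact ⟨.var n, rfl⟩

theorem Split.extRef {Γ A B : Env} (h : Split Γ A B) : Split Γ.extRef A.extRef B.extRef := by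
  intro z
  match z with
  | .ref 0 => exact .un rfl
  | .ref (n + 1) => exact h (.ref n)
  | .var n => exact h (.var n)
  | .chan n => exact h (.chan n)

/-- A reference has the dynamic type, which is unrestricted, so its entry is found on both sides. -/
theorem Split.of_extRef {Γ A B : Env} (h : Split Γ.extRef A B) :
    ∃ A' B', Split Γ A' B' ∧ A = A'.extRef ∧ B = B'.extRef := by
  have hs := h.comap Ren.shiftRef
  rw [Env.comap_extRef_shift] at hs
  have h₀ : SplitAt (some .dyn) (A (.ref 0)) (B (.ref 0)) := h (.ref 0)
  generalize hA : A (.ref 0) = a, hB : B (.ref 0) = b at h₀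
  obtain ⟨rfl, rfl⟩ : a = some .dyn ∧ b = some .dyn := by
    cases h₀ with
    | un => exact ⟨rfl, rfl⟩
    | linL h => cases h
    | linR h => cases h
  refine ⟨_, _, hs, ?_, ?_⟩ <;>
  · funext z
    match z with
    | .ref 0 => assumption
    | .ref (n + 1) => rfl
    | .var n => rfl
    | .chan n => rfl

/-! ### Structural congruence -/

theorem Ren.inj_of_involutive {r : Ren} (h : ∀ z, r.app (r.app z) = z) : r.Inj :=
  Function.LeftInverse.injective h

theorem Ren.covers_of_involutive {r : Ren} (h : ∀ z, r.app (r.app z) = z) (Δ : Env) :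
    r.Covers Δ := fun z _ _ _ => ⟨_, h z⟩

theorem Ren.swapEnds_involutive (z : Name) : Ren.swapEnds.app (Ren.swapEnds.app z) = z := by
  match z with
  | .chan 0 => rfl
  | .chan 1 => rfl
  | .chan (n + 2) => rfl
  | .var n => rfl
  | .ref n => rfl

theorem Ren.swapChans_involutive (z : Name) : Ren.swapChans.app (Ren.swapChans.app z) = z := by
  match z with
  | .chan 0 => rfl
  | .chan 1 => rfl
  | .chan 2 => rfl
  | .chan 3 => rfl
  | .chan (n + 4) => rfl
  | .var n => rfl
  | .ref n => rfl

theorem Ren.swapRefs_involutive (z : Name) : Ren.swapRefs.app (Ren.swapRefs.app z) = z := by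
  match z with
  | .ref 0 => rfl
  | .ref 1 => rfl
  | .ref (n + 2) => rfl
  | .var n => rfl
  | .chan n => rfl

/-- An involution is bijective, so coverage holds for every environment and both renaming lemmas
apply. -/
theorem ProcTyped.rename_iff {r : Ren} (h : ∀ z, r.app (r.app z) = z) {Δ : Env} {P : Proc} :
    ProcTyped Δ (P.rename r) ↔ ProcTyped (Δ.comap r) P :=
  ⟨fun hP => (hP.of_rename (Ren.inj_of_involutive h)).2,
    fun hP => hP.rename (Ren.inj_of_involutive h) (Ren.covers_of_involutive h Δ) rfl⟩

theorem Env.comap_swapEnds (Γ : Env) (S R : STy) :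
    (Γ.extChan S R).comap Ren.swapEnds = Γ.extChan R S := by
  funext z
  match z with
  | .chan 0 => rfl
  | .chan 1 => rfl
  | .chan (n + 2) => rfl
  | .var n => rfl
  | .ref n => rfl

theorem Env.comap_swapChans (Γ : Env) (S R S' R' : STy) :
    ((Γ.extChan S R).extChan S' R').comap Ren.swapChans = (Γ.extChan S' R').extChan S R := by
  funext z
  match z with
  | .chan 0 => rfl
  | .chan 1 => rfl
  | .chan 2 => rfl
  | .chan 3 => rfl
  | .chan (n + 4) => rfl
  | .var n => rfl
  | .ref n => rfl

theorem Env.comap_swapRefs (Γ : Env) :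
    Γ.extRef.extRef.comap Ren.swapRefs = Γ.extRef.extRef := by
  funext z
  match z with
  | .ref 0 => rfl
  | .ref 1 => rfl
  | .ref (n + 2) => rfl
  | .var n => rfl
  | .chan n => rfl

theorem Env.extChan_extRef (Γ : Env) (S R : STy) :
    (Γ.extChan S R).extRef = Γ.extRef.extChan S R := by
  funext z
  match z with
  | .ref 0 => rfl
  | .ref (n + 1) => rfl
  | .chan 0 => rfl
  | .chan 1 => rfl
  | .chan (n + 2) => rfl
  | .var n => rfl

theorem ProcTyped.nuChan_iff {Γ : Env} {P : Proc} :
    ProcTyped Γ (.nuChan P) ↔ ∃ S : STy, ProcTyped (Γ.extChan S S.dual) P := by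
  constructor
  · intro h
    cases h with
    | nuChan S h => exact ⟨S, h⟩
  · rintro ⟨S, h⟩
    exact .nuChan S h

theorem ProcTyped.nuRef_iff {Γ : Env} {P : Proc} :
    ProcTyped Γ (.nuRef P) ↔ ProcTyped Γ.extRef P := by
  constructor
  · intro h
    cases h with
    | nuRef h => exact h
  · exact .nuRef

theorem ProcTyped.par_iff {Γ : Env} {P Q : Proc} :
    ProcTyped Γ (.par P Q) ↔ ∃ Γ₁ Γ₂, Split Γ Γ₁ Γ₂ ∧ ProcTyped Γ₁ P ∧ ProcTyped Γ₂ Q := by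
  constructor
  · intro h
    cases h with
    | par hs h₁ h₂ => exact ⟨_, _, hs, h₁, h₂⟩
  · rintro ⟨_, _, hs, h₁, h₂⟩
    exact .par hs h₁ h₂

theorem ProcTyped.swapEnds {Γ : Env} {P : Proc} (h : ProcTyped Γ (.nuChan P)) :
    ProcTyped Γ (.nuChan (P.rename Ren.swapEnds)) := by
  obtain ⟨S, h⟩ := ProcTyped.nuChan_iff.1 h
  refine .nuChan S.dual ?_
  rwa [ProcTyped.rename_iff Ren.swapEnds_involutive, Env.comap_swapEnds, STy.dual_dual]

/-- The equivalence, for all environments at once, makes symmetry and the closure under contexts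
immediate. What remains is regrouping of environments and, for extrusion, weakening in one direction
and strengthening in the other. -/
theorem Cong.procTyped {P Q : Proc} (h : Cong P Q) :
    ∀ Γ, ProcTyped Γ P ↔ ProcTyped Γ Q := by
  induction h with
  | refl P => exact fun _ => Iff.rfl
  | symm _ ih => exact fun Γ => (ih Γ).symm
  | trans _ _ ih₁ ih₂ => exact fun Γ => (ih₁ Γ).trans (ih₂ Γ)
  | congPar _ _ ih₁ ih₂ => intro Γ; simp only [ProcTyped.par_iff, ih₁, ih₂]
  | congNuChan _ ih => intro Γ; simp only [ProcTyped.nuChan_iff, ih]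
  | congNuRef _ ih => intro Γ; simp only [ProcTyped.nuRef_iff, ih]
  | parComm P Q =>
    intro Γ
    simp only [ProcTyped.par_iff]
    constructor <;>
    · rintro ⟨A, B, hs, h₁, h₂⟩
      exact ⟨B, A, hs.symm, h₂, h₁⟩
  | parAssoc P Q R =>
    intro Γ
    simp only [ProcTyped.par_iff]
    constructor
    · rintro ⟨A, B, hs, h₁, B₁, B₂, hs', h₂, h₃⟩
      obtain ⟨C, hC, hC'⟩ := hs.symm.rotate hs'
      exact ⟨C, B₂, hC, ⟨A, B₁, hC'.symm, h₁, h₂⟩, h₃⟩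
    · rintro ⟨A, B, hs, ⟨A₁, A₂, hs', h₁, h₂⟩, h₃⟩
      obtain ⟨C, hC, hC'⟩ := hs.assoc hs'
      exact ⟨A₁, C, hC, h₁, A₂, B, hC', h₂, h₃⟩
  | parUnit P =>
    intro Γ
    rw [ProcTyped.par_iff]
    constructor
    · rintro ⟨A, B, hs, h₁, h₂⟩
      cases h₂ with
      | run h _ => rwa [← hs.eq_left h.unit_inv.1]
    · intro h
      obtain ⟨Z, hZ, hun⟩ := Γ.exists_split_un
      exact ⟨Γ, Z, hZ, h, .run (.unit hun) rfl⟩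
  | swapEnds P =>
    intro Γ
    refine ⟨ProcTyped.swapEnds, fun h => ?_⟩
    obtain ⟨S, h⟩ := ProcTyped.nuChan_iff.1 h
    rw [ProcTyped.rename_iff Ren.swapEnds_involutive, Env.comap_swapEnds] at h
    refine .nuChan S.dual ?_
    rwa [STy.dual_dual]
  | extrudeChan P Q =>
    intro Γ
    simp only [ProcTyped.par_iff, ProcTyped.nuChan_iff]
    constructor
    · rintro ⟨A, B, hs, ⟨S, h₁⟩, h₂⟩
      refine ⟨S, _, B.insChan none none, ?_, h₁,
        h₂.rename Ren.shiftChan_inj Ren.covers_shiftChan (Env.comap_insChan _ _ _)⟩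
      rw [Env.extChan_eq, Env.extChan_eq]
      exact hs.insChan (.sessL _) (.sessL _)
    · rintro ⟨S, A, B, hs, h₁, h₂⟩
      rw [Env.extChan_eq] at hs
      obtain ⟨A', B', a, b, a', b', hs', h₀, h₀', rfl, rfl⟩ := hs.of_insChan
      obtain ⟨hc, h₂⟩ := h₂.of_rename Ren.shiftChan_inj
      -- Strengthening shows that `Q` owns neither endpoint, so both entries belong to `P` and the
      -- restriction can be narrowed to it.
      obtain ⟨rfl, rfl⟩ := hc.shiftChan_none h₀ h₀'
      rw [Env.comap_insChan] at h₂
      refine ⟨A', B', hs', ⟨S, ?_⟩, h₂⟩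
      rw [Env.extChan_eq]
      cases h₀
      cases h₀'
      exact h₁
  | swapChans P =>
    intro Γ
    simp only [ProcTyped.nuChan_iff, ProcTyped.rename_iff Ren.swapChans_involutive,
      Env.comap_swapChans]
    -- The session types of the two restrictions are independent witnesses and trade places.
    exact exists_comm
  | extrudeRef P Q =>
    intro Γ
    simp only [ProcTyped.par_iff, ProcTyped.nuRef_iff]
    constructor
    · rintro ⟨A, B, hs, h₁, h₂⟩
      exact ⟨_, _, hs.extRef, h₁,
        h₂.rename Ren.shiftRef_inj Ren.covers_shiftRef (Env.comap_extRef_shift _)⟩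
    · rintro ⟨A, B, hs, h₁, h₂⟩
      obtain ⟨A', B', hs', rfl, rfl⟩ := hs.of_extRef
      obtain ⟨_, h₂⟩ := h₂.of_rename Ren.shiftRef_inj
      rw [Env.comap_extRef_shift] at h₂
      exact ⟨A', B', hs', h₁, h₂⟩
  | swapRefs P =>
    intro Γ
    simp only [ProcTyped.nuRef_iff, ProcTyped.rename_iff Ren.swapRefs_involutive,
      Env.comap_swapRefs]
  | swapChanRef P =>
    intro Γ
    simp only [ProcTyped.nuRef_iff, ProcTyped.nuChan_iff, Env.extChan_extRef]

theorem Cong.regularCasts {P Q : Proc} (h : Cong P Q) : P.RegularCasts ↔ Q.RegularCasts := by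
  induction h with
  | refl P => exact Iff.rfl
  | symm _ ih => exact ih.symm
  | trans _ _ ih₁ ih₂ => exact ih₁.trans ih₂
  | congPar _ _ ih₁ ih₂ => exact and_congr ih₁ ih₂
  | congNuChan _ ih => exact ih
  | congNuRef _ ih => exact ih
  | parComm P Q => exact and_comm
  | parAssoc P Q R => exact and_assoc.symm
  | parUnit P => exact and_iff_left trivial
  | _ => simp only [Proc.RegularCasts, Proc.regularCasts_rename]

/-! ### Preservation for processes -/

theorem HasType.chan_inv {Γ : Env} {n : ℕ} {S : STy}
    (h : HasType Γ (.name (.chan n)) (.sess S)) :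
    ∃ R, Γ (.chan n) = some (.sess R) ∧ Sub (.sess R) (.sess S) := by
  obtain ⟨T, h₁, _, h₂⟩ := h.name_inv
  obtain ⟨R, rfl⟩ := h₂.sess_right
  exact ⟨R, h₁, h₂⟩

theorem HasType.endC_inv {Γ : Env} {o o' : Option Ty} {S : STy}
    (h : HasType (Γ.insChan o o') endC (.sess S)) :
    ∃ R, o = some (.sess R) ∧ Sub (.sess R) (.sess S) ∧ Γ.Un := by
  obtain ⟨R, h₁, h₂⟩ := h.chan_inv
  obtain ⟨_, _, h₃, _⟩ := h.name_inv
  refine ⟨R, h₁, h₂, fun z T hz => h₃ (Ren.shiftChan.app z) T ?_ ?_⟩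
  · cases z <;> simp [Ren.app, Ren.shiftChan]
  · cases z <;> exact hz

theorem HasType.endD_inv {Γ : Env} {o o' : Option Ty} {S : STy}
    (h : HasType (Γ.insChan o o') endD (.sess S)) :
    ∃ R, o' = some (.sess R) ∧ Sub (.sess R) (.sess S) ∧ Γ.Un := by
  obtain ⟨R, h₁, h₂⟩ := h.chan_inv
  obtain ⟨_, _, h₃, _⟩ := h.name_inv
  refine ⟨R, h₁, h₂, fun z T hz => h₃ (Ren.shiftChan.app z) T ?_ ?_⟩
  · cases z <;> simp [Ren.app, Ren.shiftChan]
  · cases z <;> exact hz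

theorem HasType.endC {Γ : Env} (h : Γ.Un) (S : STy) :
    HasType (Γ.insChan (some (.sess S)) none) endC (.sess S) := by
  refine .name rfl fun z T hne hz => ?_
  match z with
  | .chan 0 => exact absurd rfl hne
  | .chan 1 => cases hz
  | .chan (n + 2) => exact h (.chan n) T hz
  | .var n => exact h (.var n) T hz
  | .ref n => exact h (.ref n) T hz

theorem HasType.endD {Γ : Env} (h : Γ.Un) (S : STy) :
    HasType (Γ.insChan none (some (.sess S))) endD (.sess S) := by
  refine .name rfl fun z T hne hz => ?_
  match z with
  | .chan 0 => cases hz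
  | .chan 1 => exact absurd rfl hne
  | .chan (n + 2) => exact h (.chan n) T hz
  | .var n => exact h (.var n) T hz
  | .ref n => exact h (.ref n) T hz

/-- Inversion of typing for two threads which communicate over the endpoints of a restriction. -/
theorem ProcTyped.threads_inv {Γ : Env} {E F : ECtx} {g k : Exp}
    (h : ProcTyped Γ (.nuChan (.par (.run (E.fill g)) (.run (F.fill k)))))
    (hg : ∀ {Δ U}, HasType Δ g U → ∃ S, Δ (.chan 0) = some (.sess S))
    (hk : ∀ {Δ U}, HasType Δ k U → ∃ S, Δ (.chan 1) = some (.sess S)) :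
    ∃ S A A₁ A₂ B B₁ B₂ T U T' U', Split Γ A B ∧ Split A A₁ A₂ ∧ Split B B₁ B₂ ∧ Ty.Un T ∧
      Ty.Un T' ∧ HasType (A₂.insChan (some (.sess S)) none) g U ∧
      HasType (B₂.insChan none (some (.sess S.dual))) k U' ∧
      (∀ {Γ' Γ₂' : Env} {f : Exp}, Split Γ' (A₁.insChan none none) Γ₂' → HasType Γ₂' f U →
        HasType Γ' (E.fill f) T) ∧
      (∀ {Γ' Γ₂' : Env} {f : Exp}, Split Γ' (B₁.insChan none none) Γ₂' → HasType Γ₂' f U' →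
        HasType Γ' (F.fill f) T') := by
  obtain ⟨S, h⟩ := ProcTyped.nuChan_iff.1 h
  rw [Env.extChan_eq] at h
  obtain ⟨A, B, hs, hA, hB⟩ := ProcTyped.par_iff.1 h
  cases hA with | run hA hT =>
  cases hB with | run hB hT' =>
  obtain ⟨A, B, x, y, x', y', hAB, hx, hx', rfl, rfl⟩ := hs.of_insChan
  obtain ⟨A₁, A₂, U, hsA, hgU, hE⟩ := ECtx.hasType_fill hA
  obtain ⟨B₁, B₂, U', hsB, hkU, hF⟩ := ECtx.hasType_fill hB
  obtain ⟨A₁, A₂, x₁, x₂, x₁', x₂', hA', hxA, hxA', rfl, rfl⟩ := hsA.of_insChan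
  obtain ⟨B₁, B₂, y₁, y₂, y₁', y₂', hB', hyB, hyB', rfl, rfl⟩ := hsB.of_insChan
  -- The two redexes use the two endpoints, so these entries lie in the parts of the two holes.
  -- Linearity then empties the corresponding slots everywhere else and fixes their types as `S` and
  -- its dual.
  obtain ⟨_, rfl : x₂ = _⟩ := hg hgU
  obtain ⟨_, rfl : y₂' = _⟩ := hk hkU
  obtain ⟨rfl, rfl⟩ := hxA.of_sess_right
  obtain ⟨rfl, rfl⟩ := hyB'.of_sess_right
  obtain ⟨heq, rfl⟩ := hx.of_sess_left
  cases heq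
  obtain ⟨heq, rfl⟩ := hx'.of_sess_right
  cases heq
  obtain ⟨rfl, rfl⟩ := hxA'.of_none
  obtain ⟨rfl, rfl⟩ := hyB.of_none
  exact ⟨S, A, A₁, A₂, B, B₁, B₂, _, _, _, _, hAB, hA', hB', hT, hT', hgU, hkU, hE, hF⟩

/-- The converse of `ProcTyped.threads_inv`, with new contents of the two contexts. -/
theorem ProcTyped.threads {Γ A A₁ A₂ B B₁ B₂ : Env} {E F : ECtx} {g k : Exp} {S : STy}
    {T U T' U' : Ty} (hAB : Split Γ A B) (hA : Split A A₁ A₂) (hB : Split B B₁ B₂)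
    (hT : Ty.Un T) (hT' : Ty.Un T')
    (hE : ∀ {Γ' Γ₂' : Env} {f : Exp}, Split Γ' (A₁.insChan none none) Γ₂' → HasType Γ₂' f U →
      HasType Γ' (E.fill f) T)
    (hF : ∀ {Γ' Γ₂' : Env} {f : Exp}, Split Γ' (B₁.insChan none none) Γ₂' → HasType Γ₂' f U' →
      HasType Γ' (F.fill f) T')
    (hg : HasType (A₂.insChan (some (.sess S)) none) g U)
    (hk : HasType (B₂.insChan none (some (.sess S.dual))) k U') :
    ProcTyped Γ (.nuChan (.par (.run (E.fill g)) (.run (F.fill k)))) := by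
  refine .nuChan S ?_
  rw [Env.extChan_eq]
  exact .par (hAB.insChan (.sessL S) (.sessR _))
    (.run (hE (hA.insChan (.sessR S) .none) hg) hT) (.run (hF (hB.insChan .none (.sessR _)) hk) hT')

-- Synchronization on a restricted pair of endpoints

theorem ProcTyped.comm {Γ : Env} {E F : ECtx} {v : Exp}
    (h : ProcTyped Γ
      (.nuChan (.par (.run (E.fill (.send v endC))) (.run (F.fill (.recv endD)))))) :
    ProcTyped Γ
      (.nuChan (.par (.run (E.fill endC)) (.run (F.fill (.pair .lin v endD))))) := by
  obtain ⟨S, A, A₁, A₂, B, B₁, B₂, T, U, T', U', hAB, hA, hB, hT, hT', hg, hk, hE, hF⟩ :=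
    h.threads_inv
      (fun h => by
        obtain ⟨_, _, _, _, hs, _, h, _⟩ := h.send_inv
        obtain ⟨S, h, _⟩ := h.chan_inv
        exact ⟨S, hs.some_right h⟩)
      (fun h => by
        obtain ⟨_, _, h, _⟩ := h.recv_inv
        obtain ⟨S, h, _⟩ := h.chan_inv
        exact ⟨S, h⟩)
  obtain ⟨_, _, V, R, hs, hv, hc, hR⟩ := hg.send_inv
  obtain ⟨V', R', hd, hR'⟩ := hk.recv_inv
  obtain ⟨A₃, A₄, x, y, x', y', hA₂, hx, hx', rfl, rfl⟩ := hs.of_insChan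
  obtain ⟨_, rfl, hsub, hun⟩ := hc.endC_inv
  obtain ⟨_, heq, hsub', hun'⟩ := hd.endD_inv
  cases heq
  obtain ⟨heq, rfl⟩ := hx.of_sess_right
  cases heq
  obtain ⟨rfl, rfl⟩ := hx'.of_none
  -- The sender's inversion shows that the session type is an output. Its message type lies above
  -- the type of the sent value and, by duality, below the type the receiver expects. Its residual
  -- types the new restriction.
  cases hsub with | send hV hS =>
  cases hsub' with | recv hV' hS' =>
  -- The environment `A₃` of the message is taken from the sending thread, leaving `D`, and is then
  -- added to the hole of the receiver, giving `X`.
  obtain ⟨D, hD, hD'⟩ := hA.symm.rotate hA₂.symm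
  obtain ⟨C, hC, hC'⟩ := hAB.assoc hD
  obtain ⟨X, hX, hX'⟩ := hC'.symm.assoc hB
  refine .threads hC hD'.symm hX hT hT' hE hF (((HasType.endC hun _).sub hS).sub hR)
    (.sub (.pair (hX'.symm.insChan .none (.sessR _)) hv (HasType.endD hun' _) ?_ ?_) ?_)
  · exact Ty.below_lin _
  · exact Ty.below_lin _
  · exact (Sub.prod (hV.trans hV') hS' (.refl _)).trans hR'

theorem ProcTyped.choose {Γ : Env} {E F : ECtx} {I : Finset Label} {f : {l // l ∈ I} → Exp}
    (j : {l // l ∈ I})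
    (h : ProcTyped Γ
      (.nuChan (.par (.run (E.fill (.select j endC))) (.run (F.fill (.branch endD I f)))))) :
    ProcTyped Γ
      (.nuChan (.par (.run (E.fill endC)) (.run (F.fill ((f j).subst1 endD))))) := by
  obtain ⟨S, A, A₁, A₂, B, B₁, B₂, T, U, T', U', hAB, hA, hB, hT, hT', hg, hk, hE, hF⟩ :=
    h.threads_inv
      (fun h => by
        obtain ⟨_, _, _, _, h, _⟩ := h.select_inv
        obtain ⟨S, h, _⟩ := h.chan_inv
        exact ⟨S, h⟩)
      (fun h => by
        obtain ⟨_, _, _, _, hs, h, _⟩ := h.branch_inv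
        obtain ⟨S, h, _⟩ := h.chan_inv
        exact ⟨S, hs.some_left h⟩)
  obtain ⟨K, hK, R, hj, hc, hR⟩ := hg.select_inv
  obtain ⟨_, _, hI, R', hs, hd, hf⟩ := hk.branch_inv
  obtain ⟨B₃, B₄, x, y, x', y', hB₂, hx, hx', rfl, rfl⟩ := hs.of_insChan
  obtain ⟨_, heq, hsub, hun⟩ := hc.endC_inv
  cases heq
  obtain ⟨_, rfl, hsub', hun'⟩ := hd.endD_inv
  obtain ⟨heq, rfl⟩ := hx'.of_sess_left
  cases heq
  obtain ⟨rfl, rfl⟩ := hx.of_none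
  cases hsub with | select hKI hS =>
  cases hsub' with | choice hIJ hS' =>
  -- The label lies in the set `K` expected by the selection, hence in the larger label set of the
  -- session type, hence among the branches. The residual at this label is the new session type.
  refine .threads hAB hA hB hT hT' hE hF (((HasType.endC hun _).sub (hS ⟨j, hj⟩)).sub hR) ?_
  exact (hf j).subst1 (hB₂.symm.insChan .none (.sessR _))
    ((HasType.endD hun' _).sub (hS' ⟨j, hKI hj⟩)) (.chan 1)

theorem ProcTyped.close {Γ : Env} {E F : ECtx}
    (h : ProcTyped Γ
      (.nuChan (.par (.run ((E.rename Ren.shiftChan).fill (.close endC)))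
        (.run ((F.rename Ren.shiftChan).fill (.wait endD)))))) :
    ProcTyped Γ (.par (.run (E.fill .unit)) (.run (F.fill .unit))) := by
  obtain ⟨S, A, A₁, A₂, B, B₁, B₂, T, U, T', U', hAB, hA, hB, hT, hT', hg, hk, hE, hF⟩ :=
    h.threads_inv
      (fun h => by
        obtain ⟨S, h, _⟩ := h.close_inv.1.chan_inv
        exact ⟨S, h⟩)
      (fun h => by
        obtain ⟨S, h, _⟩ := h.wait_inv.1.chan_inv
        exact ⟨S, h⟩)
  obtain ⟨hc, rfl⟩ := hg.close_inv
  obtain ⟨hd, rfl⟩ := hk.wait_inv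
  obtain ⟨_, _, _, hun⟩ := hc.endC_inv
  obtain ⟨_, _, _, hun'⟩ := hd.endD_inv
  have unit : ∀ {Γ : Env}, Γ.Un → HasType (Γ.insChan none none) .unit .unit := by
    intro Γ h
    exact .unit (Env.Un.of_comap Ren.covers_shiftChan (by rwa [Env.comap_insChan]))
  -- After closing, both endpoint slots are empty and the contexts do not mention the endpoints, so
  -- the renaming can be undone.
  have strengthen : ∀ {E : ECtx} {Γ : Env} {T : Ty},
      HasType (Γ.insChan none none) ((E.rename Ren.shiftChan).fill .unit) T →
      HasType Γ (E.fill .unit) T := by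
    intro E Γ T h
    have h' : HasType (Γ.insChan none none) ((E.fill .unit).rename Ren.shiftChan) T := by
      rwa [ECtx.fill_rename]
    have := (h'.of_rename Ren.shiftChan_inj).2
    rwa [Env.comap_insChan] at this
  exact .par hAB (.run (strengthen (hE (hA.insChan .none .none) (unit hun))) hT)
    (.run (strengthen (hF (hB.insChan .none .none) (unit hun'))) hT')

/-- The restriction changes its protocol: the dynamic session type is given up for `S`, the target
of the first cast. The second thread obtains `R` from the dual of `S` by subsumption. -/
theorem ProcTyped.collapseChan {Γ : Env} {E F : ECtx} {S R : STy} {p q : BLabel}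
    (hSR : Sub (.sess S.dual) (.sess R))
    (h : ProcTyped Γ
      (.nuChan (.par (.run (E.fill (.cast endC (.sess .dc) p (.sess S))))
        (.run (F.fill (.cast endD (.sess .dc) q (.sess R))))))) :
    ProcTyped Γ (.nuChan (.par (.run (E.fill endC)) (.run (F.fill endD)))) := by
  obtain ⟨_, A, A₁, A₂, B, B₁, B₂, T, U, T', U', hAB, hA, hB, hT, hT', hg, hk, hE, hF⟩ :=
    h.threads_inv
      (fun h => by
        obtain ⟨S, h, _⟩ := h.cast_inv.1.chan_inv
        exact ⟨S, h⟩)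
      (fun h => by
        obtain ⟨S, h, _⟩ := h.cast_inv.1.chan_inv
        exact ⟨S, h⟩)
  obtain ⟨hc, _, hU⟩ := hg.cast_inv
  obtain ⟨hd, _, hU'⟩ := hk.cast_inv
  obtain ⟨_, _, _, hun⟩ := hc.endC_inv
  obtain ⟨_, _, _, hun'⟩ := hd.endD_inv
  exact .threads hAB hA hB hT hT' hE hF ((HasType.endC hun S).sub hU)
    (((HasType.endD hun' _).sub hSR).sub hU')

-- Creation of threads and channels

theorem ProcTyped.fork {Γ : Env} {E : ECtx} {e : Exp}
    (h : ProcTyped Γ (.run (E.fill (.fork e)))) :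
    ProcTyped Γ (.par (.run (E.fill .unit)) (.run e)) := by
  cases h with | run h hT =>
  obtain ⟨A, B, U, hs, he, hE⟩ := ECtx.hasType_fill h
  obtain ⟨he', rfl⟩ := he.fork_inv
  obtain ⟨Z, hZ, hun⟩ := A.exists_split_un
  exact .par hs (.run (hE hZ (.unit hun)) hT) (.run he' rfl)

/-- The thread is weakened to an environment with empty endpoint slots. Refilling the hole with the
pair then uses a larger part, in which the slots are filled. -/
theorem ProcTyped.new {Γ : Env} {E : ECtx} (h : ProcTyped Γ (.run (E.fill .new))) :
    ProcTyped Γ (.nuChan (.run ((E.rename Ren.shiftChan).fill (.pair .lin endC endD)))) := by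
  cases h with | run h hT =>
  have h := h.rename Ren.shiftChan_inj Ren.covers_shiftChan (Env.comap_insChan Γ none none)
  rw [ECtx.fill_rename] at h
  obtain ⟨A, B, U, hs, he, hE⟩ := ECtx.hasType_fill h
  obtain ⟨S, hun, hU⟩ := HasType.new_inv he
  obtain ⟨A, B, x, y, x', y', hAB, hx, hx', rfl, rfl⟩ := hs.of_insChan
  obtain ⟨rfl, rfl⟩ := hx.of_none
  obtain ⟨rfl, rfl⟩ := hx'.of_none
  have hBun : B.Un := by
    have := hun.comap (r := Ren.shiftChan)
    rwa [Env.comap_insChan] at this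
  refine .nuChan S (.run (hE (Γ₂' := B.insChan (some (.sess S)) (some (.sess S.dual))) ?_
    (.sub (.pair ?_ (HasType.endC hBun S) (HasType.endD hBun S.dual) ?_ ?_) hU)) hT)
  · rw [Env.extChan_eq]
    exact hAB.insChan (.sessR _) (.sessR _)
  -- The part used by `new` is unrestricted, so both components of the pair can have all of it.
  · exact hBun.split.insChan (.sessL _) (.sessR _)
  · exact Ty.below_lin _
  · exact Ty.below_lin _

-- References to linear values

theorem HasType.ref_inv {Γ : Env} {a : ℕ} (h : HasType Γ (.name (.ref a)) .dyn) :
    Γ (.ref a) = some .dyn ∧ Γ.Un := by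
  obtain ⟨T, h₁, _, h₃⟩ := h.name_inv
  cases h₃
  exact ⟨h₁, Value.env_un (.ref a) h rfl⟩

theorem HasType.ref {Γ : Env} {a : ℕ} (hΓ : Γ (.ref a) = some .dyn) (hun : Γ.Un) :
    HasType Γ (.name (.ref a)) .dyn := .name hΓ fun z T _ hz => hun z T hz

theorem Split.some_both {Γ A B : Env} (h : Split Γ A B) {z : Name} {T : Ty}
    (hz : Γ z = some T) (hT : T.Un) : A z = some T ∧ B z = some T := by
  have h := h z
  rw [hz] at h
  revert h
  generalize A z = a, B z = b
  intro h
  cases h with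
  | un => exact ⟨rfl, rfl⟩
  | linL h => exact absurd h hT.not_lin
  | linR h => exact absurd h hT.not_lin

theorem Sub.eq_dyn {T : Ty} (h : Sub .dyn T) : T = .dyn := by
  cases h; rfl

/-- The linear names of `v` move from the thread to the store. The reference left in the hole is
unrestricted and therefore available on both sides. -/
theorem ProcTyped.alloc {Γ : Env} {E : ECtx} {v : Exp} {G : Ground} {p : BLabel} (hv : Value v)
    (hG : G.ty.Lin) (h : ProcTyped Γ (.run (E.fill (.cast v G.ty p .dyn)))) :
    ProcTyped Γ (.nuRef (.par (.run ((E.rename Ren.shiftRef).fill (.name (.ref 0))))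
      (.store 0 (v.rename Ren.shiftRef) G p))) := by
  cases h with | run h hT =>
  have h := h.rename Ren.shiftRef_inj Ren.covers_shiftRef (Env.comap_extRef_shift Γ)
  rw [ECtx.fill_rename] at h
  obtain ⟨A, B, U, hs, he, hE⟩ := ECtx.hasType_fill h
  obtain ⟨hw, _, hU⟩ := HasType.cast_inv he
  obtain rfl := hU.eq_dyn
  obtain ⟨hA, hB⟩ := hs.some_both (z := .ref 0) rfl rfl
  obtain ⟨Y, hY, hYun⟩ := A.exists_split_un
  obtain ⟨Z, hZ, hZun⟩ := B.exists_split_un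
  exact .nuRef (.par hs
    (.run (hE hY (.ref (hY.some_both hA rfl).2 hYun)) hT)
    (.store hZ.symm (.ref (hZ.some_both hB rfl).2 hZun) hw (hv.rename _) hG))

theorem ProcTyped.access {Γ : Env} {E : ECtx} {a : ℕ} {v : Exp} {G H : Ground} {p q : BLabel}
    (h : ProcTyped Γ
      (.par (.run (E.fill (.cast (.name (.ref a)) .dyn q H.ty))) (.store a v G p))) :
    ProcTyped Γ
      (.par (.run (E.fill (.cast (.cast v G.ty p .dyn) .dyn q H.ty))) (.locked a p)) := by
  obtain ⟨A, B, hs, hA, hB⟩ := ProcTyped.par_iff.1 h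
  cases hA with | run hA hT =>
  cases hB with | store hsB ha hv _ _ =>
  obtain ⟨A₁, A₂, U, hsA, he, hE⟩ := ECtx.hasType_fill hA
  obtain ⟨ha', _, hU⟩ := he.cast_inv
  -- The reference uses no linear name in the thread or in the store. The context thus owns all of
  -- the thread's part and the value all of the store's part, and the original splitting also types
  -- the thread after the access.
  obtain rfl := hsA.eq_left ha'.ref_inv.2
  obtain rfl := hsB.eq_right ha.ref_inv.2
  obtain ⟨Z, hZ, hZun⟩ := Γ.exists_split_un
  have hΓa : Γ (.ref a) = some .dyn := hs.some_left (hsA.some_right ha'.ref_inv.1)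
  exact .par hZ (.run (hE hs (.sub (.cast (.cast hv (.dyn_right _)) (.dyn_left _)) hU)) hT)
    (.locked (.ref (hZ.some_both hΓa rfl).2 hZun))

-- Blame and collapsing casts

theorem HasType.flv_fill {Γ : Env} {E : ECtx} {e : Exp} {T : Ty} (h : HasType Γ (E.fill e) T)
    (hΓ : Γ.Running) : Γ.flv = ((E.flv ∪ e.flv : Finset Name) : Set Name) := by
  rw [h.flv_eq hΓ, ECtx.fill_flv]

theorem ProcTyped.accessLocked {Γ : Env} {E : ECtx} {a : ℕ} {H : Ground} {p p' q : BLabel}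
    (hΓ : Γ.Running)
    (h : ProcTyped Γ
      (.par (.run (E.fill (.cast (.name (.ref a)) .dyn q H.ty))) (.locked a p))) :
    ProcTyped Γ (.par (.blame p' q E.flv) (.locked a p)) := by
  obtain ⟨A, B, hs, hA, hB⟩ := ProcTyped.par_iff.1 h
  cases hA with | run hA hT =>
  refine .par hs (.blame ?_) hB
  rw [hA.flv_fill (hΓ.left hs)]
  simp [Exp.flv]

theorem Env.flv_extRef (Γ : Env) (hΓ : Γ.Running) : Γ.extRef.flv = Γ.flv := by
  ext z
  match z with
  | .var n => exact Iff.rfl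
  | .chan n => exact Iff.rfl
  | .ref n =>
    constructor
    · rintro ⟨T, hz, hT⟩
      exact ((hΓ.extRef _ T hz).1 hT).elim
    · rintro ⟨T, hz, hT⟩
      exact ((hΓ _ T hz).1 hT).elim

/-- The reference owns no linear name and adds none to the environment, so the stored value accounts
for all of them. -/
theorem ProcTyped.gcStore {Γ : Env} {w : Exp} {G : Ground} {p p' : BLabel} (hΓ : Γ.Running)
    (h : ProcTyped Γ (.nuRef (.store 0 w G p))) : ProcTyped Γ (.blameGC p' w.flv) := by
  cases ProcTyped.nuRef_iff.1 h with | store hs ha hw _ _ =>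
  obtain rfl := hs.eq_right ha.ref_inv.2
  refine .blameGC ?_
  rw [← hw.flv_eq hΓ.extRef, Γ.flv_extRef hΓ]

theorem ProcTyped.gcLocked {Γ : Env} {p : BLabel} (h : ProcTyped Γ (.nuRef (.locked 0 p))) :
    ProcTyped Γ (.run .unit) := by
  cases ProcTyped.nuRef_iff.1 h with | locked h =>
  have := h.ref_inv.2.comap (r := Ren.shiftRef)
  rw [Env.comap_extRef_shift] at this
  exact .run (.unit this) rfl

/-- The intermediate annotations play no role: `v` has type `T`, which is below `W`, which is below
what the context expects. This covers dynamic types and dynamic session types alike. -/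
theorem ProcTyped.collapse {Γ : Env} {E : ECtx} {v : Exp} {T U V W : Ty} {p q : BLabel}
    (hs : Sub T W) (h : ProcTyped Γ (.run (E.fill (.cast (.cast v T p U) V q W)))) :
    ProcTyped Γ (.run (E.fill v)) := by
  cases h with | run h hT =>
  obtain ⟨A, B, _, hAB, he, hE⟩ := ECtx.hasType_fill h
  obtain ⟨he, _, hU⟩ := he.cast_inv
  exact .run (hE hAB ((he.cast_inv.1.sub hs).sub hU)) hT

theorem ProcTyped.collide {Γ : Env} {E : ECtx} {v : Exp} {T U V W : Ty} {p p' q q' : BLabel}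
    (hΓ : Γ.Running) (h : ProcTyped Γ (.run (E.fill (.cast (.cast v T p U) V q W)))) :
    ProcTyped Γ (.blame p' q' (E.flv ∪ v.flv)) := by
  cases h with | run h hT =>
  exact .blame (h.flv_fill hΓ)

/-- The endpoints are the free endpoints of the two redexes, so the blame set is the union of those
of the threads. The session type of the restriction can be kept. -/
theorem ProcTyped.collideChan {Γ : Env} {E F : ECtx} {T U V W : Ty} {p q p' q' : BLabel}
    (hΓ : Γ.Running)
    (h : ProcTyped Γ (.nuChan (.par (.run (E.fill (.cast endC T p U)))
      (.run (F.fill (.cast endD V q W)))))) :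
    ProcTyped Γ (.nuChan (.blame p' q' (E.flv ∪ F.flv ∪ {.chan 0, .chan 1}))) := by
  obtain ⟨S, h⟩ := ProcTyped.nuChan_iff.1 h
  obtain ⟨A, B, hs, hA, hB⟩ := ProcTyped.par_iff.1 h
  cases hA with | run hA _ =>
  cases hB with | run hB _ =>
  refine .nuChan S (.blame ?_)
  have hΓ' := hΓ.extChan S S.dual
  rw [hs.flv, hA.flv_fill (hΓ'.left hs), hB.flv_fill (hΓ'.right hs)]
  ext z
  simp only [Exp.flv, Finset.coe_union, Finset.coe_insert, Finset.coe_singleton, Set.mem_union,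
    Set.mem_insert_iff, Set.mem_singleton_iff]
  tauto

/-- The environment is general because the induction goes under restrictions and into parts of
parallel compositions. The running condition is stable under both. -/
theorem Red.procTyped {P Q : Proc} (h : Red P Q) : ∀ {Γ : Env}, Γ.Running → P.RegularCasts →
    ProcTyped Γ P → ProcTyped Γ Q := by
  induction h with
  | fork => exact fun _ _ h => h.fork
  | new => exact fun _ _ h => h.new
  | comm => exact fun _ _ h => h.comm
  | choose j => exact fun _ _ h => h.choose j
  | close => exact fun _ _ h => h.close
  | par _ ih =>
    intro Γ hΓ hr h
    obtain ⟨A, B, hs, h₁, h₂⟩ := ProcTyped.par_iff.1 h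
    exact .par hs (ih (hΓ.left hs) hr.1 h₁) h₂
  | nuChan _ ih =>
    intro Γ hΓ hr h
    obtain ⟨S, h⟩ := ProcTyped.nuChan_iff.1 h
    exact .nuChan S (ih (hΓ.extChan _ _) hr h)
  | nuRef _ ih =>
    intro Γ hΓ hr h
    exact .nuRef (ih hΓ.extRef hr (ProcTyped.nuRef_iff.1 h))
  | cong h₁ _ h₂ ih =>
    intro Γ hΓ hr h
    -- Regularity has to be carried along the congruence too, since the inner reduction may contain
    -- a cast of a pair.
    exact (h₂.procTyped Γ).1 (ih hΓ (h₁.regularCasts.1 hr) ((h₁.procTyped Γ).1 h))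
  | step hst =>
    intro Γ hΓ hr h
    cases h with | run h hT =>
    obtain ⟨A, B, _, hs, he, hE⟩ := ECtx.hasType_fill h
    exact .run (hE hs (hst.hasType (ECtx.regularCasts_fill hr).1 he)) hT
  | alloc hv hG _ => exact fun _ _ h => h.alloc hv hG
  | access => exact fun _ _ h => h.access
  | accessLocked => exact fun hΓ _ h => h.accessLocked hΓ
  | gcLocked => exact fun _ _ h => h.gcLocked
  | gcStore => exact fun hΓ _ h => h.gcStore hΓ
  | collapse _ hs => exact fun _ _ h => h.collapse hs
  | collide => exact fun hΓ _ h => h.collide hΓ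
  | collapseSess _ hs => exact fun _ _ h => h.collapse hs
  | collideSess => exact fun hΓ _ h => h.collide hΓ
  | collapseChan hs => exact fun _ _ h => h.collapseChan hs
  | collideChan => exact fun hΓ _ h => h.collideChan hΓ

-- Regularity under process reduction

theorem ECtx.regularCasts_fill_rename {E : ECtx} {e f : Exp} {r : Ren}
    (h : (E.fill e).RegularCasts) (hf : f.RegularCasts) :
    ((E.rename r).fill f).RegularCasts := by
  have : ((E.rename r).fill (e.rename r)).RegularCasts := by
    rw [← ECtx.fill_rename]
    exact (Exp.regularCasts_rename r).2 h
  exact (ECtx.regularCasts_fill this).2 hf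

theorem ECtx.regularCasts_fill_of_rename {E : ECtx} {e : Exp} {r : Ren}
    (h : ((E.rename r).fill e).RegularCasts) : (E.fill .unit).RegularCasts := by
  rw [← Exp.regularCasts_rename r, ECtx.fill_rename]
  exact (ECtx.regularCasts_fill h).2 trivial

theorem Red.regularCasts {P Q : Proc} (h : Red P Q) : P.RegularCasts → Q.RegularCasts := by
  induction h with
  | fork =>
    intro h
    obtain ⟨he, hE⟩ := ECtx.regularCasts_fill h
    exact ⟨hE trivial, he⟩
  | new => exact fun h => ECtx.regularCasts_fill_rename h ⟨trivial, trivial⟩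
  | comm =>
    rintro ⟨hE, hF⟩
    obtain ⟨he, hE⟩ := ECtx.regularCasts_fill hE
    exact ⟨hE trivial, (ECtx.regularCasts_fill hF).2 ⟨he.1, trivial⟩⟩
  | choose j =>
    rintro ⟨hE, hF⟩
    obtain ⟨hf, hF⟩ := ECtx.regularCasts_fill hF
    exact ⟨(ECtx.regularCasts_fill hE).2 trivial, hF ((hf.2 j).subst1 trivial)⟩
  | close =>
    rintro ⟨hE, hF⟩
    exact ⟨ECtx.regularCasts_fill_of_rename hE, ECtx.regularCasts_fill_of_rename hF⟩
  | par _ ih => exact fun h => ⟨ih h.1, h.2⟩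
  | nuChan _ ih => exact ih
  | nuRef _ ih => exact ih
  | cong h₁ _ h₂ ih => exact fun h => h₂.regularCasts.1 (ih (h₁.regularCasts.1 h))
  | step hst =>
    intro h
    obtain ⟨he, hE⟩ := ECtx.regularCasts_fill h
    exact hE (hst.regularCasts he)
  | alloc =>
    intro h
    exact ⟨ECtx.regularCasts_fill_rename h trivial,
      (Exp.regularCasts_rename _).2 (ECtx.regularCasts_fill h).1.1⟩
  | access =>
    rintro ⟨hE, hv⟩
    -- The cast kept in the store reappears in the thread; its annotations are a ground type and the
    -- dynamic type, both regular.
    exact ⟨(ECtx.regularCasts_fill hE).2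
      ⟨⟨hv, Ground.regular _, trivial⟩, trivial, Ground.regular _⟩, trivial⟩
  | accessLocked => exact fun _ => ⟨trivial, trivial⟩
  | gcLocked => exact fun _ => trivial
  | gcStore => exact fun _ => trivial
  | collapse =>
    intro h
    obtain ⟨he, hE⟩ := ECtx.regularCasts_fill h
    exact hE he.1.1
  | collide => exact fun _ => trivial
  | collapseSess =>
    intro h
    obtain ⟨he, hE⟩ := ECtx.regularCasts_fill h
    exact hE he.1.1
  | collideSess => exact fun _ => trivial
  | collapseChan =>
    rintro ⟨hE, hF⟩
    exact ⟨(ECtx.regularCasts_fill hE).2 trivial, (ECtx.regularCasts_fill hF).2 trivial⟩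
  | collideChan => exact fun _ => trivial

end GGV

theorem mainTheorem1 (Γ : GGV.Env) (P Q : GGV.Proc) (hΓ : Γ.Running) (hP : P.RegularCasts)
    (hred : GGV.Red P Q) (hty : GGV.ProcTyped Γ P) :
    GGV.ProcTyped Γ Q ∧ Q.RegularCasts :=
  ⟨hred.procTyped hΓ hP hty, hred.regularCasts hP⟩
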